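/- Let $P\subset\mathbb{R}^2$ be a set of $n\ge 1$ points, and let $h$ and $v$ be the numbers of horizontal and of vertical lines that contain points of $P$ (so $h,v\le n$). The rectilinear TSP asks for an order in which to visit every point of $P$ exactly once and return to the start, with minimum total $\ell_1$ length. Let $\Gamma(P)$ be the Hanan grid of $P$: its vertices are the $hv$ intersections of these lines, and its segments join neighbouring intersections. Consider the following dynamic program. The segments are treated one after the other, from left to right, the segments of a vertical line before the horizontal segments to its right, and each of these groups from bottom to top; each segment may be used zero times, once or twice. The frontier consists of one vertex on each horizontal line, the rightmost one reached so far. A state records, for every frontier vertex, whether its degree is zero, even and positive, or odd, and how the frontier vertices of positive degree are distributed over connected components. A state is rejected if a vertex that leaves the frontier has odd degree or is a point of $P$ of degree zero, or if a component loses its last frontier vertex. For each state of a layer, a shortest partial subgraph that leads to it is kept. At the end, the vertices of the last vertical line must have even degree, and positive degree if they are in $P$, and there must be only one component. A shortest subgraph obtained is turned into an order of the points of $P$ by means of an Eulerian circuit and shortcuts. (If $n=1$, the point is returned directly.) Let $\Omega(h)$ be the set of all states on $h$ vertices in which the components form a non-crossing partition of the vertices of positive degree and every component has an even number of vertices of odd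 degree. Then: 1. $|\Omega(h)| = O\!\left(\dfrac{(4+\sqrt8)^{h+1}}{(h+1)^{3/2}}\right)$ as $h\to\infty$. 2. There are exactly $2hv-h-v$ segments to treat, and after each number of treated segments, all states of the current layer belong to $\Omega(h)$; their number (as stored, counted with multiplicity) is at most $|\Omega(h)|$. 3. Given the points of $P$ as a list sorted by abscissa, the algorithm builds $\Gamma(P)$, runs the dynamic program and returns an order of the points of $P$ that is an optimal solution of the rectilinear TSP. It takes $O(nh\,7^h)$ steps, with an absolute constant, on a random access machine that handles integers and real numbers in unit time (reading, writing, comparing, adding, subtracting); the construction of the grid, all operations on states, the table look-ups and the extraction of the tour are counted. -/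

import Mathlib

open Asymptotics Filter

namespace RTSP

/-! ### Step counting

The model is a random access machine that handles integers and coordinates (real numbers) as atomic
words. One step is one read, write, comparison, addition or subtraction, up to a fixed number of
them at a time; every loop pays for each of its rounds, and whatever touches all entries of an array
pays the length of the array. A function out of a finite type stands for an array. -/

/-- A result together with the number of elementary steps spent on it. -/
structure Counted (α : Type) where
  val : α
  steps : ℕ

instance : Monad Counted where
  pure a := ⟨a, 0⟩
  bind m f := ⟨(f m.val).val, m.steps + (f m.val).steps⟩

/-- Spend `k` steps. -/
def tick (k : ℕ) : Counted Unit := ⟨(), k⟩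

/-! ### The problem -/

section Problem
variable {K : Type} [Field K] [LinearOrder K]

/-- The rectilinear distance of two points of the plane. -/
def dist1 (p q : K × K) : K := |p.1 - q.1| + |p.2 - q.2|

/-- The length of the closed tour that visits the points of a list in order and then returns to
the first one. -/
def tourLength (l : List (K × K)) : K := (List.zipWith dist1 l (l.rotate 1)).sum

end Problem

/-- The list `σ` contains every point of `P` exactly once, and no other points: the points of `P` in
some order. -/
def Enumerates (σ : List (ℝ × ℝ)) (P : Finset (ℝ × ℝ)) : Prop :=
  σ.Nodup ∧ ∀ p, p ∈ σ ↔ p ∈ P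

/-! ### The Hanan grid -/

/-- A grid with `h` horizontal and `v` vertical lines: the ordinates of the horizontal lines from
bottom to top, the abscissae of the vertical lines from left to right, and for each intersection
`(i, j)` of the `i`-th horizontal with the `j`-th vertical line whether it must be visited. -/
structure Grid (K : Type) (h v : ℕ) where
  y : Fin h → K
  x : Fin v → K
  mand : Fin h → Fin v → Bool

open Classical in
/-- The number of horizontal lines that contain points of `P`. -/
noncomputable def numRows (P : Finset (ℝ × ℝ)) : ℕ := (P.image Prod.snd).card

open Classical in
/-- The number of vertical lines that contain points of `P`. -/
noncomputable def numCols (P : Finset (ℝ × ℝ)) : ℕ := (P.image Prod.fst).card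

open Classical in
/-- The Hanan grid of `P`, the points of `P` being the vertices to visit. -/
noncomputable def hanan (P : Finset (ℝ × ℝ)) : Grid ℝ (numRows P) (numCols P) where
  y := (P.image Prod.snd).orderEmbOfFin rfl
  x := (P.image Prod.fst).orderEmbOfFin rfl
  mand i j := decide
    (((P.image Prod.fst).orderEmbOfFin rfl j, (P.image Prod.snd).orderEmbOfFin rfl i) ∈ P)

/-- Vertex `(i, j)` lies on the `i`-th horizontal and the `j`-th vertical line. -/
abbrev Vertex (h v : ℕ) := Fin h × Fin v

/-- A segment between neighbouring vertices. -/
inductive Edge (h v : ℕ) where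
  /-- between `(i, j)` and `(i', j)`, where `i' = i + 1` -/
  | vert (i i' : Fin h) (j : Fin v)
  /-- between `(i, j)` and `(i, j')`, where `j' = j + 1` -/
  | horiz (i : Fin h) (j j' : Fin v)

namespace Edge
variable {h v : ℕ}

def src : Edge h v → Vertex h v
  | vert i _ j => (i, j)
  | horiz i j _ => (i, j)

def dst : Edge h v → Vertex h v
  | vert _ i' j => (i', j)
  | horiz i _ j' => (i, j')

def length {K : Type} [Field K] (I : Grid K h v) : Edge h v → K
  | vert i i' _ => I.y i' - I.y i
  | horiz _ j j' => I.x j' - I.x j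

end Edge

/-- The vertical segments on the `j`-th vertical line, from bottom to top. -/
def vertEdges (h v : ℕ) (j : Fin v) : List (Edge h v) :=
  (List.finRange h).filterMap fun i =>
    if hi : i.val + 1 < h then some (.vert i ⟨i.val + 1, hi⟩ j) else none

/-- The horizontal segments that start on the `j`-th vertical line, from bottom to top. -/
def horizEdges (h v : ℕ) (j : Fin v) : List (Edge h v) :=
  if hj : j.val + 1 < v then
    (List.finRange h).map fun i => .horiz i j ⟨j.val + 1, hj⟩
  else []

/-- All segments of the grid in the order in which they are treated: from left to right, the
segments of a vertical line before the horizontal segments to its right, and each of these groups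
from bottom to top. -/
def edges (h v : ℕ) : List (Edge h v) :=
  (List.finRange v).flatMap fun j => vertEdges h v j ++ horizEdges h v j

/-! ### States -/

/-- The information on one frontier vertex: `none` if it has degree zero, otherwise whether its
degree is odd and the name of its connected component. A component is named after the lowest
frontier vertex that belongs to it. -/
abbrev Cell (h : ℕ) := Option (Bool × Fin h)

/-- The information on the frontier, which has one vertex on each horizontal line. -/
abbrev State (h : ℕ) := Fin h → Cell h

/-- The component of the `i`-th frontier vertex, if it has positive degree. -/
def comp {h : ℕ} (ω : State h) (i : Fin h) : Option (Fin h) := (ω i).map Prod.snd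

/-- Valid states: components are named after their lowest vertex, they form a non-crossing
partition of the vertices of positive degree, and each of them has an even number of vertices of
odd degree. -/
def IsState {h : ℕ} (ω : State h) : Prop :=
  (∀ i c, comp ω i = some c → c ≤ i ∧ comp ω c = some c) ∧
  (∀ a b c d, a < b → b < c → c < d → (comp ω a).isSome → (comp ω b).isSome →
    comp ω a = comp ω c → comp ω b = comp ω d → comp ω a = comp ω b) ∧
  (∀ c, Even (Finset.univ.filter fun i => ω i = some (true, c)).card)

instance {h : ℕ} : DecidablePred (IsState (h := h)) := fun ω => by
  unfold IsState
  infer_instance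

/-- The set of all valid states on `h` horizontal lines. -/
def Omega (h : ℕ) : Finset (State h) := Finset.univ.filter IsState

/-! ### Transitions

Each function returns the new state, or nothing if the new state is rejected. -/

/-- Give one common name to the components `a` and `b`. -/
def merge {h : ℕ} (a b : Fin h) (ω : State h) : State h :=
  fun k => (ω k).map fun pc => (pc.1, if pc.2 = a ∨ pc.2 = b then min a b else pc.2)

/-- Add `m` copies of the vertical edge between the frontier vertices `i` and `i'`. -/
def addVert {h : ℕ} (i i' : Fin h) (m : Fin 3) (ω : State h) : Counted (Option (State h)) := do
  tick 1
  if m = 0 then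
    return some ω
  else
    let c := (ω i).getD (false, i)
    let c' := (ω i').getD (false, i')
    -- copy the state and overwrite two entries
    tick (h + 2)
    let ω₁ := Function.update (Function.update ω i (some (c.1 ^^ decide (m = 1), c.2)))
      i' (some (c'.1 ^^ decide (m = 1), c'.2))
    -- rename
    tick h
    return some (merge c.2 c'.2 ω₁)

/-- Remove the frontier vertex `i`, which has positive degree and lies in component `c`. If the
component has no other frontier vertex, then the partial subgraph cannot be completed to a connected
one, and the state is rejected. -/
def removeVertex {h : ℕ} (i c : Fin h) (ω : State h) : Counted (Option (State h)) := do
  -- copy the state and overwrite an entry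
  tick (h + 1)
  let ω₁ := Function.update ω i none
  if c = i then
    -- search for the next vertex of the component
    tick h
    match (List.finRange h).find? (fun k => comp ω₁ k = some i) with
    | none => return none
    | some k =>
      -- rename
      tick h
      return some fun l => (ω₁ l).map fun pc => (pc.1, if pc.2 = i then k else pc.2)
  else
    return some ω₁

/-- Add `m` copies of the horizontal edge on line `i` between the frontier vertex, which leaves the
frontier, and its right neighbour, which replaces it. The edge is the last one at the leaving vertex,
which must have even degree, and positive degree if it has to be visited (`mand`). -/
def addHoriz {h : ℕ} (mand : Bool) (i : Fin h) (m : Fin 3) (ω : State h) :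
    Counted (Option (State h)) := do
  tick 1
  match m, ω i with
  | 0, none => return if mand then none else some ω
  | 0, some (false, c) => removeVertex i c ω
  | 0, some (true, _) => return none
  | 1, some (true, _) => return some ω
  | 1, _ => return none
  | 2, none =>
    tick (h + 1)
    return some (Function.update ω i (some (false, i)))
  | 2, some (false, _) => return some ω
  | 2, some (true, _) => return none

/-- Add `m` copies of the edge `e`. -/
def transition {K : Type} {h v : ℕ} (I : Grid K h v) (e : Edge h v) (m : Fin 3) (ω : State h) :
    Counted (Option (State h)) :=
  match e with
  | .vert i i' _ => addVert i i' m ω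
  | .horiz i j _ => addHoriz (I.mand i j) i m ω

/-- The conditions on a state of the last layer: the vertices of the rightmost vertical line have
even degree, and positive degree if they have to be visited, and there is only one component. -/
def IsFinal {K : Type} {h v : ℕ} (I : Grid K h v) (ω : State h) : Prop :=
  (∀ i (j : Fin v), j.val + 1 = v → I.mand i j = true → ω i ≠ none) ∧
  (∀ i c, ω i ≠ some (true, c)) ∧
  (∀ i k, (ω i).isSome → (ω k).isSome → comp ω i = comp ω k)

instance {K : Type} {h v : ℕ} (I : Grid K h v) : DecidablePred (IsFinal I) := fun ω => by
  unfold IsFinal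
  infer_instance

/-! ### Tables -/

/-- A table indexed by words over the alphabet `A`, stored as a tree whose nodes carry an array of
children indexed by `A`. -/
inductive Trie (A V : Type) where
  | empty : Trie A V
  | node (val : Option V) (child : A → Trie A V) : Trie A V

namespace Trie
variable {A V : Type}

def find : Trie A V → List A → Counted (Option V)
  | empty, _ => do
    tick 1
    return none
  | node o _, [] => do
    tick 1
    return o
  | node _ c, a :: w => do
    tick 1
    find (c a) w

/-- Write an entry. A new node costs its number of children. -/
def insert [Fintype A] [DecidableEq A] (x : V) : Trie A V → List A → Counted (Trie A V)
  | empty, [] => do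
    tick (1 + Fintype.card A)
    return node (some x) fun _ => empty
  | empty, a :: w => do
    tick (1 + Fintype.card A)
    let t ← insert x empty w
    return node none (Function.update (fun _ => empty) a t)
  | node _ c, [] => do
    tick 1
    return node (some x) c
  | node o c, a :: w => do
    tick 1
    let t ← insert x (c a) w
    return node o (Function.update c a t)

end Trie

/-! ### The dynamic program -/

/-- A layer: the list of the states found, and a table with, for each of them, the length of the
best partial subgraph found and the list of its edges (twice, if doubled). Lists are linked lists,
which share their tails. -/
structure Layer (K : Type) (h v : ℕ) where
  states : List (State h)
  table : Trie (Cell h) (K × List (Edge h v))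

section Algorithm
variable {K : Type} [Field K] [LinearOrder K] {h v : ℕ}

/-- Record that the state `ω` is reached by the partial subgraph `T` of length `len`. -/
def record (ω : State h) (len : K) (T : List (Edge h v)) (L : Layer K h v) :
    Counted (Layer K h v) := do
  -- read the state as a word
  tick (h + 1)
  let w := List.ofFn ω
  match ← L.table.find w with
  | some old =>
    tick 1
    if len < old.1 then
      let t ← L.table.insert (len, T) w
      return { L with table := t }
    else
      return L
  | none =>
    tick 1
    let t ← L.table.insert (len, T) w
    return { states := ω :: L.states, table := t }

/-- The layer that follows the layer `L`, when the edge `e` is treated. -/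
def nextLayer (I : Grid K h v) (L : Layer K h v) (e : Edge h v) : Counted (Layer K h v) := do
  tick 1
  L.states.foldlM (init := ⟨[], .empty⟩) fun L' ω => do
    tick (h + 1)
    match ← L.table.find (List.ofFn ω) with
    | none => return L'
    | some (len, T) =>
      [0, 1, 2].foldlM (init := L') fun L'' (m : Fin 3) => do
        tick 1
        match ← transition I e m ω with
        | none => return L''
        | some ω' =>
          tick 4
          record ω' (len + m.val • e.length I) (List.replicate m.val e ++ T) L''

/-- The first layer has one state, without edges. -/
def firstLayer : Counted (Layer K h v) := do
  tick h
  record (fun _ => none) 0 [] ⟨[], .empty⟩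

/-- The layer reached after the first `l` edges. -/
def layer (I : Grid K h v) (l : ℕ) : Counted (Layer K h v) := do
  let L ← firstLayer
  ((edges h v).take l).foldlM (nextLayer I) L

/-- The best entry of the last layer: the length of a subgraph and the list of its edges. -/
def best (I : Grid K h v) (L : Layer K h v) : Counted (Option (K × List (Edge h v))) :=
  L.states.foldlM (init := none) fun b ω => do
    -- test the final conditions
    tick (h * h + 2 * h + 1)
    if IsFinal I ω then
      tick (h + 1)
      match b, ← L.table.find (List.ofFn ω) with
      | none, r => return r
      | some b, none => return some b
      | some b, some r => return some (if r.1 < b.1 then r else b)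
    else
      return b

/-- A shortest tour subgraph, with its length. -/
def tourSubgraph (I : Grid K h v) : Counted (Option (K × List (Edge h v))) := do
  let L ← layer I (edges h v).length
  best I L

/-! ### From a tour subgraph to a tour -/

/-- A multigraph on the grid, given by the number of copies of each edge. Only neighbouring vertices
can be joined: for each vertex an array with four entries is stored. -/
abbrev Multi (h v : ℕ) := Vertex h v → Vertex h v → ℕ

/-- Change the number of copies of an edge. -/
def Multi.modify (f : ℕ → ℕ) (u w : Vertex h v) (M : Multi h v) : Multi h v :=
  fun a b => if (a = u ∧ b = w) ∨ (a = w ∧ b = u) then f (M a b) else M a b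

/-- The multigraph with a given list of edges. -/
def multi (T : List (Edge h v)) : Counted (Multi h v) := do
  tick (4 * (h * v))
  T.foldlM (init := fun _ _ => 0) fun M e => do
    tick 2
    return M.modify (· + 1) e.src e.dst

/-- The at most four neighbours of a vertex of the grid. -/
def neighbours (u : Vertex h v) : List (Vertex h v) :=
  (if hi : u.1.val + 1 < h then [(⟨u.1.val + 1, hi⟩, u.2)] else []) ++
  (if 0 < u.1.val then [(⟨u.1.val - 1, by have := u.1.isLt; omega⟩, u.2)] else []) ++
  (if hj : u.2.val + 1 < v then [(u.1, ⟨u.2.val + 1, hj⟩)] else []) ++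
  (if 0 < u.2.val then [(u.1, ⟨u.2.val - 1, by have := u.2.isLt; omega⟩)] else [])

/-- Search of an Eulerian circuit with a stack: walk along unused edges as long as possible, and
move the top of the stack to the circuit when no unused edge is left there. The first argument
bounds the number of rounds. -/
def euler : ℕ → List (Vertex h v) → Multi h v → List (Vertex h v) → Counted (List (Vertex h v))
  | 0, _, _, circuit => return circuit
  | _ + 1, [], _, circuit => do
    tick 1
    return circuit
  | k + 1, u :: stack, M, circuit => do
    tick 5
    match (neighbours u).find? (fun w => 0 < M u w) with
    | some w =>
      tick 3
      euler k (w :: u :: stack) (M.modify (· - 1) u w) circuit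
    | none =>
      tick 1
      euler k stack M (u :: circuit)

/-- The vertices to visit on a walk, each of them when it is met for the first time. -/
def shortcut (I : Grid K h v) : (Vertex h v → Bool) → List (Vertex h v) → Counted (List (K × K))
  | _, [] => do
    tick 1
    return []
  | seen, u :: l => do
    tick 3
    if I.mand u.1 u.2 = true ∧ seen u = false then
      tick 2
      let r ← shortcut I (Function.update seen u true) l
      return (I.x u.2, I.y u.1) :: r
    else
      shortcut I seen l

/-- The tour computed for a grid. A grid with a single vertex, which has no edges, is treated
separately. -/
def solve (I : Grid K h v) : Counted (List (K × K)) := do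
  tick 1
  if h = 1 ∧ v = 1 then
    tick 1
    return (List.finRange h).flatMap fun i => (List.finRange v).map fun j => (I.x j, I.y i)
  else
    match ← tourSubgraph I with
    | none => return []
    | some (_, []) => return []
    | some (_, e :: T) =>
      let M ← multi (e :: T)
      let circuit ← euler (8 * (h * v) + 1) [e.src] M []
      tick (h * v)
      shortcut I (fun _ => false) circuit

/-! ### The algorithm on a list of points -/

/-- Insert a number into an increasing list, unless it is there. -/
def insertRow (a : K) : List K → Counted (List K)
  | [] => do
    tick 1
    return [a]
  | b :: l => do
    tick 1
    if a < b then
      return a :: b :: l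
    else if a = b then
      return b :: l
    else
      let l' ← insertRow a l
      return b :: l'

/-- The ordinates that occur, in increasing order. -/
def rows (pts : List (K × K)) : Counted (List K) :=
  pts.foldlM (init := []) fun l p => do
    tick 1
    insertRow p.2 l

/-- The abscissae that occur in a list of points sorted by abscissa, in increasing order. -/
def cols : List (K × K) → Counted (List K)
  | [] => do
    tick 1
    return []
  | p :: l => do
    tick 1
    let xs ← cols l
    match xs with
    | [] => return [p.1]
    | a :: _ => return if p.1 = a then xs else p.1 :: xs

/-- Mark the intersections at which the points of a list sorted by abscissa lie, given the abscissa
and the number of the current vertical line. For each point, the `h` entries of one vertical line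
are scanned. -/
def mark (y : Fin h → K) : K → ℕ → List (K × K) → (Fin h → ℕ → Bool) →
    Counted (Fin h → ℕ → Bool)
  | _, _, [], M => do
    tick 1
    return M
  | a, j, p :: l, M => do
    tick (h + 2)
    let j' := if p.1 = a then j else j + 1
    mark y p.1 j' l fun i k => M i k || decide (k = j' ∧ y i = p.2)

/-- The Hanan grid of a list of points sorted by abscissa, with its numbers of lines. -/
def buildGrid (pts : List (K × K)) : Counted (Σ h v : ℕ, Grid K h v) := do
  let ys ← rows pts
  let xs ← cols pts
  -- copy the lists of coordinates into arrays, and set all marks to `false`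
  tick (ys.length + xs.length + ys.length * xs.length)
  let M ← mark ys.get ((pts.map Prod.fst).headD 0) 0 pts fun _ _ => false
  return ⟨ys.length, xs.length, ⟨ys.get, xs.get, fun i j => M i j.val⟩⟩

/-- The whole algorithm, for a list of points sorted by abscissa. -/
def tsp (pts : List (K × K)) : Counted (List (K × K)) := do
  let G ← buildGrid pts
  solve G.2.2

end Algorithm

end RTSP

/-! The optimum is matched with a shortest tour subgraph: an even connected multigraph on the grid
that contains the points. From a tour, consecutive points are joined by grid walks of the same ℓ1
length (`exists_edgeWalk`). Their union is even and connected, and pairs of copies of a segment can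
be dropped until at most two remain (`exists_reduced`). Conversely, an Eulerian circuit of a tour
subgraph (`euler_spec`), shortened by the triangle inequality (`tourLength_le_walkLength`), gives a
tour that is not longer.

The dynamic program finds a shortest tour subgraph for three reasons. Transitions see a partial
subgraph only through its state, so keeping one shortest representative per state loses nothing
(`Represents.nextLayer`). A state really describes degrees and connectivity on the frontier, while
the vertices already passed are even, covered and attached to the frontier (`Path.describes`); hence
the final test recognises exactly the tour subgraphs (`Describes.isFinal_iff`). Finally, a partial
subgraph of a tour subgraph is never rejected: no later segment touches a vertex that has left the
frontier, and a component cut off from the frontier could not reach the point on the last vertical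
line (`Describes.exists_transition`).

All states are valid because a vertical segment merges the blocks of two adjacent vertices, which
cannot create a crossing (`IsPartition.merge`), and changes two parities inside one resulting
component.

For the count, a valid state is encoded by a Motzkin path whose height is the number of open
components, with two kinds of up steps, four kinds of level steps and one kind of down step
(`drop_letters_mem_words`). Non-crossing makes the encoding injective; the parity of the highest
vertex of a component is omitted, since the others determine it (`letter_injOn`). Removing the level
steps leaves weighted ballot paths, counted by `2 ^ d` times a Catalan number (`ballot_reflection`).
The estimate of central binomial coefficients and the binomial theorem then give the bound
(`motzkin_le`).

The running time is the number of segments times the number of states times `O((h + 1) ^ 2)` per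
state. As `4 + √8 < 7`, the polynomial factor is absorbed by `7 ^ h` (`exists_mul_card_Omega_le`).
-/

namespace RTSP

/-! ### Counted computations -/

namespace Counted
variable {α β : Type}

@[simp] theorem val_pure (a : α) : (pure a : Counted α).val = a := rfl
@[simp] theorem steps_pure (a : α) : (pure a : Counted α).steps = 0 := rfl
@[simp] theorem val_bind (m : Counted α) (f : α → Counted β) :
    (m >>= f).val = (f m.val).val := rfl
@[simp] theorem steps_bind (m : Counted α) (f : α → Counted β) :
    (m >>= f).steps = m.steps + (f m.val).steps := rfl

theorem val_foldlM (f : β → α → Counted β) (l : List α) (b : β) :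
    (l.foldlM f b).val = l.foldl (fun b a => (f b a).val) b := by
  induction l generalizing b with
  | nil => rfl
  | cons a l ih => simp [ih]

/-- Invariant and cost are treated together because the cost of a round may depend on the invariant,
for instance on the size of the accumulated layer. -/
theorem foldlM_induction {f : β → α → Counted β} (p : β → Prop) (B : ℕ) (l : List α)
    (hf : ∀ b, ∀ a ∈ l, p b → p (f b a).val ∧ (f b a).steps ≤ B) (b : β) (hb : p b) :
    p (l.foldlM f b).val ∧ (l.foldlM f b).steps ≤ l.length * B := by
  induction l generalizing b with
  | nil => simpa using hb
  | cons a l ih =>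
    have h1 := hf b a (by simp) hb
    have h2 := ih (fun b' a' ha' => hf b' a' (by simp [ha'])) (f b a).val h1.1
    simp only [List.foldlM_cons, val_bind, steps_bind, List.length_cons]
    refine ⟨h2.1, ?_⟩
    rw [add_mul]
    omega

end Counted

@[simp] theorem val_tick (k : ℕ) : (tick k).val = () := rfl
@[simp] theorem steps_tick (k : ℕ) : (tick k).steps = k := rfl

/-! ### Tables -/

namespace Trie
variable {A V : Type}

@[simp] theorem find_empty (w : List A) : ((empty : Trie A V).find w).val = none := by
  cases w <;> simp [find]

theorem steps_find_le (t : Trie A V) (w : List A) : (t.find w).steps ≤ w.length + 1 := by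
  induction w generalizing t with
  | nil => cases t <;> simp [find]
  | cons a w ih =>
    cases t with
    | empty => simp [find]
    | node o c =>
      have := ih (c a)
      simp [find]
      omega

variable [Fintype A] [DecidableEq A]

theorem find_insert (x : V) (t : Trie A V) (w w' : List A) :
    ((t.insert x w).val.find w').val = if w' = w then some x else (t.find w').val := by
  induction w generalizing t w' with
  | nil =>
    cases t <;> cases w' <;> simp [insert, find]
  | cons a w ih =>
    cases t with
    | empty =>
      cases w' with
      | nil => simp [insert, find]
      | cons b w' =>
        by_cases hb : b = a
        · subst hb
          simp [insert, find, ih]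
        · simp [insert, find, hb]
    | node o c =>
      cases w' with
      | nil => simp [insert, find]
      | cons b w' =>
        by_cases hb : b = a
        · subst hb
          simp [insert, find, ih]
        · simp [insert, find, hb]

/-- Each prefix of the word creates at most one node, and a new node costs its array of children. -/
theorem steps_insert_le (x : V) (t : Trie A V) (w : List A) :
    (t.insert x w).steps ≤ (w.length + 1) * (1 + Fintype.card A) := by
  induction w generalizing t with
  | nil => cases t <;> simp [insert]
  | cons a w ih =>
    cases t with
    | empty =>
      have := ih empty
      simp only [insert, Counted.steps_bind, steps_tick, Counted.steps_pure, List.length_cons]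
      rw [add_mul (w.length + 1)]
      omega
    | node o c =>
      have := ih (c a)
      simp only [insert, Counted.steps_bind, steps_tick, Counted.steps_pure, List.length_cons]
      rw [add_mul (w.length + 1)]
      omega

end Trie

/-! ### Layers -/

section Layers
variable {h v : ℕ}

/-- The total length of a list of segments. -/
noncomputable def edgeLength (I : Grid ℝ h v) (T : List (Edge h v)) : ℝ := (T.map (Edge.length I)).sum

@[simp] theorem edgeLength_nil (I : Grid ℝ h v) : edgeLength I [] = 0 := rfl

theorem edgeLength_cons (I : Grid ℝ h v) (e : Edge h v) (T : List (Edge h v)) :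
    edgeLength I (e :: T) = e.length I + edgeLength I T := by
  simp [edgeLength]

theorem edgeLength_append (I : Grid ℝ h v) (S T : List (Edge h v)) :
    edgeLength I (S ++ T) = edgeLength I S + edgeLength I T := by
  simp [edgeLength]

theorem edgeLength_replicate (I : Grid ℝ h v) (e : Edge h v) (m : ℕ) :
    edgeLength I (List.replicate m e) = m • e.length I := by
  simp [edgeLength]

/-- The entry of a layer for a state. -/
def Layer.lookup (L : Layer ℝ h v) (ω : State h) : Option (ℝ × List (Edge h v)) :=
  (L.table.find (List.ofFn ω)).val

/-- The layer `L` holds, for each state that occurs in the relation `R`, a shortest list of segments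
related to it. -/
structure Represents (I : Grid ℝ h v) (L : Layer ℝ h v)
    (R : List (Edge h v) → State h → Prop) : Prop where
  nodup : L.states.Nodup
  mem_iff : ∀ ω, ω ∈ L.states ↔ ∃ r, L.lookup ω = some r
  sound : ∀ ω len T, L.lookup ω = some (len, T) → R T ω ∧ len = edgeLength I T
  optimal : ∀ T ω, R T ω → ∃ len T', L.lookup ω = some (len, T') ∧ len ≤ edgeLength I T

theorem Represents.empty (I : Grid ℝ h v) :
    Represents I ⟨[], .empty⟩ fun _ _ => False where
  nodup := List.nodup_nil
  mem_iff := by simp [Layer.lookup]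
  sound := by simp [Layer.lookup]
  optimal := by simp

/-- The exchange argument enters here: `R` may be much smaller than `R'`, as long as it dominates
`R'` at every state. -/
theorem Represents.congr {I : Grid ℝ h v} {L : Layer ℝ h v}
    {R R' : List (Edge h v) → State h → Prop} (hL : Represents I L R)
    (h1 : ∀ T ω, R T ω → R' T ω)
    (h2 : ∀ T ω, R' T ω → ∃ T', R T' ω ∧ edgeLength I T' ≤ edgeLength I T) :
    Represents I L R' where
  nodup := hL.nodup
  mem_iff := hL.mem_iff
  sound ω len T hl := ⟨h1 _ _ (hL.sound ω len T hl).1, (hL.sound ω len T hl).2⟩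
  optimal T ω hT := by
    obtain ⟨T', hT', hle⟩ := h2 T ω hT
    obtain ⟨len, T'', h3, h4⟩ := hL.optimal T' ω hT'
    exact ⟨len, T'', h3, h4.trans hle⟩

theorem lookup_insert {r : ℝ × List (Edge h v)} {L : Layer ℝ h v} {ω ω' : State h}
    {l : List (State h)} :
    Layer.lookup ⟨l, (L.table.insert r (List.ofFn ω)).val⟩ ω' =
      if ω' = ω then some r else L.lookup ω' := by
  simp only [Layer.lookup, Trie.find_insert, List.ofFn_injective.eq_iff]

/-- Only the entry of `ω` can change, and an existing one only for something strictly shorter. A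
state is listed when it first gets an entry, which keeps the list free of duplicates. -/
theorem Represents.record {I : Grid ℝ h v} {L : Layer ℝ h v}
    {R : List (Edge h v) → State h → Prop} (hL : Represents I L R) (ω : State h)
    (T : List (Edge h v)) :
    Represents I (record ω (edgeLength I T) T L).val fun T' ω' => R T' ω' ∨ (T' = T ∧ ω' = ω) := by
  have hval : (RTSP.record ω (edgeLength I T) T L).val =
      match L.lookup ω with
      | some old => if edgeLength I T < old.1 then
          { L with table := (L.table.insert (edgeLength I T, T) (List.ofFn ω)).val } else L
      | none => ⟨ω :: L.states, (L.table.insert (edgeLength I T, T) (List.ofFn ω)).val⟩ := by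
    simp only [RTSP.record, Layer.lookup, Counted.val_bind]
    cases (L.table.find (List.ofFn ω)).val with
    | none => rfl
    | some old =>
      simp only [Counted.val_bind]
      split_ifs <;> rfl
  rw [hval]
  cases hl : L.lookup ω with
  | none =>
    refine ⟨?_, ?_, ?_, ?_⟩
    · refine List.nodup_cons.2 ⟨?_, hL.nodup⟩
      rw [hL.mem_iff]
      simp [hl]
    · intro ω'
      rw [lookup_insert]
      by_cases hω : ω' = ω
      · simp [hω]
      · simp [hω, hL.mem_iff]
    · intro ω' len T'
      rw [lookup_insert]
      by_cases hω : ω' = ω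
      · simp only [hω, if_true, Option.some.injEq, Prod.mk.injEq]
        rintro ⟨rfl, rfl⟩
        simp
      · simp only [hω, if_false, and_false, or_false]
        exact hL.sound ω' len T'
    · intro T' ω' hR
      rw [lookup_insert]
      by_cases hω : ω' = ω
      · subst hω
        refine ⟨_, _, if_pos rfl, ?_⟩
        rcases hR with hR | ⟨rfl, -⟩
        · obtain ⟨len, T'', h1, h2⟩ := hL.optimal _ _ hR
          rw [hl] at h1
          cases h1
        · exact le_rfl
      · simp only [hω, if_false, and_false, or_false] at hR ⊢
        exact hL.optimal _ _ hR
  | some old =>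
    dsimp only
    split_ifs with hlt
    · refine ⟨hL.nodup, ?_, ?_, ?_⟩
      · intro ω'
        rw [lookup_insert]
        by_cases hω : ω' = ω
        · simp [hω, hL.mem_iff, hl]
        · simp [hω, hL.mem_iff]
      · intro ω' len T'
        rw [lookup_insert]
        by_cases hω : ω' = ω
        · simp only [hω, if_true, Option.some.injEq, Prod.mk.injEq]
          rintro ⟨rfl, rfl⟩
          simp
        · simp only [hω, if_false, and_false, or_false]
          exact hL.sound ω' len T'
      · intro T' ω' hR
        rw [lookup_insert]
        by_cases hω : ω' = ω
        · subst hω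
          refine ⟨_, _, if_pos rfl, ?_⟩
          rcases hR with hR | ⟨rfl, -⟩
          · obtain ⟨len, T'', h1, h2⟩ := hL.optimal _ _ hR
            rw [hl] at h1
            cases h1
            exact hlt.le.trans h2
          · exact le_rfl
        · simp only [hω, if_false, and_false, or_false] at hR ⊢
          exact hL.optimal _ _ hR
    · refine ⟨hL.nodup, hL.mem_iff, fun ω' len T' h' => ⟨Or.inl (hL.sound _ _ _ h').1,
        (hL.sound _ _ _ h').2⟩, ?_⟩
      rintro T' ω' (hR | ⟨rfl, rfl⟩)
      · exact hL.optimal _ _ hR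
      · exact ⟨old.1, old.2, hl, not_lt.1 hlt⟩

/-- The states reached by treating the segments `es`, with the partial subgraphs that lead to
them. -/
inductive Path (I : Grid ℝ h v) : List (Edge h v) → List (Edge h v) → State h → Prop
  | nil : Path I [] [] fun _ => none
  | snoc {es T : List (Edge h v)} {e : Edge h v} {m : Fin 3} {ω ω' : State h} :
    Path I es T ω → (transition I e m ω).val = some ω' →
    Path I (es ++ [e]) (List.replicate m.val e ++ T) ω'

theorem Path.nil_inv {I : Grid ℝ h v} {T : List (Edge h v)} {ω : State h}
    (hp : Path I [] T ω) : T = [] ∧ ω = fun _ => none := by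
  generalize hes : ([] : List (Edge h v)) = es at hp
  cases hp with
  | nil => exact ⟨rfl, rfl⟩
  | snoc => simp at hes

theorem Path.snoc_inv {I : Grid ℝ h v} {es T : List (Edge h v)} {e : Edge h v} {ω' : State h}
    (hp : Path I (es ++ [e]) T ω') : ∃ (m : Fin 3) (T0 : List (Edge h v)) (ω : State h),
      Path I es T0 ω ∧ (transition I e m ω).val = some ω' ∧ T = List.replicate m.val e ++ T0 := by
  generalize hes : es ++ [e] = es' at hp
  cases hp with
  | nil => simp at hes
  | snoc h1 h2 =>
    obtain ⟨rfl, h3⟩ := List.append_inj' hes rfl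
    cases h3
    exact ⟨_, _, _, h1, h2, rfl⟩

/-- The treatment of one choice for the segment `e`, from the state `ω`. -/
noncomputable def tryChoice (I : Grid ℝ h v) (e : Edge h v) (ω : State h) (len : ℝ) (T : List (Edge h v))
    (L : Layer ℝ h v) (m : Fin 3) : Counted (Layer ℝ h v) := do
  tick 1
  match ← transition I e m ω with
  | none => return L
  | some ω' =>
    tick 4
    record ω' (len + m.val • e.length I) (List.replicate m.val e ++ T) L

theorem Represents.tryChoice {I : Grid ℝ h v} {L : Layer ℝ h v}
    {R : List (Edge h v) → State h → Prop} (hL : Represents I L R) (e : Edge h v) (ω : State h)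
    (T : List (Edge h v)) (m : Fin 3) :
    Represents I (tryChoice I e ω (edgeLength I T) T L m).val fun T' ω' =>
      R T' ω' ∨ ((transition I e m ω).val = some ω' ∧ T' = List.replicate m.val e ++ T) := by
  simp only [RTSP.tryChoice, Counted.val_bind]
  cases ht : (transition I e m ω).val with
  | none => simpa using hL
  | some ω' =>
    have := hL.record ω' (List.replicate m.val e ++ T)
    rw [edgeLength_append, edgeLength_replicate, add_comm] at this
    refine this.congr ?_ ?_
    · rintro T' ω'' (hR | ⟨rfl, rfl⟩)
      · exact Or.inl hR
      · exact Or.inr ⟨rfl, rfl⟩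
    · rintro T' ω'' (hR | ⟨h1, rfl⟩)
      · exact ⟨T', Or.inl hR, le_rfl⟩
      · cases h1
        exact ⟨_, Or.inr ⟨rfl, rfl⟩, le_rfl⟩

/-- The treatment of the segment `e` from the state `ω` of the layer `L`. -/
noncomputable def expand (I : Grid ℝ h v) (L : Layer ℝ h v) (e : Edge h v) (L' : Layer ℝ h v) (ω : State h) :
    Counted (Layer ℝ h v) := do
  tick (h + 1)
  match ← L.table.find (List.ofFn ω) with
  | none => return L'
  | some (len, T) => [0, 1, 2].foldlM (init := L') (tryChoice I e ω len T)

/-- Names the nested loop bodies, so that each has its own invariant and its own step bound. -/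
theorem nextLayer_eq (I : Grid ℝ h v) (L : Layer ℝ h v) (e : Edge h v) :
    nextLayer I L e = (tick 1 >>= fun _ => L.states.foldlM (expand I L e) ⟨[], .empty⟩) := by
  rw [nextLayer]
  congr 1
  funext _
  congr 1
  funext L' ω
  rw [expand]
  congr 1
  funext _
  congr 1
  funext r
  cases r <;> rfl

theorem Represents.expand {I : Grid ℝ h v} {L L' : Layer ℝ h v}
    {R R' : List (Edge h v) → State h → Prop} (hL : Represents I L R) (e : Edge h v)
    (hL' : Represents I L' R') (ω : State h) :
    Represents I (expand I L e L' ω).val fun T' ω' => R' T' ω' ∨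
      ∃ (m : Fin 3) (len : ℝ) (T : List (Edge h v)), L.lookup ω = some (len, T) ∧
        (transition I e m ω).val = some ω' ∧ T' = List.replicate m.val e ++ T := by
  simp only [RTSP.expand, Counted.val_bind]
  change Represents I (Counted.val (match L.lookup ω with
    | none => return L'
    | some (len, T) => [0, 1, 2].foldlM (init := L') (RTSP.tryChoice I e ω len T))) _
  cases hl : L.lookup ω with
  | none => simpa using hL'
  | some r =>
    obtain ⟨len, T⟩ := r
    obtain ⟨-, rfl⟩ := hL.sound _ _ _ hl
    simp only [List.foldlM_cons, List.foldlM_nil, Counted.val_bind, Counted.val_pure]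
    have := ((hL'.tryChoice e ω T 0).tryChoice e ω T 1).tryChoice e ω T 2
    refine this.congr ?_ ?_
    · rintro T' ω' (((hR | ⟨h1, h2⟩) | ⟨h1, h2⟩) | ⟨h1, h2⟩)
      · exact Or.inl hR
      all_goals exact Or.inr ⟨_, _, _, rfl, h1, h2⟩
    · rintro T' ω' (hR | ⟨m, len, T0, h0, h1, h2⟩)
      · exact ⟨T', by simp [hR], le_rfl⟩
      · cases h0
        refine ⟨T', ?_, le_rfl⟩
        fin_cases m
        · exact Or.inl (Or.inl (Or.inr ⟨h1, h2⟩))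
        · exact Or.inl (Or.inr ⟨h1, h2⟩)
        · exact Or.inr ⟨h1, h2⟩

theorem Represents.foldl_expand {I : Grid ℝ h v} {L : Layer ℝ h v}
    {R : List (Edge h v) → State h → Prop} (hL : Represents I L R) (e : Edge h v)
    (l : List (State h)) {L' : Layer ℝ h v} {R' : List (Edge h v) → State h → Prop}
    (hL' : Represents I L' R') :
    Represents I (l.foldlM (RTSP.expand I L e) L').val fun T' ω' => R' T' ω' ∨ ∃ ω ∈ l,
      ∃ (m : Fin 3) (len : ℝ) (T : List (Edge h v)), L.lookup ω = some (len, T) ∧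
        (transition I e m ω).val = some ω' ∧ T' = List.replicate m.val e ++ T := by
  induction l generalizing L' R' with
  | nil => simpa using hL'
  | cons ω l ih =>
    have := ih (hL.expand e hL' ω)
    simpa [or_assoc] using this

/-- Bellman's principle. A transition depends on the prefix `T0` only through its state `ω`, so `T0`
can be replaced by the stored list for `ω`, which is not longer and leads to the same new state. -/
theorem Represents.nextLayer {I : Grid ℝ h v} {L : Layer ℝ h v} {es : List (Edge h v)}
    (hL : Represents I L (Path I es)) (e : Edge h v) :
    Represents I (nextLayer I L e).val (Path I (es ++ [e])) := by
  rw [nextLayer_eq]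
  refine (hL.foldl_expand e L.states (Represents.empty I)).congr ?_ ?_
  · rintro T ω' (h1 | ⟨ω, -, m, len, T0, h1, h2, rfl⟩)
    · exact h1.elim
    · exact (hL.sound _ _ _ h1).1.snoc h2
  · intro T ω' hp
    obtain ⟨m, T0, ω, h1, h2, rfl⟩ := hp.snoc_inv
    obtain ⟨len, T', h3, h4⟩ := hL.optimal _ _ h1
    refine ⟨List.replicate m.val e ++ T', Or.inr ⟨ω, (hL.mem_iff ω).2 ⟨_, h3⟩, m, len, T', h3, h2,
      rfl⟩, ?_⟩
    rw [edgeLength_append, edgeLength_append, ← (hL.sound _ _ _ h3).2]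
    gcongr

theorem represents_firstLayer (I : Grid ℝ h v) :
    Represents I (firstLayer (K := ℝ) (h := h) (v := v)).val (Path I []) := by
  refine ((Represents.empty I).record (fun _ => none) []).congr ?_ ?_
  · rintro T ω (h1 | ⟨rfl, rfl⟩)
    · exact h1.elim
    · exact .nil
  · intro T ω hp
    exact ⟨T, Or.inr hp.nil_inv, le_rfl⟩

theorem represents_foldlM_nextLayer {I : Grid ℝ h v} (es' : List (Edge h v)) {L : Layer ℝ h v}
    {es : List (Edge h v)} (hL : Represents I L (Path I es)) :
    Represents I (es'.foldlM (nextLayer I) L).val (Path I (es ++ es')) := by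
  induction es' generalizing L es with
  | nil => simpa using hL
  | cons e es' ih =>
    have := ih (hL.nextLayer e)
    simpa using this

theorem represents_layer (I : Grid ℝ h v) (l : ℕ) :
    Represents I (layer I l).val (Path I ((edges h v).take l)) := by
  have := represents_foldlM_nextLayer ((edges h v).take l) (represents_firstLayer I)
  simpa [layer] using this

/-- The comparison of the state `ω` with the best entry found before. -/
noncomputable def better (I : Grid ℝ h v) (L : Layer ℝ h v) (b : Option (ℝ × List (Edge h v)))
    (ω : State h) : Option (ℝ × List (Edge h v)) :=
  if IsFinal I ω then
    match b, L.lookup ω with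
    | none, r => r
    | some b, none => some b
    | some b, some r => some (if r.1 < b.1 then r else b)
  else b

theorem best_eq (I : Grid ℝ h v) (L : Layer ℝ h v) :
    (best I L).val = L.states.foldl (better I L) none := by
  rw [best, Counted.val_foldlM]
  congr 1
  funext b ω
  simp only [Counted.val_bind, better]
  split_ifs
  · simp only [Counted.val_bind, Layer.lookup]
    cases b <;> cases (L.table.find (List.ofFn ω)).val <;> rfl
  · rfl

theorem best_spec {I : Grid ℝ h v} {L : Layer ℝ h v} {R : List (Edge h v) → State h → Prop}
    (hL : Represents I L R) :
    (∀ r, (best I L).val = some r → r.1 = edgeLength I r.2 ∧ ∃ ω, IsFinal I ω ∧ R r.2 ω) ∧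
    ∀ T ω, R T ω → IsFinal I ω → ∃ r, (best I L).val = some r ∧ r.1 ≤ edgeLength I T := by
  -- The start value is arbitrary: the result is at most the length of the start value and of every
  -- final entry met in `l`.
  have key : ∀ (l : List (State h)) (b : Option (ℝ × List (Edge h v))),
      (∀ r, b = some r → r.1 = edgeLength I r.2 ∧ ∃ ω, IsFinal I ω ∧ R r.2 ω) →
      (∀ r, l.foldl (better I L) b = some r → r.1 = edgeLength I r.2 ∧ ∃ ω, IsFinal I ω ∧ R r.2 ω) ∧
      (∀ r0, (b = some r0 ∨ ∃ ω ∈ l, IsFinal I ω ∧ L.lookup ω = some r0) →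
        ∃ r, l.foldl (better I L) b = some r ∧ r.1 ≤ r0.1) := by
    intro l
    induction l with
    | nil =>
      intro b hb
      refine ⟨hb, ?_⟩
      rintro r0 (h1 | ⟨ω, h1, -⟩)
      · exact ⟨r0, h1, le_rfl⟩
      · simp at h1
    | cons ω l ih =>
      intro b hb
      simp only [List.foldl_cons]
      set b' := better I L b ω with hb'
      have h1 : ∀ r, b' = some r → r.1 = edgeLength I r.2 ∧ ∃ ω, IsFinal I ω ∧ R r.2 ω := by
        intro r hr
        rw [hb', better.eq_def] at hr
        split_ifs at hr with hf
        · have hs : ∀ r, L.lookup ω = some r →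
              r.1 = edgeLength I r.2 ∧ ∃ ω, IsFinal I ω ∧ R r.2 ω := fun r hr =>
            ⟨(hL.sound ω r.1 r.2 hr).2, ω, hf, (hL.sound ω r.1 r.2 hr).1⟩
          cases b with
          | none => exact hs r hr
          | some b =>
            cases hl : L.lookup ω with
            | none =>
              rw [hl] at hr
              exact hb r hr
            | some r' =>
              rw [hl] at hr
              simp only [Option.some.injEq] at hr
              split_ifs at hr
              · exact hs r (hl.trans (congrArg some hr))
              · exact hb r (congrArg some hr)
        · exact hb r hr
      have h2 : ∀ r0, (b = some r0 ∨ (IsFinal I ω ∧ L.lookup ω = some r0)) →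
          ∃ r, b' = some r ∧ r.1 ≤ r0.1 := by
        intro r0 hr0
        rw [hb', better.eq_def]
        rcases hr0 with h3 | ⟨hf, h3⟩
        · subst h3
          split_ifs
          · cases L.lookup ω with
            | none => exact ⟨_, rfl, le_rfl⟩
            | some r' =>
              refine ⟨_, rfl, ?_⟩
              split_ifs with h4
              · exact h4.le
              · exact le_rfl
          · exact ⟨_, rfl, le_rfl⟩
        · rw [if_pos hf, h3]
          cases b with
          | none => exact ⟨_, rfl, le_rfl⟩
          | some b =>
            refine ⟨_, rfl, ?_⟩
            split_ifs with h4
            · exact le_rfl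
            · exact not_lt.1 h4
      refine ⟨(ih b' h1).1, ?_⟩
      intro r0 hr0
      have h3 : (b = some r0 ∨ (IsFinal I ω ∧ L.lookup ω = some r0)) ∨
          ∃ ω ∈ l, IsFinal I ω ∧ L.lookup ω = some r0 := by
        rcases hr0 with h4 | ⟨ω', h4, h5⟩
        · exact Or.inl (Or.inl h4)
        · rcases List.mem_cons.1 h4 with rfl | h4
          · exact Or.inl (Or.inr h5)
          · exact Or.inr ⟨ω', h4, h5⟩
      rcases h3 with h3 | h3
      · obtain ⟨r1, h4, h5⟩ := h2 r0 h3
        obtain ⟨r, h6, h7⟩ := (ih b' h1).2 r1 (Or.inl h4)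
        exact ⟨r, h6, h7.trans h5⟩
      · exact (ih b' h1).2 r0 (Or.inr h3)
  rw [best_eq]
  have h0 := key L.states none (by simp)
  refine ⟨h0.1, ?_⟩
  intro T ω hR hf
  obtain ⟨len, T', h1, h2⟩ := hL.optimal _ _ hR
  obtain ⟨r, h3, h4⟩ := h0.2 (len, T') (Or.inr ⟨ω, (hL.mem_iff ω).2 ⟨_, h1⟩, hf, h1⟩)
  exact ⟨r, h3, h4.trans h2⟩

end Layers

/-! ### Valid states -/

section States
variable {h : ℕ}

/-- Non-crossing partitions of a subset of the frontier, with blocks named after their lowest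
elements. -/
structure IsPartition (f : Fin h → Option (Fin h)) : Prop where
  le : ∀ i c, f i = some c → c ≤ i
  name : ∀ i c, f i = some c → f c = some c
  noncrossing : ∀ a b c d, a < b → b < c → c < d → (f a).isSome → (f b).isSome →
    f a = f c → f b = f d → f a = f b

/-- With `x` between `b` and `d` and `y` outside, the order is `y < b < x < d` or `b < x < d < y`;
both are forbidden patterns unless the blocks coincide. -/
theorem IsPartition.separated {f : Fin h → Option (Fin h)} (hf : IsPartition f) {b d x y : Fin h}
    (hbd : f b = f d) (hxy : f x = f y) (hb : (f b).isSome) (hx : (f x).isSome)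
    (h1 : b < x) (h2 : x < d) (h3 : y < b ∨ d < y) : f b = f x := by
  rcases h3 with h3 | h3
  · have := hf.noncrossing y b x d h3 h1 h2 (hxy ▸ hx) hb hxy.symm hbd
    rw [hxy, this]
  · exact hf.noncrossing b x d y h1 h2 h3 hb hx hbd hxy

/-- A name is borne by the vertex it denotes, so no vertex uses the name `i` yet, and a block with
one vertex crosses nothing. -/
theorem IsPartition.update_singleton {f : Fin h → Option (Fin h)} (hf : IsPartition f) {i : Fin h}
    (hi : f i = none) : IsPartition (Function.update f i (some i)) := by
  have hfresh : ∀ k, f k ≠ some i := fun k hk => by simpa [hi] using hf.name k i hk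
  refine ⟨?_, ?_, ?_⟩
  · intro k c hk
    by_cases hki : k = i
    · subst hki
      simp at hk
      exact hk.symm.le
    · rw [Function.update_of_ne hki] at hk
      exact hf.le k c hk
  · intro k c hk
    by_cases hci : c = i
    · simp [hci]
    · rw [Function.update_of_ne hci]
      by_cases hki : k = i
      · subst hki
        simp at hk
        exact absurd hk.symm hci
      · rw [Function.update_of_ne hki] at hk
        exact hf.name k c hk
  · intro a b c d hab hbc hcd ha hb hac hbd
    simp only [Function.update_apply] at ha hb hac hbd ⊢
    have := hf.noncrossing a b c d hab hbc hcd
    grind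

/-- No vertex lies between `i` and `i'`. A third block that crossed the merged block would therefore
already cross one of the two old ones. -/
theorem IsPartition.merge {f : Fin h → Option (Fin h)} (hf : IsPartition f) {i i' c c' : Fin h}
    (hii : i'.val = i.val + 1) (hi : f i = some c) (hi' : f i' = some c') :
    IsPartition fun k => (f k).map fun x => if x = c ∨ x = c' then min c c' else x := by
  have hc := hf.name i c hi
  have hc' := hf.name i' c' hi'
  refine ⟨?_, ?_, ?_⟩
  · intro k d hk
    obtain ⟨x, hx, rfl⟩ := Option.map_eq_some_iff.1 hk
    have := hf.le k x hx
    split_ifs with h1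
    · rcases h1 with rfl | rfl
      · exact (min_le_left _ _).trans this
      · exact (min_le_right _ _).trans this
    · exact this
  · intro k d hk
    obtain ⟨x, hx, rfl⟩ := Option.map_eq_some_iff.1 hk
    split_ifs with h1
    · rcases min_choice c c' with h2 | h2
      · rw [h2, hc]
        simp
      · rw [h2, hc']
        simp
    · rw [hf.name k x hx]
      simp [h1]
  -- Two vertices share a block after the merger if they did before or if each lies in one of the
  -- two merged blocks.
  · have key : ∀ x y, (f x).isSome →
        ((f x).map (fun x => if x = c ∨ x = c' then min c c' else x) =
          (f y).map (fun x => if x = c ∨ x = c' then min c c' else x) ↔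
          f x = f y ∨ ((f x = some c ∨ f x = some c') ∧ (f y = some c ∨ f y = some c'))) := by
      intro x y hx
      obtain ⟨p, hp⟩ := Option.isSome_iff_exists.1 hx
      rw [hp]
      cases hq : f y with
      | none => simp
      | some q =>
        simp only [Option.map_some, Option.some.injEq]
        rcases min_choice c c' with h2 | h2 <;> rw [h2] <;> grind
    intro a b x d hab hbx hxd ha hb hac hbd
    simp only [Option.isSome_map] at ha hb
    rw [key a x ha] at hac
    rw [key b d hb] at hbd
    rw [key a b ha]
    have sep := @IsPartition.separated h f hf
    -- An interval whose ends avoid the consecutive vertices `i` and `i'` contains both or neither.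
    have hiv : ∀ b d : Fin h, b ≠ i → b ≠ i' → d ≠ i → d ≠ i' →
        ((b < i ∧ i < d) ↔ (b < i' ∧ i' < d)) := by
      intro b d h1 h2 h3 h4
      rw [ne_eq, Fin.ext_iff] at h1 h2 h3 h4
      simp only [Fin.lt_def]
      omega
    -- If `i` and `i'` are inside the interval, the one in the old block of `y` crosses with `y`; if
    -- both are outside, the one in the old block of `x` crosses with `x`.
    have hbtw : ∀ b d x y : Fin h, b < x → x < d → (y < b ∨ d < y) → f b = f d → (f b).isSome →
        (f x = some c ∨ f x = some c') → (f y = some c ∨ f y = some c') →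
        f b = some c ∨ f b = some c' := by
      intro b d x y h1 h2 h3 h4 h5 hx hy
      by_contra hcon
      push Not at hcon
      have hbi : b ≠ i := fun hh => hcon.1 (hh ▸ hi)
      have hbi' : b ≠ i' := fun hh => hcon.2 (hh ▸ hi')
      have hdi : d ≠ i := fun hh => hcon.1 (h4.trans (hh ▸ hi))
      have hdi' : d ≠ i' := fun hh => hcon.2 (h4.trans (hh ▸ hi'))
      have hyb : ¬ (b < y ∧ y < d) := fun hh => by
        rcases h3 with h3 | h3
        · exact lt_asymm h3 hh.1
        · exact lt_asymm h3 hh.2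
      have hout : ∀ z, z ≠ b → z ≠ d → ¬ (b < z ∧ z < d) → z < b ∨ d < z := by
        intro z g1 g2 g3
        rw [ne_eq, Fin.ext_iff] at g1 g2
        simp only [Fin.lt_def] at g3 ⊢
        omega
      by_cases hin : b < i ∧ i < d
      · have hin' := (hiv b d hbi hbi' hdi hdi').1 hin
        rcases hy with hy | hy
        · have := sep h4 (hi.trans hy.symm) h5 (by simp [hi]) hin.1 hin.2 h3
          exact hcon.1 (this.trans hi)
        · have := sep h4 (hi'.trans hy.symm) h5 (by simp [hi']) hin'.1 hin'.2 h3
          exact hcon.2 (this.trans hi')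
      · have hin' := fun hh => hin ((hiv b d hbi hbi' hdi hdi').2 hh)
        rcases hx with hx | hx
        · have := sep h4 (hx.trans hi.symm) h5 (by simp [hx]) h1 h2
            (hout i (Ne.symm hbi) (Ne.symm hdi) hin)
          exact hcon.1 (this.trans hx)
        · have := sep h4 (hx.trans hi'.symm) h5 (by simp [hx]) h1 h2
            (hout i' (Ne.symm hbi') (Ne.symm hdi') hin')
          exact hcon.2 (this.trans hx)
    rcases hac with hac | ⟨ha1, hx1⟩
    · rcases hbd with hbd | ⟨hb1, hd1⟩
      · exact Or.inl (hf.noncrossing a b x d hab hbx hxd ha hb hac hbd)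
      · exact Or.inr ⟨hbtw a x b d hab hbx (Or.inr hxd) hac ha hb1 hd1, hb1⟩
    · rcases hbd with hbd | ⟨hb1, hd1⟩
      · exact Or.inr ⟨ha1, hbtw b d x a hbx hxd (Or.inl hab) hbd hb hx1 ha1⟩
      · exact Or.inr ⟨ha1, hb1⟩

/-- Since `i` does not name its block, every name in use is still borne by its own vertex. -/
theorem IsPartition.remove {f : Fin h → Option (Fin h)} (hf : IsPartition f) {i : Fin h}
    (hi : f i ≠ some i) : IsPartition (Function.update f i none) := by
  refine ⟨?_, ?_, ?_⟩
  · intro k c hk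
    by_cases hki : k = i
    · simp [hki] at hk
    · rw [Function.update_of_ne hki] at hk
      exact hf.le k c hk
  · intro k c hk
    by_cases hki : k = i
    · simp [hki] at hk
    · rw [Function.update_of_ne hki] at hk
      have := hf.name k c hk
      rw [Function.update_of_ne (fun hc => hi (by subst hc; exact this))]
      exact this
  · intro a b c d hab hbc hcd ha hb hac hbd
    simp only [Function.update_apply] at ha hb hac hbd ⊢
    have := hf.noncrossing a b c d hab hbc hcd
    grind

/-- The lowest remaining vertex `k` becomes the name. As `k` belonged to the block `i`, it was not a
name before; the renaming is thus injective on the names in use and preserves the blocks. -/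
theorem IsPartition.remove_name {f : Fin h → Option (Fin h)} (hf : IsPartition f) {i k : Fin h}
    (hk : Function.update f i none k = some i)
    (hmin : ∀ l, Function.update f i none l = some i → k ≤ l) :
    IsPartition fun l => (Function.update f i none l).map fun x => if x = i then k else x := by
  set g := Function.update f i none with hg
  have hgi : ∀ l x, g l = some x ↔ l ≠ i ∧ f l = some x := by
    intro l x
    by_cases hl : l = i
    · simp [hg, hl]
    · simp [hg, hl]
  have hki := (hgi k i).1 hk
  have hfk : ∀ l, f l ≠ some k := by
    intro l hl
    have := hf.name l k hl
    rw [hki.2] at this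
    exact hki.1 (Option.some.inj this).symm
  refine ⟨?_, ?_, ?_⟩
  · intro l d hl
    obtain ⟨x, hx, rfl⟩ := Option.map_eq_some_iff.1 hl
    split_ifs with h1
    · exact hmin l (h1 ▸ hx)
    · exact hf.le l x ((hgi _ _).1 hx).2
  · intro l d hl
    obtain ⟨x, hx, rfl⟩ := Option.map_eq_some_iff.1 hl
    split_ifs with h1
    · rw [hk]
      simp
    · rw [(hgi x x).2 ⟨h1, hf.name l x ((hgi _ _).1 hx).2⟩]
      simp [h1]
  · have key : ∀ x y, (g x).isSome →
        ((g x).map (fun x => if x = i then k else x) =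
          (g y).map (fun x => if x = i then k else x) ↔ g x = g y) := by
      intro x y hx
      obtain ⟨p, hp⟩ := Option.isSome_iff_exists.1 hx
      have h1 := ((hgi _ _).1 hp).2
      rw [hp]
      cases hq : g y with
      | none => simp
      | some q =>
        have h2 := ((hgi _ _).1 hq).2
        have h3 := hfk x
        have h4 := hfk y
        simp only [Option.map_some, Option.some.injEq]
        grind
    have hsome : ∀ x, (g x).isSome → f x = g x ∧ x ≠ i := by
      intro x hx
      obtain ⟨p, hp⟩ := Option.isSome_iff_exists.1 hx
      rw [hp]
      exact ⟨((hgi _ _).1 hp).2, ((hgi _ _).1 hp).1⟩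
    intro a b c d hab hbc hcd ha hb hac hbd
    simp only [Option.isSome_map] at ha hb
    rw [key _ _ ha] at hac ⊢
    rw [key _ _ hb] at hbd
    have hc := hac ▸ ha
    have hd := hbd ▸ hb
    rw [← (hsome a ha).1, ← (hsome b hb).1]
    refine hf.noncrossing a b c d hab hbc hcd ?_ ?_ ?_ ?_
    · rwa [(hsome a ha).1]
    · rwa [(hsome b hb).1]
    · rw [(hsome a ha).1, (hsome c hc).1, hac]
    · rw [(hsome b hb).1, (hsome d hd).1, hbd]

/-! ### Parities of components. -/

/-- The number of odd vertices of a component, modulo two. -/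
def oddCount (ω : State h) (c : Fin h) : ZMod 2 :=
  ∑ i, if ω i = some (true, c) then 1 else 0

/-- In `ZMod 2` the parity condition is additive: each update of the state adds an explicit
increment. -/
theorem isState_iff {ω : State h} :
    IsState ω ↔ IsPartition (comp ω) ∧ ∀ c, oddCount ω c = 0 := by
  have hodd : ∀ c, oddCount ω c = 0 ↔
      Even (Finset.univ.filter fun i => ω i = some (true, c)).card := by
    intro c
    rw [oddCount, Finset.sum_boole, ZMod.natCast_eq_zero_iff_even]
  constructor
  · rintro ⟨h1, h2, h3⟩
    exact ⟨⟨fun i c hc => (h1 i c hc).1, fun i c hc => (h1 i c hc).2, h2⟩,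
      fun c => (hodd c).2 (h3 c)⟩
  · rintro ⟨h1, h2⟩
    exact ⟨fun i c hc => ⟨h1.le i c hc, h1.name i c hc⟩, h1.noncrossing,
      fun c => (hodd c).1 (h2 c)⟩

theorem oddCount_update (ω : State h) (i : Fin h) (z : Cell h) (c : Fin h) :
    oddCount (Function.update ω i z) c = oddCount ω c +
      ((if z = some (true, c) then 1 else 0) - if ω i = some (true, c) then 1 else 0) := by
  rw [← sub_eq_iff_eq_add', oddCount, oddCount, ← Finset.sum_sub_distrib,
    Finset.sum_eq_single i]
  · simp
  · intro k _ hk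
    simp [Function.update_of_ne hk]
  · simp

theorem comp_update (ω : State h) (i : Fin h) (z : Cell h) :
    comp (Function.update ω i z) = Function.update (comp ω) i (z.map Prod.snd) := by
  funext k
  by_cases hk : k = i
  · subst hk
    simp [comp]
  · simp [comp, Function.update_of_ne hk]

theorem comp_map (ω : State h) (g : Fin h → Fin h) (k : Fin h) :
    comp (fun k => (ω k).map fun pc => (pc.1, g pc.2)) k = (comp ω k).map g := by
  simp only [comp, Option.map_map]
  rfl

/-! ### Validity of states after a vertical segment. -/

/-- The cell of a frontier vertex that is given a positive degree, before the parity changes. -/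
def cellOf (ω : State h) (i : Fin h) : Bool × Fin h := (ω i).getD (false, i)

/-- The state after `m > 0` copies of a vertical edge have been counted in the degrees. -/
def touch (i i' : Fin h) (m : Fin 3) (ω : State h) : State h :=
  Function.update (Function.update ω i (some ((cellOf ω i).1 ^^ decide (m = 1), (cellOf ω i).2)))
    i' (some ((cellOf ω i').1 ^^ decide (m = 1), (cellOf ω i').2))

theorem addVert_val (i i' : Fin h) (m : Fin 3) (ω : State h) :
    (addVert i i' m ω).val = some (if m = 0 then ω else
      merge (cellOf ω i).2 (cellOf ω i').2 (touch i i' m ω)) := by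
  rw [addVert]
  by_cases hm : m = 0
  · simp [hm]
  · simp [hm]
    rfl

theorem comp_touch {i i' : Fin h} (m : Fin 3) (ω : State h) :
    comp (touch i i' m ω) = Function.update (Function.update (comp ω) i (some (cellOf ω i).2)) i'
      (some (cellOf ω i').2) := by
  rw [touch, comp_update, comp_update]
  rfl

/-- A vertex of degree zero becomes a new block; for any other vertex nothing changes. The function
`f` is allowed to differ from `comp ω` away from `i`, so that both ends of a segment can be treated
in succession. -/
theorem IsPartition.update_cellOf {ω : State h} {f : Fin h → Option (Fin h)} (hf : IsPartition f)
    {i : Fin h} (hi : f i = comp ω i) :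
    IsPartition (Function.update f i (some (cellOf ω i).2)) := by
  cases hω : ω i with
  | none =>
    have : cellOf ω i = (false, i) := by simp [cellOf, hω]
    rw [this]
    exact hf.update_singleton (by simp [hi, comp, hω])
  | some pc =>
    have : some (cellOf ω i).2 = f i := by simp [cellOf, hω, hi, comp]
    rw [this, Function.update_eq_self]
    exact hf

theorem IsPartition.comp_touch {ω : State h} (hω : IsPartition (comp ω)) {i i' : Fin h}
    (hii : i ≠ i') (m : Fin 3) : IsPartition (comp (touch i i' m ω)) := by
  rw [RTSP.comp_touch]
  refine (hω.update_cellOf rfl).update_cellOf ?_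
  rw [Function.update_of_ne hii.symm]

theorem comp_merge (a b : Fin h) (ω : State h) :
    comp (merge a b ω) = fun k => (comp ω k).map fun x => if x = a ∨ x = b then min a b else x :=
  funext fun k => comp_map ω (fun x => if x = a ∨ x = b then min a b else x) k

theorem oddCount_update_cellOf {ω σ : State h} {i : Fin h} (hi : σ i = ω i) (m : Fin 3)
    (c : Fin h) :
    oddCount (Function.update σ i (some ((cellOf ω i).1 ^^ decide (m = 1), (cellOf ω i).2))) c =
      oddCount σ c + if m = 1 ∧ (cellOf ω i).2 = c then 1 else 0 := by
  have h2 : (0 : ZMod 2) - 1 = 1 := by decide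
  rw [oddCount_update, hi]
  congr 1
  cases hω : ω i with
  | none => by_cases hm : m = 1 <;> simp [cellOf, hω, hm]
  | some pc =>
    obtain ⟨p, d⟩ := pc
    by_cases hm : m = 1 <;> by_cases hd : d = c <;> cases p <;> simp [cellOf, hω, hm, hd, h2]

theorem oddCount_touch {i i' : Fin h} (hii : i ≠ i') (m : Fin 3) (ω : State h) (c : Fin h) :
    oddCount (touch i i' m ω) c = oddCount ω c + (if m = 1 ∧ (cellOf ω i).2 = c then 1 else 0) +
      if m = 1 ∧ (cellOf ω i').2 = c then 1 else 0 := by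
  rw [touch, oddCount_update_cellOf (Function.update_of_ne hii.symm _ _),
    oddCount_update_cellOf rfl]

/-- The two counts add up at the common name, and the other name is no longer in use. -/
theorem oddCount_merge (a b : Fin h) (ω : State h) (c : Fin h) :
    oddCount (merge a b ω) c =
      if c = min a b then (if a = b then oddCount ω a else oddCount ω a + oddCount ω b)
      else if c = a ∨ c = b then 0 else oddCount ω c := by
  have hpt : ∀ k, (if merge a b ω k = some (true, c) then (1 : ZMod 2) else 0) =
      if c = min a b then (if a = b then (if ω k = some (true, a) then 1 else 0) else
        (if ω k = some (true, a) then 1 else 0) + (if ω k = some (true, b) then 1 else 0))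
      else if c = a ∨ c = b then 0 else (if ω k = some (true, c) then 1 else 0) := by
    intro k
    cases hk : ω k with
    | none => simp [merge, hk]
    | some pc =>
      obtain ⟨p, d⟩ := pc
      simp only [merge, hk, Option.map_some, Option.some.injEq, Prod.mk.injEq]
      rcases min_choice a b with h2 | h2 <;> rw [h2] <;> cases p <;> simp <;> grind
  simp only [oddCount, hpt]
  split_ifs
  · rfl
  · rw [Finset.sum_add_distrib]
  · simp
  · rfl

/-- A single copy flips the parity of both ends, which lie in one component afterwards, so its count
changes by `1 + 1 = 0`. -/
theorem IsState.addVert {ω : State h} (hω : IsState ω) {i i' : Fin h} (hii : i'.val = i.val + 1)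
    (m : Fin 3) {ω' : State h} (hω' : (addVert i i' m ω).val = some ω') : IsState ω' := by
  rw [addVert_val, Option.some.injEq] at hω'
  subst hω'
  by_cases hm : m = 0
  · simpa [hm] using hω
  rw [if_neg hm]
  rw [isState_iff] at hω ⊢
  have hne : i ≠ i' := fun hh => by rw [hh] at hii; omega
  constructor
  · rw [comp_merge]
    refine (hω.1.comp_touch hne m).merge hii ?_ ?_
    · rw [comp_touch, Function.update_of_ne hne, Function.update_self]
    · rw [comp_touch, Function.update_self]
  · intro c
    have h11 : (1 : ZMod 2) + 1 = 0 := by decide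
    rw [oddCount_merge]
    simp only [oddCount_touch hne, hω.2, zero_add]
    generalize (cellOf ω i).2 = a
    generalize (cellOf ω i').2 = b
    split_ifs <;> grind

theorem oddCount_rename (i k : Fin h) (ω : State h) (hk : i ≠ k) (c : Fin h) :
    oddCount (fun l => (ω l).map fun pc => (pc.1, if pc.2 = i then k else pc.2)) c =
      if c = k then oddCount ω i + oddCount ω k else if c = i then 0 else oddCount ω c := by
  have hpt : ∀ l, (if (ω l).map (fun pc => (pc.1, if pc.2 = i then k else pc.2)) = some (true, c)
        then (1 : ZMod 2) else 0) =
      if c = k then (if ω l = some (true, i) then 1 else 0) +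
        (if ω l = some (true, k) then 1 else 0)
      else if c = i then 0 else (if ω l = some (true, c) then 1 else 0) := by
    intro l
    cases hl : ω l with
    | none => simp
    | some pc =>
      obtain ⟨p, d⟩ := pc
      simp only [Option.map_some, Option.some.injEq, Prod.mk.injEq]
      cases p <;> simp
      grind
  simp only [oddCount, hpt]
  split_ifs
  · rw [Finset.sum_add_distrib]
  · simp
  · rfl

/-! ### Validity of states after a horizontal segment. -/

theorem find?_finRange_eq_some {p : Fin h → Bool} {k : Fin h}
    (hk : (List.finRange h).find? p = some k) : p k = true ∧ ∀ l, p l = true → k ≤ l := by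
  rw [List.find?_eq_some_iff_getElem] at hk
  obtain ⟨h1, j, hj, h2, h3⟩ := hk
  refine ⟨h1, fun l hl => ?_⟩
  by_contra hlt
  rw [not_le] at hlt
  simp only [List.getElem_finRange] at h2
  have := h3 l.val (by rw [← h2] at hlt; exact hlt)
  simp [hl] at this

/-- The possible results of the removal of a vertex of positive degree. -/
theorem removeVertex_val (i c : Fin h) (ω : State h) :
    (removeVertex i c ω).val =
      if c = i then
        ((List.finRange h).find? fun k => comp (Function.update ω i none) k = some i).map fun k l =>
          (Function.update ω i none l).map fun pc => (pc.1, if pc.2 = i then k else pc.2)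
      else some (Function.update ω i none) := by
  rw [removeVertex]
  simp only [Counted.val_bind]
  by_cases hc : c = i
  · simp only [hc, if_true, Counted.val_bind]
    cases (List.finRange h).find? fun k => comp (Function.update ω i none) k = some i <;> rfl
  · simp only [hc, if_false]
    rfl

/-- The leaving vertex is even, so no count of odd vertices changes; the search finds the lowest
remaining vertex, as `IsPartition.remove_name` needs. -/
theorem IsState.removeVertex {ω : State h} (hω : IsState ω) {i c : Fin h}
    (hi : ω i = some (false, c)) {ω' : State h}
    (hω' : (removeVertex i c ω).val = some ω') : IsState ω' := by
  rw [isState_iff] at hω ⊢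
  have hcomp : comp (Function.update ω i none) = Function.update (comp ω) i none :=
    comp_update ω i none
  have hodd : ∀ x, oddCount (Function.update ω i none) x = 0 := by
    intro x
    rw [oddCount_update, hω.2]
    simp [hi]
  rw [removeVertex_val] at hω'
  by_cases hc : c = i
  · rw [if_pos hc, Option.map_eq_some_iff] at hω'
    obtain ⟨k, hk, rfl⟩ := hω'
    have hk := find?_finRange_eq_some hk
    simp only [decide_eq_true_eq, hcomp] at hk
    have hik : i ≠ k := by
      rintro rfl
      simp at hk
    constructor
    · have := hω.1.remove_name hk.1 hk.2
      convert this using 1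
      funext l
      rw [comp_map (Function.update ω i none) (fun x => if x = i then k else x), hcomp]
    · intro x
      rw [oddCount_rename i k _ hik]
      simp [hodd]
  · rw [if_neg hc, Option.some.injEq] at hω'
    subst hω'
    refine ⟨?_, hodd⟩
    rw [hcomp]
    refine hω.1.remove ?_
    simp [comp, hi, hc]

theorem addHoriz_val (mand : Bool) (i : Fin h) (m : Fin 3) (ω : State h) :
    (addHoriz mand i m ω).val =
      match m, ω i with
      | 0, none => if mand then none else some ω
      | 0, some (false, c) => (removeVertex i c ω).val
      | 0, some (true, _) => none
      | 1, some (true, _) => some ω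
      | 1, _ => none
      | 2, none => some (Function.update ω i (some (false, i)))
      | 2, some (false, _) => some ω
      | 2, some (true, _) => none := by
  rw [addHoriz.eq_def]
  simp only [Counted.val_bind]
  rcases hω : ω i with _ | ⟨_ | _, c⟩ <;> fin_cases m <;> rfl

theorem IsState.addHoriz {ω : State h} (hω : IsState ω) {mand : Bool} {i : Fin h} {m : Fin 3}
    {ω' : State h} (hω' : (addHoriz mand i m ω).val = some ω') : IsState ω' := by
  rw [addHoriz_val] at hω'
  rcases hi : ω i with _ | ⟨_ | _, c⟩ <;> rw [hi] at hω' <;> fin_cases m <;> simp at hω'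
  · exact hω'.2 ▸ hω
  · subst hω'
    rw [isState_iff] at hω ⊢
    rw [comp_update]
    refine ⟨hω.1.update_singleton (by simp [comp, hi]), fun c => ?_⟩
    rw [oddCount_update, hω.2]
    simp [hi]
  · exact hω.removeVertex hi hω'
  · exact hω' ▸ hω
  · exact hω' ▸ hω

/-! ### The list of segments, and validity of all reachable states. -/

variable {v : ℕ}

/-- The two ends of the segment lie on neighbouring lines. -/
def Edge.Adjacent : Edge h v → Prop
  | .vert i i' _ => i'.val = i.val + 1
  | .horiz _ j j' => j'.val = j.val + 1

theorem mem_vertEdges {j : Fin v} {e : Edge h v} :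
    e ∈ vertEdges h v j ↔ ∃ i i' : Fin h, i'.val = i.val + 1 ∧ e = .vert i i' j := by
  simp only [vertEdges, List.mem_filterMap, List.mem_finRange, true_and]
  constructor
  · rintro ⟨i, hi⟩
    split_ifs at hi with h1
    exact ⟨i, ⟨i.val + 1, h1⟩, rfl, (Option.some.inj hi).symm⟩
  · rintro ⟨i, i', h1, rfl⟩
    refine ⟨i, ?_⟩
    rw [dif_pos (h1 ▸ i'.isLt)]
    simp [Fin.ext_iff, h1]

theorem mem_horizEdges {j : Fin v} {e : Edge h v} :
    e ∈ horizEdges h v j ↔ ∃ (i : Fin h) (j' : Fin v), j'.val = j.val + 1 ∧ e = .horiz i j j' := by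
  rw [horizEdges]
  split_ifs with hj
  · simp only [List.mem_map, List.mem_finRange, true_and]
    constructor
    · rintro ⟨i, rfl⟩
      exact ⟨i, _, rfl, rfl⟩
    · rintro ⟨i, j', h1, rfl⟩
      exact ⟨i, by simp [Fin.ext_iff, h1]⟩
  · simp only [List.not_mem_nil, false_iff]
    rintro ⟨i, j', h1, -⟩
    exact hj (h1 ▸ j'.isLt)

theorem mem_edges {e : Edge h v} : e ∈ edges h v ↔ e.Adjacent := by
  simp only [edges, List.mem_flatMap, List.mem_finRange, true_and, List.mem_append, mem_vertEdges,
    mem_horizEdges]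
  constructor
  · rintro ⟨j, ⟨i, i', h1, rfl⟩ | ⟨i, j', h1, rfl⟩⟩
    · exact h1
    · exact h1
  · cases e with
    | vert i i' j => exact fun h1 => ⟨j, Or.inl ⟨i, i', h1, rfl⟩⟩
    | horiz i j j' => exact fun h1 => ⟨j, Or.inr ⟨i, j', h1, rfl⟩⟩

theorem IsState.transition {I : Grid ℝ h v} {e : Edge h v} (he : e.Adjacent) {m : Fin 3}
    {ω ω' : State h} (hω : IsState ω) (hω' : (transition I e m ω).val = some ω') : IsState ω' := by
  cases e with
  | vert i i' j => exact hω.addVert he m hω'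
  | horiz i j j' => exact hω.addHoriz hω'

theorem isState_none : IsState (fun _ : Fin h => none) := by
  rw [isState_iff]
  refine ⟨⟨?_, ?_, ?_⟩, ?_⟩ <;> simp [comp, oddCount]

theorem Path.isState {I : Grid ℝ h v} {es T : List (Edge h v)} {ω : State h} (hp : Path I es T ω)
    (hes : ∀ e ∈ es, e.Adjacent) : IsState ω := by
  induction hp with
  | nil => exact isState_none
  | snoc h1 h2 ih => exact (ih fun e he => hes e (by simp [he])).transition (hes _ (by simp)) h2

theorem mem_Omega_of_mem_states {I : Grid ℝ h v} {L : Layer ℝ h v} {es : List (Edge h v)}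
    (hL : Represents I L (Path I es)) (hes : ∀ e ∈ es, e.Adjacent) {ω : State h}
    (hω : ω ∈ L.states) : ω ∈ Omega h := by
  obtain ⟨⟨len, T⟩, h1⟩ := (hL.mem_iff ω).1 hω
  exact Finset.mem_filter.2 ⟨Finset.mem_univ _, (hL.sound _ _ _ h1).1.isState hes⟩

theorem length_states_le {I : Grid ℝ h v} {L : Layer ℝ h v} {es : List (Edge h v)}
    (hL : Represents I L (Path I es)) (hes : ∀ e ∈ es, e.Adjacent) :
    L.states.length ≤ (Omega h).card := by
  classical
  rw [← List.toFinset_card_of_nodup hL.nodup]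
  exact Finset.card_le_card fun ω hω => mem_Omega_of_mem_states hL hes (List.mem_toFinset.1 hω)

theorem length_vertEdges (j : Fin v) : (vertEdges h v j).length = h - 1 := by
  cases h with
  | zero => simp [vertEdges]
  | succ n =>
    rw [vertEdges, List.finRange_succ_last]
    simp only [List.filterMap_append, List.filterMap_cons, List.filterMap_nil]
    rw [List.filterMap_map]
    simp

/-- There are `v * (h - 1)` vertical and `(v - 1) * h` horizontal segments; the additive form avoids
truncated subtraction. -/
theorem length_edges (hh : 0 < h) (hv : 0 < v) : (edges h v).length + h + v = 2 * h * v := by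
  have h1 : (edges h v).length = v * (h - 1) + (v - 1) * h := by
    rw [edges, List.length_flatMap]
    simp only [List.length_append, length_vertEdges]
    obtain ⟨n, rfl⟩ : ∃ n, v = n + 1 := ⟨v - 1, by omega⟩
    rw [List.finRange_succ_last]
    simp [horizEdges, Function.comp_def]
    ring
  obtain ⟨n, rfl⟩ : ∃ n, v = n + 1 := ⟨v - 1, by omega⟩
  obtain ⟨k, rfl⟩ : ∃ k, h = k + 1 := ⟨h - 1, by omega⟩
  rw [h1]
  simp only [Nat.add_sub_cancel]
  ring

end States

/-! ### Partial subgraphs and their states -/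

section Graphs
variable {h v : ℕ}

/-- The number of ends of the segment `e` at `u`. -/
def incidence (e : Edge h v) (u : Vertex h v) : ℕ :=
  (if e.src = u then 1 else 0) + if e.dst = u then 1 else 0

/-- The degree of a vertex in the multigraph with a given list of edges. -/
def degree (T : List (Edge h v)) (u : Vertex h v) : ℕ := (T.map fun e => incidence e u).sum

@[simp] theorem degree_nil (u : Vertex h v) : degree [] u = 0 := rfl

theorem degree_cons (e : Edge h v) (T : List (Edge h v)) (u : Vertex h v) :
    degree (e :: T) u = incidence e u + degree T u := by
  simp [degree]

theorem degree_append (S T : List (Edge h v)) (u : Vertex h v) :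
    degree (S ++ T) u = degree S u + degree T u := by
  simp [degree]

theorem degree_replicate (m : ℕ) (e : Edge h v) (u : Vertex h v) :
    degree (List.replicate m e) u = m * incidence e u := by
  simp [degree]

/-- The segment `e` joins `u` and `w`. -/
def Edge.Joins (e : Edge h v) (u w : Vertex h v) : Prop :=
  (e.src = u ∧ e.dst = w) ∨ (e.src = w ∧ e.dst = u)

theorem Edge.Joins.symm {e : Edge h v} {u w : Vertex h v} (he : e.Joins u w) : e.Joins w u :=
  Or.symm he

theorem Edge.Joins.incidence_pos {e : Edge h v} {u w : Vertex h v} (he : e.Joins u w) :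
    incidence e u ≠ 0 := by
  rcases he with ⟨h1, -⟩ | ⟨-, h1⟩ <;> simp [incidence, h1]

/-- The vertices `u` and `w` are connected in the multigraph with a given list of edges. -/
def Conn (T : List (Edge h v)) : Vertex h v → Vertex h v → Prop :=
  Relation.ReflTransGen fun u w => ∃ e ∈ T, e.Joins u w

theorem Conn.refl {T : List (Edge h v)} (u : Vertex h v) : Conn T u u := Relation.ReflTransGen.refl

theorem Conn.trans {T : List (Edge h v)} {u w z : Vertex h v} (h1 : Conn T u w)
    (h2 : Conn T w z) : Conn T u z := Relation.ReflTransGen.trans h1 h2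

theorem Conn.symm {T : List (Edge h v)} {u w : Vertex h v} (h1 : Conn T u w) : Conn T w u := by
  induction h1 with
  | refl => exact .refl u
  | tail _ hyz ih =>
    obtain ⟨e, he, hj⟩ := hyz
    exact Relation.ReflTransGen.head ⟨e, he, hj.symm⟩ ih

theorem Conn.mono {S T : List (Edge h v)} (hST : S ⊆ T) {u w : Vertex h v} (h1 : Conn S u w) :
    Conn T u w := by
  induction h1 with
  | refl => exact .refl u
  | tail _ hyz ih =>
    obtain ⟨e, he, hj⟩ := hyz
    exact Relation.ReflTransGen.tail ih ⟨e, hST he, hj⟩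

theorem Conn.of_joins {T : List (Edge h v)} {e : Edge h v} (he : e ∈ T) {u w : Vertex h v}
    (hj : e.Joins u w) : Conn T u w := Relation.ReflTransGen.single ⟨e, he, hj⟩

theorem degree_ne_zero_of_joins {T : List (Edge h v)} {e : Edge h v} (he : e ∈ T)
    {u w : Vertex h v} (hj : e.Joins u w) : degree T u ≠ 0 := by
  rw [degree]
  intro h0
  rw [List.sum_eq_zero_iff] at h0
  exact hj.incidence_pos (h0 _ (List.mem_map_of_mem he))

theorem exists_joins_of_degree_ne_zero {T : List (Edge h v)} {u : Vertex h v}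
    (hu : degree T u ≠ 0) : ∃ e ∈ T, ∃ w, e.Joins u w := by
  by_contra hcon
  push Not at hcon
  apply hu
  rw [degree, List.sum_eq_zero_iff]
  intro n hn
  obtain ⟨e, he, rfl⟩ := List.mem_map.1 hn
  have h1 : e.src ≠ u := fun h1 => hcon e he e.dst (Or.inl ⟨h1, rfl⟩)
  have h2 : e.dst ≠ u := fun h2 => hcon e he e.src (Or.inr ⟨rfl, h2⟩)
  simp [incidence, h1, h2]

/-- This matches the convention of `cellOf`, which gives an unused vertex its own index as name:
equality of names can then express connectivity for all frontier vertices, used or not. -/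
theorem Conn.eq_of_degree_eq_zero {T : List (Edge h v)} {u w : Vertex h v} (hc : Conn T u w)
    (hu : degree T u = 0) : u = w := by
  rcases Relation.ReflTransGen.cases_head hc with h1 | ⟨z, ⟨e, he, hj⟩, -⟩
  · exact h1
  · exact absurd hu (degree_ne_zero_of_joins he hj)

/-- A connection that crosses `e` several times can be shortened to one that crosses it at most
once. -/
theorem conn_replicate_append {T : List (Edge h v)} {e : Edge h v} {m : ℕ} (hm : m ≠ 0)
    {x y : Vertex h v} : Conn (List.replicate m e ++ T) x y ↔ Conn T x y ∨
      (Conn T x e.src ∧ Conn T e.dst y) ∨ (Conn T x e.dst ∧ Conn T e.src y) := by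
  have hsub : T ⊆ List.replicate m e ++ T := List.subset_append_right _ _
  have hmem : e ∈ List.replicate m e ++ T := by simp [hm]
  have hsd : Conn (List.replicate m e ++ T) e.src e.dst := .of_joins hmem (Or.inl ⟨rfl, rfl⟩)
  constructor
  · intro hc
    induction hc with
    | refl => exact Or.inl (.refl x)
    | @tail y z _ hyz ih =>
      obtain ⟨e', he', hj⟩ := hyz
      rcases List.mem_append.1 he' with he' | he'
      · obtain rfl := List.eq_of_mem_replicate he'
        rcases hj with ⟨rfl, rfl⟩ | ⟨rfl, rfl⟩
        · rcases ih with ih | ⟨h1, h2⟩ | ⟨h1, h2⟩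
          · exact Or.inr (Or.inl ⟨ih, .refl _⟩)
          · exact Or.inr (Or.inl ⟨h1, .refl _⟩)
          · exact Or.inl h1
        · rcases ih with ih | ⟨h1, h2⟩ | ⟨h1, h2⟩
          · exact Or.inr (Or.inr ⟨ih, .refl _⟩)
          · exact Or.inl h1
          · exact Or.inr (Or.inr ⟨h1, .refl _⟩)
      · have := Conn.of_joins he' hj
        rcases ih with ih | ⟨h1, h2⟩ | ⟨h1, h2⟩
        · exact Or.inl (ih.trans this)
        · exact Or.inr (Or.inl ⟨h1, h2.trans this⟩)
        · exact Or.inr (Or.inr ⟨h1, h2.trans this⟩)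
  · rintro (h1 | ⟨h1, h2⟩ | ⟨h1, h2⟩)
    · exact h1.mono hsub
    · exact (h1.mono hsub).trans (hsd.trans (h2.mono hsub))
    · exact (h1.mono hsub).trans (hsd.symm.trans (h2.mono hsub))

/-- A tour subgraph: an even and connected multigraph that contains the vertices to visit. -/
structure IsTourGraph (I : Grid ℝ h v) (T : List (Edge h v)) : Prop where
  even : ∀ u, Even (degree T u)
  covers : ∀ i j, I.mand i j = true → degree T (i, j) ≠ 0
  conn : ∀ u w, degree T u ≠ 0 → degree T w ≠ 0 → Conn T u w

/-! ### The moving frontier. -/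

/-- The frontier moves from `f` to `f'` when the segments of a list are treated; `f i` is the number
of the vertical line on which the frontier vertex of the `i`-th horizontal line lies. -/
inductive Front : (Fin h → Fin v) → List (Edge h v) → (Fin h → Fin v) → Prop
  | nil (f : Fin h → Fin v) : Front f [] f
  | vert {f f' : Fin h → Fin v} {es : List (Edge h v)} {i i' : Fin h} {j : Fin v} :
    f i = j → f i' = j → i'.val = i.val + 1 → Front f es f' → Front f (.vert i i' j :: es) f'
  | horiz {f f' : Fin h → Fin v} {es : List (Edge h v)} {i : Fin h} {j j' : Fin v} :
    f i = j → j'.val = j.val + 1 → Front (Function.update f i j') es f' →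
    Front f (.horiz i j j' :: es) f'

theorem Front.append {f g f' : Fin h → Fin v} {es es' : List (Edge h v)} (h1 : Front f es g)
    (h2 : Front g es' f') : Front f (es ++ es') f' := by
  induction h1 with
  | nil => exact h2
  | vert a b c _ ih => exact .vert a b c (ih h2)
  | horiz a b _ ih => exact .horiz a b (ih h2)

theorem Front.append_inv {f f' : Fin h → Fin v} {es es' : List (Edge h v)}
    (h1 : Front f (es ++ es') f') : ∃ g, Front f es g ∧ Front g es' f' := by
  induction es generalizing f with
  | nil => exact ⟨f, .nil f, h1⟩
  | cons e es ih =>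
    cases h1 with
    | vert a b c h2 =>
      obtain ⟨g, h3, h4⟩ := ih h2
      exact ⟨g, .vert a b c h3, h4⟩
    | horiz a b h2 =>
      obtain ⟨g, h3, h4⟩ := ih h2
      exact ⟨g, .horiz a b h3, h4⟩

theorem Front.adjacent {f f' : Fin h → Fin v} {es : List (Edge h v)} (h1 : Front f es f') :
    ∀ e ∈ es, e.Adjacent := by
  induction h1 with
  | nil => simp
  | vert a b c _ ih => simpa [Edge.Adjacent, c] using ih
  | horiz a b _ ih => simpa [Edge.Adjacent, b] using ih

/-- The frontier only moves to the right, so the segments still to come never touch a vertex to its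
left. -/
theorem Front.le_of_joins {f f' : Fin h → Fin v} {es : List (Edge h v)} (h1 : Front f es f') :
    ∀ e ∈ es, ∀ u w, e.Joins u w → f u.1 ≤ u.2 := by
  induction h1 with
  | nil => simp
  | @vert f f' es i i' j a b c _ ih =>
    intro e he u w hj
    rcases List.mem_cons.1 he with rfl | he
    · rcases hj with ⟨rfl, -⟩ | ⟨-, rfl⟩
      · exact a.le
      · exact b.le
    · exact ih e he u w hj
  | @horiz f f' es i j j' a b _ ih =>
    intro e he u w hj
    rcases List.mem_cons.1 he with rfl | he
    · rcases hj with ⟨rfl, -⟩ | ⟨-, rfl⟩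
      · exact a.le
      · change f i ≤ j'
        rw [a, Fin.le_def]
        omega
    · have := ih e he u w hj
      by_cases hu : u.1 = i
      · rw [hu, Function.update_self] at this
        rw [hu, a, Fin.le_def]
        rw [Fin.le_def] at this
        omega
      · rwa [Function.update_of_ne hu] at this

theorem Front.degree_eq_zero {f f' : Fin h → Fin v} {es S : List (Edge h v)} (h1 : Front f es f')
    (hS : S ⊆ es) {u : Vertex h v} (hu : u.2 < f u.1) : degree S u = 0 := by
  by_contra h0
  obtain ⟨e, he, w, hj⟩ := exists_joins_of_degree_ne_zero h0
  exact not_lt.2 (h1.le_of_joins e (hS he) u w hj) hu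

theorem front_vert (j : Fin v) (es : List (Edge h v))
    (hes : ∀ e ∈ es, ∃ i i' : Fin h, i'.val = i.val + 1 ∧ e = .vert i i' j) :
    Front (fun _ => j) es fun _ => j := by
  induction es with
  | nil => exact .nil _
  | cons e es ih =>
    obtain ⟨i, i', h1, rfl⟩ := hes e (by simp)
    exact .vert rfl rfl h1 (ih fun e he => hes e (by simp [he]))

theorem front_horiz (j j' : Fin v) (hj : j'.val = j.val + 1) (l : List (Fin h)) (hl : l.Nodup)
    (f : Fin h → Fin v) (hf : ∀ i ∈ l, f i = j) :
    Front f (l.map fun i => .horiz i j j') fun i => if i ∈ l then j' else f i := by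
  induction l generalizing f with
  | nil => simpa using Front.nil f
  | cons i l ih =>
    obtain ⟨h1, h2⟩ := List.nodup_cons.1 hl
    refine .horiz (hf i (by simp)) hj ?_
    have := ih h2 (Function.update f i j') fun k hk => by
      rw [Function.update_of_ne (fun hki => h1 (by rw [← hki]; exact hk))]
      exact hf k (by simp [hk])
    convert this using 1
    funext k
    by_cases hki : k = i
    · subst hki
      simp
    · simp [hki]

theorem front_edges (hv : 0 < v) (f : Fin h → Fin v) (hf : ∀ i, (f i).val = 0) :
    ∃ f', Front f (edges h v) f' ∧ ∀ i, (f' i).val + 1 = v := by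
  -- Induction on the number `n` of vertical lines to the right of `j`, for the part of the edge
  -- list that begins at line `j`.
  have key : ∀ (n : ℕ) (j : Fin v), j.val + n + 1 = v → ∃ f', Front (fun _ : Fin h => j)
      (((List.finRange v).drop j.val).flatMap fun j => vertEdges h v j ++ horizEdges h v j) f' ∧
      ∀ i, (f' i).val + 1 = v := by
    intro n
    induction n with
    | zero =>
      intro j hj
      rw [List.drop_eq_getElem_cons (by simp), List.drop_eq_nil_of_le (by simp; omega)]
      refine ⟨fun _ => j, ?_, fun _ => hj⟩
      have h1 : horizEdges h v j = [] := by
        rw [horizEdges, dif_neg (by omega)]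
      simpa [h1] using front_vert j (vertEdges h v j) fun e he => mem_vertEdges.1 he
    | succ n ih =>
      intro j hj
      have hj1 : j.val + 1 < v := by omega
      obtain ⟨f', h1, h2⟩ := ih ⟨j.val + 1, hj1⟩ (by simp; omega)
      refine ⟨f', ?_, h2⟩
      rw [List.drop_eq_getElem_cons (by simp)]
      simp only [List.flatMap_cons, List.getElem_finRange, Fin.cast_mk, Fin.eta]
      refine Front.append (Front.append (front_vert j _ fun e he => mem_vertEdges.1 he) ?_) h1
      have := front_horiz j ⟨j.val + 1, hj1⟩ rfl (List.finRange h) (List.nodup_finRange h)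
        (fun _ => j) (fun _ _ => rfl)
      rw [horizEdges, dif_pos hj1]
      simpa using this
  obtain ⟨f', h1, h2⟩ := key (v - 1) ⟨0, hv⟩ (by simp; omega)
  refine ⟨f', ?_, h2⟩
  have h3 : f = fun _ => ⟨0, hv⟩ := funext fun i => Fin.ext (hf i)
  rw [h3]
  simpa [edges] using h1

/-! ### The meaning of a state. -/

/-- The state `ω` describes the partial subgraph `T` with the frontier `f`. -/
structure Describes (I : Grid ℝ h v) (f : Fin h → Fin v) (T : List (Edge h v)) (ω : State h) :
    Prop where
  none_iff : ∀ k, ω k = none ↔ degree T (k, f k) = 0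
  odd_iff : ∀ k, (cellOf ω k).1 = true ↔ Odd (degree T (k, f k))
  name_iff : ∀ k l, (cellOf ω k).2 = (cellOf ω l).2 ↔ Conn T (k, f k) (l, f l)
  past_even : ∀ k j, j < f k → Even (degree T (k, j))
  past_covers : ∀ k j, j < f k → I.mand k j = true → degree T (k, j) ≠ 0
  past_conn : ∀ k j, j < f k → degree T (k, j) ≠ 0 → ∃ l, Conn T (k, j) (l, f l)
  future : ∀ k j, f k < j → degree T (k, j) = 0

theorem describes_nil (I : Grid ℝ h v) (f : Fin h → Fin v) (hf : ∀ i, (f i).val = 0) :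
    Describes I f [] fun _ => none where
  none_iff := by simp
  odd_iff := by simp [cellOf]
  name_iff k l := by
    simp only [cellOf, Option.getD_none]
    constructor
    · rintro rfl
      exact .refl _
    · intro hc
      exact congrArg Prod.fst (hc.eq_of_degree_eq_zero rfl)
  past_even k j hj := by
    rw [Fin.lt_def, hf] at hj
    omega
  past_covers k j hj := by
    rw [Fin.lt_def, hf] at hj
    omega
  past_conn := by simp
  future := by simp

theorem IsState.comp_name {ω : State h} (hω : IsState ω) {k c : Fin h} (hk : comp ω k = some c) :
    comp ω c = some c := (isState_iff.1 hω).1.name k c hk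

theorem cellOf_of_none {ω : State h} {k : Fin h} (hk : ω k = none) : cellOf ω k = (false, k) := by
  simp [cellOf, hk]

theorem cellOf_of_some {ω : State h} {k : Fin h} {pc : Bool × Fin h} (hk : ω k = some pc) :
    cellOf ω k = pc := by
  simp [cellOf, hk]

/-- Both ends lie on the frontier, which does not move, so past and future keep their degrees. On
the frontier, merging two names is the rule of `conn_replicate_append`. -/
theorem Describes.addVert {I : Grid ℝ h v} {f : Fin h → Fin v} {T : List (Edge h v)} {ω : State h}
    (hd : Describes I f T ω) {i i' : Fin h} {j : Fin v} (hi : f i = j)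
    (hi' : f i' = j) (hii : i'.val = i.val + 1) (m : Fin 3) {ω' : State h}
    (hω' : (addVert i i' m ω).val = some ω') :
    Describes I f (List.replicate m.val (.vert i i' j) ++ T) ω' := by
  rw [addVert_val, Option.some.injEq] at hω'
  subst hω'
  by_cases hm : m = 0
  · simpa [hm] using hd
  rw [if_neg hm]
  have hm0 : m.val ≠ 0 := fun h0 => hm (Fin.ext h0)
  have hne : i ≠ i' := fun hh => by rw [hh] at hii; omega
  set e : Edge h v := .vert i i' j with he
  have hsrc : e.src = (i, f i) := by rw [hi]; rfl
  have hdst : e.dst = (i', f i') := by rw [hi']; rfl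
  set a := (cellOf ω i).2 with ha
  set b := (cellOf ω i').2 with hb
  have hdeg : ∀ u, degree (List.replicate m.val e ++ T) u = m.val * incidence e u + degree T u := by
    intro u
    rw [degree_append, degree_replicate]
  have hinc : ∀ k, incidence e (k, f k) = (if i = k then 1 else 0) + if i' = k then 1 else 0 := by
    intro k
    have : ∀ l, ((l, f l) = (k, f k)) ↔ l = k := fun l =>
      ⟨fun hh => congrArg Prod.fst hh, fun hh => by rw [hh]⟩
    simp only [incidence, hsrc, hdst, this]
  have hinc0 : ∀ k j', j' ≠ f k → incidence e (k, j') = 0 := by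
    intro k j' hj
    rw [incidence, hsrc, hdst, if_neg, if_neg]
    · intro hh
      obtain ⟨rfl, rfl⟩ := Prod.mk.inj hh
      exact hj rfl
    · intro hh
      obtain ⟨rfl, rfl⟩ := Prod.mk.inj hh
      exact hj rfl
  -- The default name of an unused vertex is borne by no other vertex, since an isolated vertex is
  -- connected only to itself.
  have hfresh : ∀ k, ω k = none → ∀ l, l ≠ k → (cellOf ω l).2 ≠ k := by
    intro k hk l hl hh
    have h1 : (cellOf ω k).2 = k := by rw [cellOf_of_none hk]
    rw [← h1, eq_comm, hd.name_iff k l] at hh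
    exact hl (congrArg Prod.fst (hh.eq_of_degree_eq_zero ((hd.none_iff k).1 hk))).symm
  have hτ : ∀ k, touch i i' m ω k = if k = i ∨ k = i' then
      some ((cellOf ω k).1 ^^ decide (m = 1), (cellOf ω k).2) else ω k := by
    intro k
    simp only [touch, Function.update_apply]
    by_cases h1 : k = i'
    · simp [h1]
    · by_cases h2 : k = i
      · simp [h2, hne]
      · simp [h1, h2]
  have hnone : ∀ k, merge a b (touch i i' m ω) k = none ↔ ω k = none ∧ k ≠ i ∧ k ≠ i' := by
    intro k
    simp only [merge, Option.map_eq_none_iff, hτ]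
    split_ifs with h1
    · simp only [false_iff]
      tauto
    · tauto
  -- The renaming also holds for the default names of unused vertices: those other than `i` and `i'`
  -- are neither `a` nor `b`.
  have hname : ∀ k, (cellOf (merge a b (touch i i' m ω)) k).2 =
      if (cellOf ω k).2 = a ∨ (cellOf ω k).2 = b then min a b else (cellOf ω k).2 := by
    intro k
    by_cases hk : ω k = none ∧ k ≠ i ∧ k ≠ i'
    · rw [cellOf_of_none ((hnone k).2 hk), cellOf_of_none hk.1, if_neg]
      rintro (h1 | h1)
      · exact hfresh k hk.1 i (Ne.symm hk.2.1) h1.symm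
      · exact hfresh k hk.1 i' (Ne.symm hk.2.2) h1.symm
    · have h1 : ∃ p, touch i i' m ω k = some (p, (cellOf ω k).2) := by
        rw [hτ]
        split_ifs with h2
        · exact ⟨_, rfl⟩
        · cases hω : ω k with
          | none => exact absurd ⟨hω, by tauto⟩ hk
          | some pc => exact ⟨pc.1, by rw [cellOf_of_some hω]⟩
      obtain ⟨p, hp⟩ := h1
      have h2 : merge a b (touch i i' m ω) k = some (p,
          if (cellOf ω k).2 = a ∨ (cellOf ω k).2 = b then min a b else (cellOf ω k).2) := by
        simp [merge, hp]
      rw [cellOf_of_some h2]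
  have hpar : ∀ k, (cellOf (merge a b (touch i i' m ω)) k).1 =
      if k = i ∨ k = i' then ((cellOf ω k).1 ^^ decide (m = 1)) else (cellOf ω k).1 := by
    intro k
    by_cases h1 : k = i ∨ k = i'
    · rw [if_pos h1]
      simp only [cellOf, merge, hτ, if_pos h1]
      rfl
    · rw [if_neg h1]
      simp only [cellOf, merge, hτ, if_neg h1]
      cases ω k <;> rfl
  refine ⟨?_, ?_, ?_, ?_, ?_, ?_, ?_⟩
  · intro k
    rw [hnone, hdeg, hinc, hd.none_iff]
    constructor
    · rintro ⟨h1, h2, h3⟩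
      simp [h1, Ne.symm h2, Ne.symm h3]
    · intro h1
      have h2 := Nat.eq_zero_of_add_eq_zero h1
      refine ⟨h2.2, ?_, ?_⟩
      · rintro rfl
        simp [hm0] at h2
      · rintro rfl
        simp [hm0] at h2
  · intro k
    rw [hpar, hdeg, hinc]
    by_cases h1 : k = i ∨ k = i'
    · rw [if_pos h1]
      have h2 : (if i = k then 1 else 0) + (if i' = k then 1 else 0) = 1 := by
        rcases h1 with rfl | rfl
        · simp [Ne.symm hne]
        · simp [hne]
      rw [h2, mul_one, Nat.odd_add]
      have h3 := hd.odd_iff k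
      have h4 : Odd m.val ↔ m = 1 := by
        fin_cases m <;> simp
      rw [h4, ← Nat.not_odd_iff_even, ← h3]
      cases (cellOf ω k).1 <;> by_cases h5 : m = 1 <;> simp [h5]
    · rw [if_neg h1]
      have h2 : (if i = k then 1 else 0) + (if i' = k then 1 else 0) = 0 := by
        rw [if_neg (fun hh => h1 (Or.inl hh.symm)), if_neg (fun hh => h1 (Or.inr hh.symm))]
      rw [h2, mul_zero, zero_add]
      exact hd.odd_iff k
  · intro k l
    rw [hname, hname, conn_replicate_append hm0, hsrc, hdst, ← hd.name_iff, ← hd.name_iff,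
      ← hd.name_iff, ← hd.name_iff, ← hd.name_iff]
    rw [← ha, ← hb]
    generalize (cellOf ω k).2 = x
    generalize (cellOf ω l).2 = y
    rcases min_choice a b with h2 | h2 <;> rw [h2] <;> grind
  · intro k j' hj
    rw [hdeg, hinc0 k j' hj.ne, mul_zero, zero_add]
    exact hd.past_even k j' hj
  · intro k j' hj
    rw [hdeg, hinc0 k j' hj.ne, mul_zero, zero_add]
    exact hd.past_covers k j' hj
  · intro k j' hj
    rw [hdeg, hinc0 k j' hj.ne, mul_zero, zero_add]
    intro h1
    obtain ⟨l, hl⟩ := hd.past_conn k j' hj h1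
    exact ⟨l, hl.mono (List.subset_append_right _ _)⟩
  · intro k j' hj
    rw [hdeg, hinc0 k j' hj.ne', mul_zero, zero_add]
    exact hd.future k j' hj

/-- The names after a vertex has left the frontier. -/
theorem removeVertex_names {ω : State h} (hω : IsState ω) {i c : Fin h}
    (hi : ω i = some (false, c)) {ω' : State h} (hω' : (removeVertex i c ω).val = some ω') :
    ω' i = none ∧ (∀ k, k ≠ i → (ω' k = none ↔ ω k = none) ∧ (cellOf ω' k).1 = (cellOf ω k).1 ∧
      (cellOf ω' k).2 ≠ i) ∧
    (∀ k l, k ≠ i → l ≠ i →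
      ((cellOf ω' k).2 = (cellOf ω' l).2 ↔ (cellOf ω k).2 = (cellOf ω l).2)) ∧
    ∃ k, k ≠ i ∧ (cellOf ω k).2 = (cellOf ω i).2 := by
  have hci : (cellOf ω i).2 = c := by rw [cellOf_of_some hi]
  have hcomp : comp ω i = some c := by simp [comp, hi]
  rw [removeVertex_val] at hω'
  have hcell : ∀ k, k ≠ i → Function.update ω i none k = ω k :=
    fun k hk => Function.update_of_ne hk _ _
  have hnm : ∀ k, ω k ≠ none → comp ω k = some (cellOf ω k).2 := by
    intro k hk
    obtain ⟨pc, hpc⟩ := Option.ne_none_iff_exists'.1 hk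
    rw [cellOf_of_some hpc]
    simp [comp, hpc]
  by_cases hc : c = i
  · rw [if_pos hc, Option.map_eq_some_iff] at hω'
    obtain ⟨k0, hk0, rfl⟩ := hω'
    have hk0 := (find?_finRange_eq_some hk0).1
    simp only [decide_eq_true_eq] at hk0
    have hk0i : k0 ≠ i := by
      rintro rfl
      simp [comp] at hk0
    have hk1 : comp ω k0 = some i := by
      rw [comp, hcell k0 hk0i] at hk0
      exact hk0
    have hk2 : ω k0 ≠ none := by
      intro hh
      simp [comp, hh] at hk1
    have hk3 : (cellOf ω k0).2 = i := by
      rw [hnm k0 hk2] at hk1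
      exact Option.some.inj hk1
    -- The vertex `k0` is in use under the name `i`, so it is neither a default name nor the name of
    -- a component.
    have hfresh : ∀ l, (cellOf ω l).2 ≠ k0 := by
      intro l hl
      by_cases hln : ω l = none
      · rw [cellOf_of_none hln] at hl
        subst hl
        exact hk2 hln
      · have h1 := hω.comp_name (hnm l hln)
        rw [hl, hk1] at h1
        exact hk0i (Option.some.inj h1).symm
    have hnew : ∀ k, k ≠ i → cellOf (fun l => (Function.update ω i none l).map fun pc =>
        (pc.1, if pc.2 = i then k0 else pc.2)) k =
        ((cellOf ω k).1, if (cellOf ω k).2 = i then k0 else (cellOf ω k).2) := by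
      intro k hk
      rcases Option.eq_none_or_eq_some (ω k) with h1 | ⟨pc, h1⟩
      · simp [cellOf, h1, hk]
      · simp [cellOf, hcell k hk, h1]
    refine ⟨by simp, ?_, ?_, k0, hk0i, ?_⟩
    · intro k hk
      rw [hnew k hk]
      refine ⟨by simp [hcell k hk], rfl, ?_⟩
      dsimp only
      split_ifs with h1
      · exact hk0i
      · exact h1
    · intro k l hk hl
      rw [hnew k hk, hnew l hl]
      have h1 := hfresh k
      have h2 := hfresh l
      dsimp only
      grind
    · rw [hk3, hci, hc]
  · rw [if_neg hc, Option.some.injEq] at hω'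
    subst hω'
    have hnew : ∀ k, k ≠ i → cellOf (Function.update ω i none) k = cellOf ω k := by
      intro k hk
      simp only [cellOf, hcell k hk]
    -- The component is named after `c ≠ i`, and `c` itself is the frontier vertex that keeps it
    -- alive.
    have hcc := hω.comp_name hcomp
    refine ⟨by simp, ?_, ?_, c, hc, ?_⟩
    · intro k hk
      rw [hnew k hk, hcell k hk]
      refine ⟨Iff.rfl, rfl, ?_⟩
      intro hh
      by_cases hkn : ω k = none
      · rw [cellOf_of_none hkn] at hh
        exact hk hh
      · have h1 := hω.comp_name (hnm k hkn)
        rw [hh, hcomp] at h1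
        exact hc (Option.some.inj h1)
    · intro k l hk hl
      rw [hnew k hk, hnew l hl]
    · rw [hci]
      have h1 : ω c ≠ none := by
        intro hh
        simp [comp, hh] at hcc
      rw [hnm c h1] at hcc
      exact Option.some.inj hcc

section Horiz
variable {I : Grid ℝ h v} {f : Fin h → Fin v} {T : List (Edge h v)} {ω : State h}
  {i : Fin h} {j j' : Fin v}

/-- The case of a horizontal segment that is used. -/
theorem Describes.addHoriz_used (hd : Describes I f T ω) (hi : f i = j) (hj : j'.val = j.val + 1)
    {m : Fin 3} (hm : m ≠ 0) (hpar : Odd (degree T (i, j)) ↔ m = 1) {ω' : State h}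
    (hother : ∀ k, k ≠ i → ω' k = ω k) (hnone : ω' i ≠ none)
    (hcell : cellOf ω' i = (decide (m = 1), (cellOf ω i).2)) :
    Describes I (Function.update f i j') (List.replicate m.val (.horiz i j j') ++ T) ω' := by
  have hm0 : m.val ≠ 0 := fun h0 => hm (Fin.ext h0)
  set e : Edge h v := .horiz i j j' with he
  have hsrc : e.src = (i, j) := rfl
  have hdst : e.dst = (i, j') := rfl
  have hjj : j < j' := by rw [Fin.lt_def]; omega
  have hw : degree T (i, j') = 0 := hd.future i j' (by rw [hi]; exact hjj)
  have hdeg : ∀ u, degree (List.replicate m.val e ++ T) u = m.val * incidence e u + degree T u := by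
    intro u
    rw [degree_append, degree_replicate]
  have hincw : incidence e (i, j') = 1 := by
    simp [incidence, hsrc, hdst, hjj.ne]
  have hincu : incidence e (i, j) = 1 := by
    simp [incidence, hsrc, hdst, hjj.ne']
  have hinc0 : ∀ u, u ≠ (i, j) → u ≠ (i, j') → incidence e u = 0 := by
    intro u h1 h2
    rw [incidence, hsrc, hdst, if_neg (Ne.symm h1), if_neg (Ne.symm h2)]
  have hinck : ∀ k, k ≠ i → ∀ j0, incidence e (k, j0) = 0 := fun k hk j0 =>
    hinc0 _ (fun hh => hk (congrArg Prod.fst hh)) fun hh => hk (congrArg Prod.fst hh)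
  have hmodd : Odd m.val ↔ m = 1 := by fin_cases m <;> simp
  have hname : ∀ k, (cellOf ω' k).2 = (cellOf ω k).2 := by
    intro k
    by_cases hk : k = i
    · rw [hk, hcell]
    · simp only [cellOf, hother k hk]
  have hsub : T ⊆ List.replicate m.val e ++ T := List.subset_append_right _ _
  have huw : Conn (List.replicate m.val e ++ T) (i, j) (i, j') :=
    .of_joins (e := e) (by simp [hm0]) (Or.inl ⟨rfl, rfl⟩)
  have hwl : ∀ u : Vertex h v, u ≠ (i, j') → ¬ Conn T u (i, j') := fun u hu hc =>
    hu (hc.symm.eq_of_degree_eq_zero hw).symm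
  -- The right end is isolated in `T`, so the new copies are a dead end and connect no two old
  -- vertices.
  have hold : ∀ x y : Vertex h v, x ≠ (i, j') → y ≠ (i, j') →
      (Conn (List.replicate m.val e ++ T) x y ↔ Conn T x y) := by
    intro x y hx hy
    rw [conn_replicate_append hm0, hsrc, hdst]
    constructor
    · rintro (h1 | ⟨-, h1⟩ | ⟨h1, -⟩)
      · exact h1
      · exact absurd h1.symm (hwl y hy)
      · exact absurd h1 (hwl x hx)
    · exact Or.inl
  have hnew : ∀ k, Conn (List.replicate m.val e ++ T) (k, f k) (k, Function.update f i j' k) := by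
    intro k
    by_cases hk : k = i
    · subst hk
      rw [Function.update_self, hi]
      exact huw
    · rw [Function.update_of_ne hk]
      exact .refl _
  have hfne : ∀ k, (k, f k) ≠ (i, j') := by
    intro k hh
    obtain ⟨rfl, h2⟩ := Prod.mk.inj hh
    rw [hi] at h2
    exact hjj.ne h2
  -- The only vertex that newly enters the past is `(i, j)`.
  have hpast : ∀ k j0, j0 < Function.update f i j' k → (k, j0) = (i, j) ∨
      (j0 < f k ∧ incidence e (k, j0) = 0) := by
    intro k j0 hj0
    by_cases hk : k = i
    · subst hk
      rw [Function.update_self, Fin.lt_def] at hj0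
      by_cases h1 : j0 = j
      · exact Or.inl (by rw [h1])
      · rw [Fin.ext_iff] at h1
        refine Or.inr ⟨by rw [hi, Fin.lt_def]; omega, hinc0 _ ?_ ?_⟩
        · intro hh
          exact h1 (congrArg Fin.val (Prod.mk.inj hh).2)
        · intro hh
          have := congrArg Fin.val (Prod.mk.inj hh).2
          omega
    · rw [Function.update_of_ne hk] at hj0
      exact Or.inr ⟨hj0, hinck k hk j0⟩
  refine ⟨?_, ?_, ?_, ?_, ?_, ?_, ?_⟩
  · intro k
    by_cases hk : k = i
    · subst hk
      rw [Function.update_self, hdeg, hincw, hw]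
      simp [hnone, hm0]
    · rw [Function.update_of_ne hk, hdeg, hinck k hk, hother k hk, hd.none_iff]
      simp
  · intro k
    by_cases hk : k = i
    · subst hk
      rw [Function.update_self, hdeg, hincw, hw, hcell]
      simp [hmodd]
    · rw [Function.update_of_ne hk, hdeg, hinck k hk, cellOf, hother k hk, mul_zero, zero_add]
      exact hd.odd_iff k
  · intro k l
    rw [hname, hname, hd.name_iff, ← hold _ _ (hfne k) (hfne l)]
    exact ⟨fun hc => ((hnew k).symm.trans hc).trans (hnew l),
      fun hc => ((hnew k).trans hc).trans (hnew l).symm⟩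
  · intro k j0 hj0
    rcases hpast k j0 hj0 with h1 | ⟨h1, h2⟩
    · rw [h1, hdeg, hincu, mul_one, Nat.even_add, ← Nat.not_odd_iff_even, ← Nat.not_odd_iff_even,
        hpar, hmodd]
    · rw [hdeg, h2, mul_zero, zero_add]
      exact hd.past_even k j0 h1
  · intro k j0 hj0 hmand
    rcases hpast k j0 hj0 with h1 | ⟨h1, h2⟩
    · rw [h1, hdeg, hincu]
      omega
    · rw [hdeg, h2, mul_zero, zero_add]
      exact hd.past_covers k j0 h1 hmand
  · intro k j0 hj0 hpos
    rcases hpast k j0 hj0 with h1 | ⟨h1, h2⟩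
    · rw [h1]
      refine ⟨i, ?_⟩
      rw [Function.update_self]
      exact huw
    · rw [hdeg, h2, mul_zero, zero_add] at hpos
      obtain ⟨l, hl⟩ := hd.past_conn k j0 h1 hpos
      exact ⟨l, (hl.mono hsub).trans (hnew l)⟩
  · intro k j0 hj0
    by_cases hk : k = i
    · subst hk
      rw [Function.update_self, Fin.lt_def] at hj0
      rw [hdeg, hd.future k j0 (by rw [hi, Fin.lt_def]; omega), hinc0, mul_zero]
      · intro hh
        have := congrArg Fin.val (Prod.mk.inj hh).2
        omega
      · intro hh
        have := congrArg Fin.val (Prod.mk.inj hh).2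
        omega
    · rw [Function.update_of_ne hk] at hj0
      rw [hdeg, hinck k hk, hd.future k j0 hj0, mul_zero]

/-- The case of a horizontal segment that is not used. -/
theorem Describes.addHoriz_unused (hd : Describes I f T ω) (hi : f i = j)
    (hj : j'.val = j.val + 1) (heven : Even (degree T (i, j)))
    (hcov : I.mand i j = true → degree T (i, j) ≠ 0)
    (hex : degree T (i, j) ≠ 0 → ∃ k, k ≠ i ∧ (cellOf ω k).2 = (cellOf ω i).2) {ω' : State h}
    (hnone : ω' i = none)
    (hother : ∀ k, k ≠ i → (ω' k = none ↔ ω k = none) ∧ (cellOf ω' k).1 = (cellOf ω k).1 ∧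
      (cellOf ω' k).2 ≠ i)
    (hname : ∀ k l, k ≠ i → l ≠ i →
      ((cellOf ω' k).2 = (cellOf ω' l).2 ↔ (cellOf ω k).2 = (cellOf ω l).2)) :
    Describes I (Function.update f i j') T ω' := by
  have hjj : j < j' := by rw [Fin.lt_def]; omega
  have hw : degree T (i, j') = 0 := hd.future i j' (by rw [hi]; exact hjj)
  have hpast : ∀ k j0, j0 < Function.update f i j' k → (k, j0) = (i, j) ∨ j0 < f k := by
    intro k j0 hj0
    by_cases hk : k = i
    · subst hk
      rw [Function.update_self, Fin.lt_def] at hj0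
      by_cases h1 : j0 = j
      · exact Or.inl (by rw [h1])
      · rw [Fin.ext_iff] at h1
        exact Or.inr (by rw [hi, Fin.lt_def]; omega)
    · rw [Function.update_of_ne hk] at hj0
      exact Or.inr hj0
  -- What was attached to the frontier through the leaving vertex is reattached at another frontier
  -- vertex of its component, provided by `hex`.
  have hreroute : ∀ x, degree T x ≠ 0 → Conn T x (i, j) → ∃ l, l ≠ i ∧ Conn T x (l, f l) := by
    intro x hx hc
    by_cases h0 : degree T (i, j) = 0
    · have := hc.symm.eq_of_degree_eq_zero h0
      rw [this] at h0
      exact absurd h0 hx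
    · obtain ⟨k, hk, h1⟩ := hex h0
      rw [hd.name_iff, hi] at h1
      exact ⟨k, hk, hc.trans h1.symm⟩
  refine ⟨?_, ?_, ?_, ?_, ?_, ?_, ?_⟩
  · intro k
    by_cases hk : k = i
    · subst hk
      rw [Function.update_self, hw]
      simp [hnone]
    · rw [Function.update_of_ne hk, (hother k hk).1, hd.none_iff]
  · intro k
    by_cases hk : k = i
    · subst hk
      rw [Function.update_self, hw, cellOf_of_none hnone]
      simp
    · rw [Function.update_of_ne hk, (hother k hk).2.1, hd.odd_iff]
  · intro k l
    by_cases hk : k = i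
    · subst hk
      by_cases hl : l = k
      · subst hl
        exact iff_of_true rfl (.refl _)
      · rw [Function.update_self, Function.update_of_ne hl, cellOf_of_none hnone]
        refine iff_of_false (Ne.symm (hother l hl).2.2) fun hc => hl ?_
        exact (congrArg Prod.fst (hc.eq_of_degree_eq_zero hw)).symm
    · by_cases hl : l = i
      · subst hl
        rw [Function.update_self, Function.update_of_ne hk, cellOf_of_none hnone]
        refine iff_of_false (hother k hk).2.2 fun hc => hk ?_
        exact (congrArg Prod.fst (hc.symm.eq_of_degree_eq_zero hw)).symm
      · rw [Function.update_of_ne hk, Function.update_of_ne hl, hname k l hk hl, hd.name_iff]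
  · intro k j0 hj0
    rcases hpast k j0 hj0 with h1 | h1
    · rwa [h1]
    · exact hd.past_even k j0 h1
  · intro k j0 hj0 hmand
    rcases hpast k j0 hj0 with h1 | h1
    · obtain ⟨rfl, rfl⟩ := Prod.mk.inj h1
      exact hcov hmand
    · exact hd.past_covers k j0 h1 hmand
  · intro k j0 hj0 hpos
    have h2 : ∃ l, l ≠ i ∧ Conn T (k, j0) (l, f l) := by
      rcases hpast k j0 hj0 with h1 | h1
      · refine hreroute _ hpos ?_
        rw [h1]
        exact .refl _
      · obtain ⟨l, hl⟩ := hd.past_conn k j0 h1 hpos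
        by_cases hli : l = i
        · subst hli
          rw [hi] at hl
          exact hreroute _ hpos hl
        · exact ⟨l, hli, hl⟩
    obtain ⟨l, hl, hc⟩ := h2
    refine ⟨l, ?_⟩
    rwa [Function.update_of_ne hl]
  · intro k j0 hj0
    by_cases hk : k = i
    · subst hk
      rw [Function.update_self, Fin.lt_def] at hj0
      exact hd.future k j0 (by rw [hi, Fin.lt_def]; omega)
    · rw [Function.update_of_ne hk] at hj0
      exact hd.future k j0 hj0

theorem Describes.name_ne (hd : Describes I f T ω) (hi : ω i = none) {k : Fin h} (hk : k ≠ i) :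
    (cellOf ω k).2 ≠ i := by
  intro hh
  have h1 : (cellOf ω i).2 = i := by rw [cellOf_of_none hi]
  rw [← h1, eq_comm, hd.name_iff] at hh
  exact hk (congrArg Prod.fst (hh.eq_of_degree_eq_zero ((hd.none_iff i).1 hi))).symm

theorem Describes.addHoriz (hd : Describes I f T ω) (hω : IsState ω) (hi : f i = j)
    (hj : j'.val = j.val + 1) {m : Fin 3} {ω' : State h}
    (hω' : (addHoriz (I.mand i j) i m ω).val = some ω') :
    Describes I (Function.update f i j') (List.replicate m.val (.horiz i j j') ++ T) ω' := by
  have hodd := hd.odd_iff i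
  have hz := hd.none_iff i
  rw [hi] at hodd hz
  rw [addHoriz_val] at hω'
  -- Five combinations are not rejected outright: an unused or an even vertex with zero or two
  -- copies, and an odd vertex with one copy.
  rcases hωi : ω i with _ | ⟨_ | _, c⟩ <;> rw [hωi] at hω' <;> fin_cases m <;> simp at hω'
  · obtain ⟨h1, rfl⟩ := hω'
    have h0 := hz.1 hωi
    refine hd.addHoriz_unused hi hj (by simp [h0]) (by simp [h1]) (by simp [h0]) hωi ?_ ?_
    · exact fun k hk => ⟨Iff.rfl, rfl, hd.name_ne hωi hk⟩
    · exact fun k l _ _ => Iff.rfl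
  · subst hω'
    have h0 := hz.1 hωi
    refine hd.addHoriz_used (m := 2) hi hj (by decide) (by simp [h0]) ?_ (by simp) ?_
    · exact fun k hk => Function.update_of_ne hk _ _
    · simp [cellOf, hωi]
  · obtain ⟨h1, h2, h3, h4⟩ := removeVertex_names hω hωi hω'
    have h5 : Even (degree T (i, j)) := by
      rw [← Nat.not_odd_iff_even, ← hodd, cellOf_of_some hωi]
      simp
    refine hd.addHoriz_unused hi hj h5 ?_ (fun _ => h4) h1 h2 h3
    intro _ h0
    rw [hz.2 h0] at hωi
    cases hωi
  · subst hω'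
    refine hd.addHoriz_used (m := 2) hi hj (by decide) ?_ (fun _ _ => rfl) (by simp [hωi]) ?_
    · rw [← hodd, cellOf_of_some hωi]
      simp
    · rw [cellOf_of_some hωi]
      rfl
  · subst hω'
    refine hd.addHoriz_used (m := 1) hi hj (by decide) ?_ (fun _ _ => rfl) (by simp [hωi]) ?_
    · rw [← hodd, cellOf_of_some hωi]
      simp
    · rw [cellOf_of_some hωi]
      rfl

end Horiz

/-- Validity of the states is needed along the way: when a vertex leaves, its component survives
because the name of a component is one of its own vertices. -/
theorem Path.describes {I : Grid ℝ h v} {f f' : Fin h → Fin v} (hf : ∀ i, (f i).val = 0)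
    {es T : List (Edge h v)} {ω : State h} (hp : Path I es T ω) (hF : Front f es f') :
    Describes I f' T ω := by
  induction hp generalizing f' with
  | nil =>
    cases hF
    exact describes_nil I f hf
  | @snoc es T e m ω ω' h1 h2 ih =>
    obtain ⟨g, h3, h4⟩ := hF.append_inv
    have hd := ih h3
    have hω := h1.isState h3.adjacent
    cases h4 with
    | vert a b c h5 =>
      cases h5
      exact hd.addVert a b c m h2
    | horiz a b h5 =>
      cases h5
      exact hd.addHoriz hω a b h2

/-- With the frontier on the last vertical line, every vertex is past or on the frontier. Past
vertices satisfy the degree conditions already and are attached to the frontier, so only the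
frontier has to be tested. -/
theorem Describes.isFinal_iff {I : Grid ℝ h v} {f : Fin h → Fin v} {T : List (Edge h v)}
    {ω : State h} (hd : Describes I f T ω) (hf : ∀ i, (f i).val + 1 = v) :
    IsFinal I ω ↔ IsTourGraph I T := by
  have hcase : ∀ k (j : Fin v), j < f k ∨ j = f k := by
    intro k j
    have := hf k
    rw [Fin.lt_def, Fin.ext_iff]
    omega
  have hnm : ∀ k, ω k ≠ none → comp ω k = some (cellOf ω k).2 := by
    intro k hk
    obtain ⟨pc, hpc⟩ := Option.ne_none_iff_exists'.1 hk
    rw [cellOf_of_some hpc]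
    simp [comp, hpc]
  constructor
  · rintro ⟨h1, h2, h3⟩
    refine ⟨?_, ?_, ?_⟩
    · rintro ⟨k, j⟩
      rcases hcase k j with hj | rfl
      · exact hd.past_even k j hj
      · rw [← Nat.not_odd_iff_even, ← hd.odd_iff]
        intro hodd
        cases hk : ω k with
        | none => simp [cellOf, hk] at hodd
        | some pc =>
          rw [cellOf_of_some hk] at hodd
          exact h2 k pc.2 (by rw [hk, ← hodd])
    · intro k j hm
      rcases hcase k j with hj | rfl
      · exact hd.past_covers k j hj hm
      · rw [ne_eq, ← hd.none_iff]
        exact h1 k (f k) (hf k) hm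
    · have hto : ∀ u, degree T u ≠ 0 → ∃ l, ω l ≠ none ∧ Conn T u (l, f l) := by
        rintro ⟨k, j⟩ hu
        have hc : ∃ l, Conn T (k, j) (l, f l) := by
          rcases hcase k j with hj | rfl
          · exact hd.past_conn k j hj hu
          · exact ⟨k, .refl _⟩
        obtain ⟨l, hl⟩ := hc
        refine ⟨l, fun hn => ?_, hl⟩
        have h0 := (hd.none_iff l).1 hn
        rw [← hl.symm.eq_of_degree_eq_zero h0] at hu
        exact hu h0
      intro u w hu hw
      obtain ⟨k, hk, hck⟩ := hto u hu
      obtain ⟨l, hl, hcl⟩ := hto w hw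
      have h4 := h3 k l (Option.isSome_iff_ne_none.2 hk) (Option.isSome_iff_ne_none.2 hl)
      rw [hnm k hk, hnm l hl, Option.some.injEq, hd.name_iff] at h4
      exact hck.trans (h4.trans hcl.symm)
  · rintro ⟨h1, h2, h3⟩
    refine ⟨?_, ?_, ?_⟩
    · intro i j hj hm
      have : j = f i := by
        have := hf i
        rw [Fin.ext_iff]
        omega
      subst this
      rw [ne_eq, hd.none_iff]
      exact h2 i _ hm
    · intro i c hi
      have := (hd.odd_iff i).1 (by rw [cellOf_of_some hi])
      exact Nat.not_even_iff_odd.2 this (h1 _)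
    · intro i k hi hk
      have hi' := Option.isSome_iff_ne_none.1 hi
      have hk' := Option.isSome_iff_ne_none.1 hk
      rw [hnm i hi', hnm k hk', Option.some.injEq, hd.name_iff]
      refine h3 _ _ ?_ ?_
      · rwa [ne_eq, ← hd.none_iff]
      · rwa [ne_eq, ← hd.none_iff]

/-! ### No tour subgraph is lost. -/

/-- The list of segments with given multiplicities, in the order in which it is built. -/
def build (m : Edge h v → Fin 3) (es T : List (Edge h v)) : List (Edge h v) :=
  es.foldl (fun T e => List.replicate (m e).val e ++ T) T

theorem build_cons (m : Edge h v → Fin 3) (e : Edge h v) (es T : List (Edge h v)) :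
    build m (e :: es) T = build m es (List.replicate (m e).val e ++ T) := rfl

theorem exists_build_eq_append (m : Edge h v → Fin 3) (es T : List (Edge h v)) :
    ∃ S, S ⊆ es ∧ build m es T = S ++ T := by
  induction es generalizing T with
  | nil => exact ⟨[], by simp, rfl⟩
  | cons e es ih =>
    obtain ⟨S, h1, h2⟩ := ih (List.replicate (m e).val e ++ T)
    refine ⟨S ++ List.replicate (m e).val e, ?_, ?_⟩
    · refine List.append_subset.2 ⟨List.subset_cons_of_subset _ h1, ?_⟩
      intro x hx
      simp [List.eq_of_mem_replicate hx]
    · rw [build_cons, h2, List.append_assoc]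

/-- A partial subgraph that can be completed to a tour subgraph is not rejected. -/
theorem Describes.exists_transition {I : Grid ℝ h v} {f f' : Fin h → Fin v}
    {S T es : List (Edge h v)} {e : Edge h v} {ω : State h} (hd : Describes I f T ω)
    (hF : Front f (e :: es) f') (m : Fin 3) (hS : S ⊆ es)
    (hT : IsTourGraph I (S ++ (List.replicate m.val e ++ T)))
    (hlast : ∃ r j, j.val + 1 = v ∧ I.mand r j = true) :
    ∃ ω', (transition I e m ω).val = some ω' := by
  cases hF with
  | @vert _ _ _ i i' j a b c h1 =>
    refine ⟨_, addVert_val i i' m ω⟩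
  | @horiz _ _ _ i j j' hi hj h1 =>
    set T' := S ++ (List.replicate m.val (Edge.horiz i j j') ++ T) with hT'
    have hjj : j < j' := by rw [Fin.lt_def]; omega
    -- After this segment nothing touches `(i, j)`, so its final degree is `m` plus its present
    -- degree; evenness and coverage of the tour subgraph decide the case.
    have hSu : degree S (i, j) = 0 := h1.degree_eq_zero hS (by simpa using hjj)
    have hu : degree T' (i, j) = m.val + degree T (i, j) := by
      rw [hT', degree_append, degree_append, hSu, degree_replicate]
      simp [incidence, Edge.src, Edge.dst, hjj.ne']
    have heven := hT.even (i, j)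
    rw [hu] at heven
    have hcov := hT.covers i j
    rw [hu] at hcov
    have hodd := hd.odd_iff i
    have hz := hd.none_iff i
    rw [hi] at hodd hz
    change ∃ ω', (RTSP.addHoriz (I.mand i j) i m ω).val = some ω'
    rw [addHoriz_val]
    rcases hωi : ω i with _ | ⟨_ | _, c⟩
    · have h0 := hz.1 hωi
      rw [h0] at heven hcov
      fin_cases m
      · by_cases hm : I.mand i j = true
        · exact absurd rfl (hcov hm)
        · exact ⟨ω, by simp [hm]⟩
      · simp at heven
      · exact ⟨_, rfl⟩
    · have h2 : ¬ Odd (degree T (i, j)) := by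
        rw [← hodd, cellOf_of_some hωi]
        simp
      fin_cases m
      · dsimp only
        rw [removeVertex_val]
        by_cases hc : c = i
        · subst hc
          rw [if_pos rfl]
          cases hfind : (List.finRange h).find? fun k =>
              comp (Function.update ω c none) k = some c with
          | some k => exact ⟨_, rfl⟩
          | none =>
            -- The component of the leaving vertex has no other frontier vertex. It will be shown to
            -- be closed under the later segments although it misses the last vertical line.
            exfalso
            rw [List.find?_eq_none] at hfind
            have hno : ∀ k, k ≠ c → ¬ Conn T (c, j) (k, f k) := by
              intro k hk hconn
              rw [← hi, ← hd.name_iff, cellOf_of_some hωi] at hconn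
              refine hfind k (List.mem_finRange k) ?_
              cases hωk : ω k with
              | none =>
                rw [cellOf_of_none hωk] at hconn
                exact absurd hconn.symm hk
              | some pc =>
                rw [cellOf_of_some hωk] at hconn
                simp [comp, Function.update_of_ne hk, hωk, ← hconn]
            have hu0 : degree T (c, j) ≠ 0 := by
              intro h0
              rw [hz.2 h0] at hωi
              cases hωi
            -- All its vertices lie strictly to the left of the moved frontier.
            have hpos : ∀ x : Vertex h v, Conn T (c, j) x → x.2 < Function.update f c j' x.1 := by
              rintro ⟨k, jx⟩ hx
              have hdx : degree T (k, jx) ≠ 0 := by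
                intro h0
                rw [hx.symm.eq_of_degree_eq_zero h0] at h0
                exact hu0 h0
              have hle : jx ≤ f k := by
                by_contra hlt
                exact hdx (hd.future k jx (not_le.1 hlt))
              by_cases hk : k = c
              · subst hk
                simp only [Function.update_self]
                exact (hle.trans hi.le).trans_lt hjj
              · simp only [Function.update_of_ne hk]
                refine lt_of_le_of_ne hle ?_
                rintro rfl
                exact hno k hk hx
            -- Later segments start at or beyond the moved frontier and so cannot leave the
            -- component.
            have hstay : ∀ x, Conn T' (c, j) x → Conn T (c, j) x := by
              intro x hx
              induction hx with
              | refl => exact .refl _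
              | @tail y z _ hyz ih =>
                obtain ⟨e, he, hjn⟩ := hyz
                rw [hT'] at he
                simp only [List.replicate_zero, List.nil_append,
                  List.mem_append] at he
                rcases he with he | he
                · exact absurd (hpos y ih) (not_lt.2 (h1.le_of_joins e (hS he) y z hjn))
                · exact ih.trans (.of_joins he hjn)
            -- The vertex to visit on the last line must belong to the component, yet nothing lies
            -- to the right of that line.
            obtain ⟨r, jl, hjl, hm⟩ := hlast
            have h3 := hpos (r, jl) (hstay _ (hT.conn _ _ (by rw [hu]; simpa using hu0)
              (hT.covers r jl hm)))
            rw [Fin.lt_def] at h3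
            have := (Function.update f c j' r).isLt
            dsimp only at h3
            omega
        · exact ⟨_, by rw [if_neg hc]⟩
      · rw [Nat.even_add] at heven
        simp at heven
        exact absurd heven h2
      · exact ⟨_, rfl⟩
    · have h2 : Odd (degree T (i, j)) := by
        rw [← hodd, cellOf_of_some hωi]
      have h3 := Nat.not_even_iff_odd.2 h2
      rw [Nat.even_add] at heven
      fin_cases m
      · exact absurd (heven.1 (by simp)) h3
      · exact ⟨_, rfl⟩
      · exact absurd (heven.1 (by simp)) h3

/-- At each segment the choice prescribed by `m` is accepted, since the rest of `build` completes
the partial subgraph to a tour subgraph. -/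
theorem Path.exists_of_isTourGraph {I : Grid ℝ h v}
    (hlast : ∃ r j, j.val + 1 = v ∧ I.mand r j = true) (m : Edge h v → Fin 3)
    {f0 f f' : Fin h → Fin v} (hf0 : ∀ i, (f0 i).val = 0) (es : List (Edge h v))
    {ds T : List (Edge h v)} {ω : State h} (hp : Path I ds T ω)
    (hF0 : Front f0 ds f) (hF : Front f es f') (hT : IsTourGraph I (build m es T)) :
    ∃ ω', Path I (ds ++ es) (build m es T) ω' := by
  induction es generalizing ds T ω f with
  | nil => exact ⟨ω, by simpa [build] using hp⟩
  | cons e es ih =>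
    obtain ⟨S, hS, hST⟩ := exists_build_eq_append m es (List.replicate (m e).val e ++ T)
    rw [build_cons] at hT ⊢
    have hd := hp.describes hf0 hF0
    obtain ⟨ω', hω'⟩ := hd.exists_transition hF (m e) hS (hST ▸ hT) hlast
    obtain ⟨g, h1, h2⟩ := (show Front f ([e] ++ es) f' from hF).append_inv
    have := ih (hp.snoc hω') (hF0.append h1) h2 hT
    simpa using this

/-- The dynamic program finds a shortest tour subgraph, among those built by choosing a multiplicity
of each segment. -/
theorem tourSubgraph_spec {I : Grid ℝ h v} (hlast : ∃ r j, j.val + 1 = v ∧ I.mand r j = true) :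
    (∀ r, (tourSubgraph I).val = some r → r.1 = edgeLength I r.2 ∧ IsTourGraph I r.2 ∧
      ∃ ω, Path I (edges h v) r.2 ω) ∧
    ∀ m : Edge h v → Fin 3, IsTourGraph I (build m (edges h v) []) →
      ∃ r, (tourSubgraph I).val = some r ∧ r.1 ≤ edgeLength I (build m (edges h v) []) := by
  have hv : 0 < v := by
    obtain ⟨-, j, hj, -⟩ := hlast
    omega
  have hf0 : ∀ i : Fin h, ((fun _ => ⟨0, hv⟩ : Fin h → Fin v) i).val = 0 := fun _ => rfl
  obtain ⟨f', hF, hf'⟩ := front_edges hv (fun _ : Fin h => ⟨0, hv⟩) hf0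
  have hL := represents_layer I (edges h v).length
  rw [List.take_length] at hL
  obtain ⟨h1, h2⟩ := best_spec hL
  have hval : (tourSubgraph I).val = (best I (layer I (edges h v).length).val).val := rfl
  rw [hval]
  refine ⟨?_, ?_⟩
  · intro r hr
    obtain ⟨h3, ω, h4, h5⟩ := h1 r hr
    exact ⟨h3, ((h5.describes hf0 hF).isFinal_iff hf').1 h4, ω, h5⟩
  · intro m hm
    obtain ⟨ω, hω⟩ := Path.exists_of_isTourGraph hlast m hf0 (edges h v) .nil (.nil _) hF hm
    rw [List.nil_append] at hω
    exact h2 _ ω hω (((hω.describes hf0 hF).isFinal_iff hf').2 hm)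

end Graphs

/-! ### Lengths of walks -/

section Walks
variable {α : Type}

/-- The length of a walk through the entries of a list. -/
def walkLength (g : α → α → ℝ) : List α → ℝ
  | a :: b :: l => g a b + walkLength g (b :: l)
  | _ => 0

@[simp] theorem walkLength_singleton (g : α → α → ℝ) (a : α) : walkLength g [a] = 0 := rfl

@[simp] theorem walkLength_cons_cons (g : α → α → ℝ) (a b : α) (l : List α) :
    walkLength g (a :: b :: l) = g a b + walkLength g (b :: l) := rfl

theorem walkLength_map {β : Type} (g : β → β → ℝ) (p : α → β) (l : List α) :
    walkLength g (l.map p) = walkLength (fun a b => g (p a) (p b)) l := by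
  induction l with
  | nil => rfl
  | cons a l ih =>
    cases l with
    | nil => rfl
    | cons b l => simpa using ih

theorem walkLength_concat (g : α → α → ℝ) (a b c : α) (l : List α) :
    walkLength g (a :: (l ++ [b, c])) = walkLength g (a :: (l ++ [b])) + g b c := by
  induction l generalizing a with
  | nil => simp
  | cons d l ih => simp [ih, add_assoc]

variable {g : α → α → ℝ} (htri : ∀ a b c, g a c ≤ g a b + g b c)
include htri

theorem walkLength_head_le (a x : α) (l : List α) (hl : l ≠ []) :
    walkLength g (a :: l) ≤ g a x + walkLength g (x :: l) := by
  cases l with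
  | nil => exact absurd rfl hl
  | cons b l =>
    have := htri a x b
    simp only [walkLength_cons_cons]
    linarith

theorem walkLength_last_le (a b c : α) (l : List α) :
    walkLength g (a :: (l ++ [b])) ≤ walkLength g (a :: (l ++ [c])) + g c b := by
  induction l generalizing a with
  | nil => simpa using htri a c b
  | cons d l ih =>
    have := ih d
    simp only [List.cons_append, walkLength_cons_cons]
    linarith

/-- Skipping one intermediate stop at a time, by the triangle inequality; fixing both ends ensures
that there is always a next stop. -/
theorem walkLength_sublist {l l' : List α} (hl : l.Sublist l') (a b : α) :
    walkLength g (a :: (l ++ [b])) ≤ walkLength g (a :: (l' ++ [b])) := by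
  induction hl generalizing a with
  | slnil => exact le_rfl
  | @cons l l' x _ ih =>
    refine (walkLength_head_le htri a x (l ++ [b]) (by simp)).trans ?_
    simp only [List.cons_append, walkLength_cons_cons]
    have := ih x
    linarith
  | @cons_cons l l' x _ ih =>
    simp only [List.cons_append, walkLength_cons_cons]
    have := ih x
    linarith

omit htri

/-! ### Rectilinear tours and shortcuts. -/

theorem dist1_comm (p q : ℝ × ℝ) : dist1 p q = dist1 q p := by
  simp [dist1, abs_sub_comm]

theorem dist1_self (p : ℝ × ℝ) : dist1 p p = 0 := by simp [dist1]

theorem dist1_nonneg (p q : ℝ × ℝ) : 0 ≤ dist1 p q := by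
  rw [dist1]
  positivity

theorem dist1_triangle (p q r : ℝ × ℝ) : dist1 p r ≤ dist1 p q + dist1 q r := by
  have h1 := abs_sub_le p.1 q.1 r.1
  have h2 := abs_sub_le p.2 q.2 r.2
  simp only [dist1]
  linarith

theorem tourLength_cons (a : ℝ × ℝ) (l : List (ℝ × ℝ)) :
    tourLength (a :: l) = walkLength dist1 (a :: (l ++ [a])) := by
  have key : ∀ (l : List (ℝ × ℝ)) (a b : ℝ × ℝ),
      (List.zipWith dist1 (a :: l) (l ++ [b])).sum = walkLength dist1 (a :: (l ++ [b])) := by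
    intro l
    induction l with
    | nil => intro a b; simp
    | cons c l ih => intro a b; simpa using ih c b
  simpa [tourLength] using key l a a

theorem tourLength_nonneg (l : List (ℝ × ℝ)) : 0 ≤ tourLength l := by
  rw [tourLength]
  refine List.sum_nonneg fun x hx => ?_
  obtain ⟨i, hi, rfl⟩ := List.getElem_of_mem hx
  rw [List.getElem_zipWith]
  exact dist1_nonneg _ _

theorem tourLength_sublist {l l' : List (ℝ × ℝ)} (hl : l.Sublist l') :
    tourLength l ≤ tourLength l' := by
  cases hl with
  | slnil => exact le_rfl
  | @cons l l' c hl =>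
    cases l with
    | nil => exact tourLength_nonneg _
    | cons d t =>
      rw [tourLength_cons, tourLength_cons]
      -- When the first point `c` is dropped, the tour based at `d` is compared with the closed walk
      -- `c, d, t, c`: returning to `d` directly is no longer than returning through `c`.
      have h1 := walkLength_sublist dist1_triangle hl c c
      have h2 := walkLength_last_le dist1_triangle d d c t
      simp only [List.cons_append, walkLength_cons_cons] at h1
      linarith
  | @cons_cons l l' c hl =>
    rw [tourLength_cons, tourLength_cons]
    exact walkLength_sublist dist1_triangle hl c c

/-- A tour that uses a closed walk with shortcuts. -/
theorem tourLength_le_walkLength {l C : List (ℝ × ℝ)} {s : ℝ × ℝ} (hl : l.Sublist C)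
    (hhead : C.head? = some s) (hlast : C.getLast? = some s) :
    tourLength l ≤ walkLength dist1 C := by
  refine (tourLength_sublist hl).trans ?_
  cases C with
  | nil => simp at hhead
  | cons a L =>
    simp only [List.head?_cons, Option.some.injEq] at hhead
    subst hhead
    rw [tourLength_cons]
    rcases List.eq_nil_or_concat' L with rfl | ⟨m, b, rfl⟩
    · simp [dist1_self]
    · rw [← List.cons_append, List.getLast?_concat] at hlast
      obtain rfl := Option.some.inj hlast
      rw [List.append_assoc]
      change walkLength dist1 (b :: (m ++ [b, b])) ≤ _
      rw [walkLength_concat, dist1_self, add_zero]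

end Walks

/-! ### Eulerian circuits -/

section Euler
variable {h v : ℕ}

/-- The total weight of the directed edges of a multigraph. -/
def Multi.total {R : Type} [CommSemiring R] (g : Vertex h v → Vertex h v → R) (M : Multi h v) : R :=
  ∑ p : Vertex h v × Vertex h v, (M p.1 p.2 : R) * g p.1 p.2

/-- A copy counts once in each direction. Lengths, degrees and the number of edges are all instances
of this weighted total. -/
theorem Multi.total_succ {R : Type} [CommSemiring R] (g : Vertex h v → Vertex h v → R)
    (M : Multi h v) {u w : Vertex h v} (huw : u ≠ w) :
    (M.modify (· + 1) u w).total g = M.total g + (g u w + g w u) := by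
  have hpt : ∀ p : Vertex h v × Vertex h v, ((M.modify (· + 1) u w p.1 p.2 : ℕ) : R) * g p.1 p.2 =
      (M p.1 p.2 : R) * g p.1 p.2 + ((if p = (u, w) then g u w else 0) +
        if p = (w, u) then g w u else 0) := by
    rintro ⟨a, b⟩
    simp only [Multi.modify, Prod.mk.injEq]
    by_cases h1 : a = u ∧ b = w
    · obtain ⟨rfl, rfl⟩ := h1
      simp [huw, add_mul]
    · by_cases h2 : a = w ∧ b = u
      · obtain ⟨rfl, rfl⟩ := h2
        simp [huw.symm, add_mul]
      · simp [h1, h2]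
  rw [Multi.total, Finset.sum_congr rfl fun p _ => hpt p, Finset.sum_add_distrib,
    Finset.sum_add_distrib, Finset.sum_ite_eq', Finset.sum_ite_eq']
  simp [Multi.total]

/-- Removal of an edge is treated as the inverse of an addition, so that `Multi.total_succ` covers
it without subtraction. -/
theorem Multi.modify_pred_succ {M : Multi h v} (hsymm : ∀ a b, M a b = M b a) {u w : Vertex h v}
    (hpos : 0 < M u w) : (M.modify (· - 1) u w).modify (· + 1) u w = M := by
  have hpos' := hsymm u w ▸ hpos
  funext a b
  simp only [Multi.modify]
  split_ifs with h1
  · rcases h1 with ⟨rfl, rfl⟩ | ⟨rfl, rfl⟩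
    · omega
    · omega
  · rfl

theorem Multi.modify_symm {M : Multi h v} (hsymm : ∀ a b, M a b = M b a) (f : ℕ → ℕ)
    (u w a b : Vertex h v) : M.modify f u w a b = M.modify f u w b a := by
  simp only [Multi.modify, hsymm a b]
  have : (a = u ∧ b = w) ∨ (a = w ∧ b = u) ↔ (b = u ∧ a = w) ∨ (b = w ∧ a = u) := by tauto
  simp only [this]

theorem Multi.modify_pred_le (M : Multi h v) (u w a b : Vertex h v) :
    M.modify (· - 1) u w a b ≤ M a b := by
  simp only [Multi.modify]
  split_ifs <;> omega

theorem mem_neighbours_of_joins {e : Edge h v} (he : e.Adjacent) {u w : Vertex h v}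
    (hj : e.Joins u w) : w ∈ neighbours u := by
  obtain ⟨i, j⟩ := u
  cases e with
  | vert k k' l =>
    rcases hj with ⟨h1, rfl⟩ | ⟨rfl, h1⟩ <;> obtain ⟨rfl, rfl⟩ := Prod.mk.inj h1
    · have h2 : k.val + 1 < h := he ▸ k'.isLt
      rw [Edge.Adjacent] at he
      simp [neighbours, h2, Edge.dst, Fin.ext_iff, he]
    · rw [Edge.Adjacent] at he
      simp [neighbours, Edge.src, Fin.ext_iff, he]
  | horiz k l l' =>
    rcases hj with ⟨h1, rfl⟩ | ⟨rfl, h1⟩ <;> obtain ⟨rfl, rfl⟩ := Prod.mk.inj h1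
    · have h2 : l.val + 1 < v := he ▸ l'.isLt
      rw [Edge.Adjacent] at he
      simp [neighbours, h2, Edge.dst, Fin.ext_iff, he]
    · rw [Edge.Adjacent] at he
      simp [neighbours, Edge.src, Fin.ext_iff, he]

theorem ne_of_mem_neighbours {u w : Vertex h v} (hw : w ∈ neighbours u) : u ≠ w := by
  rintro rfl
  simp only [neighbours, List.mem_append] at hw
  rcases hw with ((hw | hw) | hw) | hw <;> split_ifs at hw <;>
    simp [Prod.ext_iff, Fin.ext_iff] at hw <;> omega

theorem Edge.src_ne_dst {e : Edge h v} (he : e.Adjacent) : e.src ≠ e.dst :=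
  ne_of_mem_neighbours (mem_neighbours_of_joins he (Or.inl ⟨rfl, rfl⟩))

theorem multi_val (T : List (Edge h v)) :
    (multi T).val = T.foldl (fun (M : Multi h v) e => M.modify (· + 1) e.src e.dst) fun _ _ => 0 := by
  rw [multi, Counted.val_bind, Counted.val_foldlM]
  rfl

theorem multi_total {R : Type} [CommSemiring R] (g : Vertex h v → Vertex h v → R)
    {T : List (Edge h v)} (hT : ∀ e ∈ T, e.Adjacent) :
    (multi T).val.total g = (T.map fun e => g e.src e.dst + g e.dst e.src).sum := by
  have key : ∀ (T : List (Edge h v)) (M : Multi h v), (∀ e ∈ T, e.Adjacent) →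
      (T.foldl (fun M e => M.modify (· + 1) e.src e.dst) M).total g =
        M.total g + (T.map fun e => g e.src e.dst + g e.dst e.src).sum := by
    intro T
    induction T with
    | nil => simp
    | cons e T ih =>
      intro M hT
      rw [List.foldl_cons, ih _ fun e he => hT e (by simp [he]),
        Multi.total_succ _ _ (Edge.src_ne_dst (hT e (by simp)))]
      simp [add_assoc]
  rw [multi_val, key T _ hT]
  simp [Multi.total]

theorem multi_symm (T : List (Edge h v)) (a b : Vertex h v) :
    (multi T).val a b = (multi T).val b a := by
  have key : ∀ (T : List (Edge h v)) (M : Multi h v), (∀ a b, M a b = M b a) → ∀ a b,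
      (T.foldl (fun M e => M.modify (· + 1) e.src e.dst) M) a b =
      (T.foldl (fun M e => M.modify (· + 1) e.src e.dst) M) b a := by
    intro T
    induction T with
    | nil => exact fun M hM => hM
    | cons e T ih => exact fun M hM => ih _ (Multi.modify_symm hM _ _ _)
  rw [multi_val]
  exact key T _ (fun _ _ => rfl) a b

theorem multi_pos_iff (T : List (Edge h v)) (a b : Vertex h v) :
    0 < (multi T).val a b ↔ ∃ e ∈ T, e.Joins a b := by
  have key : ∀ (T : List (Edge h v)) (M : Multi h v),
      0 < (T.foldl (fun M e => M.modify (· + 1) e.src e.dst) M) a b ↔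
        0 < M a b ∨ ∃ e ∈ T, e.Joins a b := by
    intro T
    induction T with
    | nil => simp
    | cons e T ih =>
      intro M
      rw [List.foldl_cons, ih]
      have : 0 < M.modify (· + 1) e.src e.dst a b ↔ 0 < M a b ∨ e.Joins a b := by
        simp only [Multi.modify, Edge.Joins]
        by_cases h1 : (a = e.src ∧ b = e.dst) ∨ (a = e.dst ∧ b = e.src)
        · rw [if_pos h1]
          refine iff_of_true (Nat.succ_pos _) (Or.inr ?_)
          rcases h1 with ⟨rfl, rfl⟩ | ⟨rfl, rfl⟩ <;> simp
        · rw [if_neg h1]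
          have : ¬ ((e.src = a ∧ e.dst = b) ∨ (e.src = b ∧ e.dst = a)) := by
            rintro (⟨rfl, rfl⟩ | ⟨rfl, rfl⟩) <;> simp at h1
          tauto
      rw [this]
      simp [or_assoc]
  rw [multi_val, key]
  simp

/-- The weights whose total is the degree of `a`. -/
def degreeWeight (a x _y : Vertex h v) : ℕ := if x = a then 1 else 0

theorem multi_degree {T : List (Edge h v)} (hT : ∀ e ∈ T, e.Adjacent) (a : Vertex h v) :
    (multi T).val.total (degreeWeight a) = degree T a := multi_total _ hT

theorem Multi.degree_eq_zero {M : Multi h v} {u : Vertex h v} (hu : ∀ w, M u w = 0) :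
    M.total (degreeWeight u) = 0 := by
  rw [Multi.total]
  refine Finset.sum_eq_zero ?_
  rintro ⟨a, b⟩ -
  simp only [degreeWeight]
  split_ifs with h1
  · simp [h1, hu]
  · simp

/-- The vertex `z` is where the current excursion must return: `z :: circuit` is a walk ending at
`s`, and in the unused multigraph the only possible odd vertices are `z` and the top `u` of the
stack, when they differ. The unused edges, the stack and `z :: circuit` together weigh at most
`len`; the factors two come from counting unused edges in both directions. Vertices in the circuit
have no unused edges, so at the end the circuit is closed under adjacency in `M0`. For the fuel, a
push removes two from the directed total and adds one to the stack, and a pop removes one. -/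
theorem euler_spec {g : Vertex h v → Vertex h v → ℝ} (hg : ∀ a b, g a b = g b a)
    (hg0 : ∀ a b, 0 ≤ g a b) {M0 : Multi h v} {s : Vertex h v} {len : ℝ} (k : ℕ) :
    ∀ (u : Vertex h v) (st : List (Vertex h v)) (M : Multi h v) (circuit : List (Vertex h v))
      (z : Vertex h v), (∀ a b, M a b = M b a) → (∀ a b, 0 < M a b → b ∈ neighbours a) →
      (∀ a, Even (M.total (degreeWeight a) + ((if u = a then 1 else 0) + if z = a then 1 else 0))) →
      (z :: circuit).getLast? = some s → (u :: st).getLast? = some s →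
      M.total g + 2 * walkLength g (u :: st) + 2 * walkLength g (z :: circuit) ≤ 2 * len →
      (∀ a ∈ circuit, ∀ b, M a b = 0) →
      (∀ a b, 0 < M0 a b → 0 < M a b ∨ b ∈ u :: st ∨ b ∈ circuit) →
      M.total (fun _ _ => 1) + (u :: st).length ≤ k →
      (euler k (u :: st) M circuit).val.head? = some s ∧
      (euler k (u :: st) M circuit).val.getLast? = some s ∧
      walkLength g (euler k (u :: st) M circuit).val ≤ len ∧
      ∀ a ∈ (euler k (u :: st) M circuit).val, ∀ b, 0 < M0 a b →
        b ∈ (euler k (u :: st) M circuit).val := by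
  induction k with
  | zero =>
    intro u st M circuit z _ _ _ _ _ _ _ _ hk
    simp at hk
  | succ k ih =>
    intro u st M circuit z hsymm hnb hpar hz hst hlen hdone hcov hk
    rw [euler]
    simp only [Counted.val_bind]
    cases hf : (neighbours u).find? fun w => 0 < M u w with
    | some w =>
      simp only [Counted.val_bind]
      have hw : 0 < M u w := by simpa using List.find?_some hf
      have huw : u ≠ w := ne_of_mem_neighbours (List.mem_of_find?_eq_some hf)
      have hM := Multi.modify_pred_succ hsymm hw
      set M' := M.modify (· - 1) u w with hM'
      have hle : ∀ a b, M' a b ≤ M a b := M.modify_pred_le u w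
      have htot : ∀ {R : Type} [CommSemiring R] (g : Vertex h v → Vertex h v → R),
          M.total g = M'.total g + (g u w + g w u) := by
        intro R _ g
        rw [← Multi.total_succ g M' huw, hM]
      refine ih w (u :: st) M' circuit z (Multi.modify_symm hsymm _ _ _) ?_ ?_ hz ?_ ?_ ?_ ?_ ?_
      · exact fun a b hab => hnb a b (hab.trans_le (hle a b))
      · intro a
        have := hpar a
        rw [htot, degreeWeight, degreeWeight] at this
        have h2 : M'.total (degreeWeight a) + ((if u = a then 1 else 0) + (if w = a then 1 else 0)) +
            ((if u = a then 1 else 0) + (if z = a then 1 else 0)) =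
            (M'.total (degreeWeight a) + ((if w = a then 1 else 0) + (if z = a then 1 else 0))) +
            2 * (if u = a then 1 else 0) := by ring
        rw [h2, Nat.even_add] at this
        exact this.2 (even_two_mul _)
      · rw [List.getLast?_cons_cons]
        exact hst
      · rw [htot, hg w u] at hlen
        rw [walkLength_cons_cons, hg w u]
        linarith
      · exact fun a ha b => Nat.le_zero.1 ((hle a b).trans (hdone a ha b).le)
      · intro a b hab
        rcases hcov a b hab with h1 | h1 | h1
        · by_cases h2 : (a = u ∧ b = w) ∨ (a = w ∧ b = u)
          · rcases h2 with ⟨rfl, rfl⟩ | ⟨rfl, rfl⟩ <;> simp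
          · left
            simpa only [hM', Multi.modify, if_neg h2] using h1
        · exact Or.inr (Or.inl (List.mem_cons_of_mem _ h1))
        · exact Or.inr (Or.inr h1)
      · rw [htot] at hk
        simp only [List.length_cons] at hk ⊢
        omega
    | none =>
      simp only [Counted.val_bind]
      have hu : ∀ w, M u w = 0 := by
        intro w
        by_contra h0
        have hpos := Nat.pos_of_ne_zero h0
        rw [List.find?_eq_none] at hf
        exact hf w (hnb u w hpos) (by simpa using hpos)
      -- At `u` no unused edge is left, so by parity the walk can be stuck only where it had to
      -- return.
      have hzu : z = u := by
        by_contra hne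
        have := hpar u
        rw [Multi.degree_eq_zero hu] at this
        simp [hne] at this
      subst hzu
      have hdone' : ∀ a ∈ z :: circuit, ∀ b, M a b = 0 := by
        intro a ha
        rcases List.mem_cons.1 ha with rfl | ha
        · exact hu
        · exact hdone a ha
      cases st with
      | nil =>
        have hres : (euler k [] M (z :: circuit)).val = z :: circuit := by
          cases k <;> simp [euler]
        rw [hres]
        have hzs : z = s := by simpa using hst
        refine ⟨by simp [hzs], hz, ?_, ?_⟩
        · have : 0 ≤ M.total g := Finset.sum_nonneg fun p _ =>
            mul_nonneg (Nat.cast_nonneg _) (hg0 _ _)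
          simp only [walkLength_singleton] at hlen
          linarith
        · intro a ha b hab
          rcases hcov a b hab with h1 | h1 | h1
          · rw [hdone' a ha b] at h1
            omega
          · simp at h1
            simp [h1]
          · exact List.mem_cons_of_mem _ h1
      | cons t st =>
        -- The new top `t` is also the new point of return: the step from `t` to `z` passes from the
        -- stack to the circuit.
        refine ih t st M (z :: circuit) t hsymm hnb ?_ ?_ ?_ ?_ hdone' ?_ ?_
        · intro a
          have := hpar a
          rw [← two_mul, Nat.even_add] at this ⊢
          exact iff_of_true (this.2 (even_two_mul _)) (even_two_mul _)
        · rw [List.getLast?_cons_cons]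
          exact hz
        · rw [List.getLast?_cons_cons] at hst
          exact hst
        · rw [walkLength_cons_cons] at hlen
          rw [walkLength_cons_cons g t z, hg t z]
          linarith
        · intro a b hab
          rcases hcov a b hab with h1 | h1 | h1
          · exact Or.inl h1
          · rcases List.mem_cons.1 h1 with rfl | h1
            · simp
            · exact Or.inr (Or.inl h1)
          · exact Or.inr (Or.inr (List.mem_cons_of_mem _ h1))
        · simp only [List.length_cons] at hk ⊢
          omega

/-- The point of the plane at a vertex of the grid. -/
def Grid.point (I : Grid ℝ h v) (u : Vertex h v) : ℝ × ℝ := (I.x u.2, I.y u.1)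

theorem Edge.length_eq_dist1 {I : Grid ℝ h v} (hx : Monotone I.x) (hy : Monotone I.y)
    {e : Edge h v} (he : e.Adjacent) : e.length I = dist1 (I.point e.src) (I.point e.dst) := by
  cases e with
  | vert i i' j =>
    have : I.y i ≤ I.y i' := hy (by rw [Fin.le_def, he]; omega)
    simp [Edge.length, dist1, Grid.point, Edge.src, Edge.dst, abs_sub_comm (I.y i),
      abs_of_nonneg (sub_nonneg.2 this)]
  | horiz i j j' =>
    have : I.x j ≤ I.x j' := hx (by rw [Fin.le_def, he]; omega)
    simp [Edge.length, dist1, Grid.point, Edge.src, Edge.dst, abs_sub_comm (I.x j),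
      abs_of_nonneg (sub_nonneg.2 this)]

/-- The search finds a closed walk that is not longer than the tour subgraph and passes through all
vertices of positive degree. -/
theorem euler_isTourGraph {I : Grid ℝ h v} (hx : Monotone I.x) (hy : Monotone I.y) {e : Edge h v}
    {T : List (Edge h v)} (hadj : ∀ e' ∈ e :: T, e'.Adjacent) (hT : IsTourGraph I (e :: T))
    {k : ℕ} (hk : 2 * (e :: T).length + 1 ≤ k) :
    (euler k [e.src] (multi (e :: T)).val []).val.head? = some e.src ∧
    (euler k [e.src] (multi (e :: T)).val []).val.getLast? = some e.src ∧
    walkLength (fun a b => dist1 (I.point a) (I.point b))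
      (euler k [e.src] (multi (e :: T)).val []).val ≤ edgeLength I (e :: T) ∧
    ∀ u, degree (e :: T) u ≠ 0 → u ∈ (euler k [e.src] (multi (e :: T)).val []).val := by
  have hmain := euler_spec (g := fun a b => dist1 (I.point a) (I.point b))
    (M0 := (multi (e :: T)).val) (s := e.src) (len := edgeLength I (e :: T))
    (fun a b => dist1_comm _ _) (fun a b => dist1_nonneg _ _) k e.src [] (multi (e :: T)).val []
    e.src (multi_symm _) ?_ ?_ rfl rfl ?_ (by simp) (fun a b hab => Or.inl hab) ?_
  · obtain ⟨h1, h2, h3, h4⟩ := hmain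
    refine ⟨h1, h2, h3, fun u hu => ?_⟩
    have hs : e.src ∈ (euler k [e.src] (multi (e :: T)).val []).val := List.mem_of_mem_head? h1
    have hsdeg : degree (e :: T) e.src ≠ 0 :=
      degree_ne_zero_of_joins (by simp) (Or.inl ⟨rfl, rfl⟩ : e.Joins e.src e.dst)
    -- Closure of the circuit under adjacency is propagated along the connection from `e.src` to
    -- `u`.
    have hconn := hT.conn e.src u hsdeg hu
    induction hconn with
    | refl => exact hs
    | tail _ hyz ih =>
      obtain ⟨e', he', hj⟩ := hyz
      refine h4 _ (ih (degree_ne_zero_of_joins he' hj)) _ ?_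
      exact (multi_pos_iff _ _ _).2 ⟨e', he', hj⟩
  · intro a b hab
    obtain ⟨e', he', hj⟩ := (multi_pos_iff _ _ _).1 hab
    exact mem_neighbours_of_joins (hadj e' he') hj
  · intro a
    rw [multi_degree hadj, ← two_mul, Nat.even_add]
    exact iff_of_true (hT.even a) (even_two_mul _)
  · rw [multi_total _ hadj]
    simp only [walkLength_singleton, mul_zero, add_zero]
    rw [edgeLength, ← List.sum_map_mul_left]
    refine le_of_eq (congrArg List.sum (List.map_congr_left fun e' he' => ?_))
    rw [Edge.length_eq_dist1 hx hy (hadj e' he'), dist1_comm (I.point e'.dst), two_mul]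
  -- The fuel counts every edge in both directions, plus one for the initial stack.
  · rw [multi_total _ hadj]
    simp only [List.map_const', List.sum_replicate, List.length_singleton]
    simpa [mul_comm] using hk

theorem shortcut_spec (I : Grid ℝ h v) (hI : Function.Injective I.point)
    (l : List (Vertex h v)) (seen : Vertex h v → Bool) :
    (shortcut I seen l).val.Sublist (l.map I.point) ∧ (shortcut I seen l).val.Nodup ∧
    ∀ p, p ∈ (shortcut I seen l).val ↔
      ∃ u ∈ l, I.mand u.1 u.2 = true ∧ seen u = false ∧ I.point u = p := by
  induction l generalizing seen with
  | nil => simp [shortcut]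
  | cons u l ih =>
    rw [shortcut]
    simp only [Counted.val_bind]
    split_ifs with h1
    · obtain ⟨h2, h3, h4⟩ := ih (Function.update seen u true)
      simp only [Counted.val_bind, Counted.val_pure, List.map_cons]
      change ((I.point u) :: (shortcut I (Function.update seen u true) l).val).Sublist _ ∧
        ((I.point u) :: (shortcut I (Function.update seen u true) l).val).Nodup ∧ ∀ p,
        (p ∈ (I.point u) :: (shortcut I (Function.update seen u true) l).val ↔ _)
      refine ⟨h2.cons_cons _, List.nodup_cons.2 ⟨?_, h3⟩, ?_⟩
      · rw [h4]
        rintro ⟨w, -, -, h5, h6⟩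
        rw [hI h6] at h5
        simp at h5
      · intro p
        rw [List.mem_cons, h4]
        constructor
        · rintro (rfl | ⟨w, h5, h6, h7, h8⟩)
          · exact ⟨u, by simp, h1.1, h1.2, rfl⟩
          · have hwu : w ≠ u := by
              rintro rfl
              simp at h7
            rw [Function.update_of_ne hwu] at h7
            exact ⟨w, by simp [h5], h6, h7, h8⟩
        · rintro ⟨w, h5, h6, h7, h8⟩
          by_cases hwu : w = u
          · left
            rw [← h8, hwu]
          · right
            refine ⟨w, ?_, h6, ?_, h8⟩
            · simpa [hwu] using h5
            · rwa [Function.update_of_ne hwu]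
    · obtain ⟨h2, h3, h4⟩ := ih seen
      refine ⟨h2.cons _, h3, fun p => ?_⟩
      rw [h4]
      constructor
      · rintro ⟨w, h5, h6⟩
        exact ⟨w, by simp [h5], h6⟩
      · rintro ⟨w, h5, h6, h7, h8⟩
        refine ⟨w, ?_, h6, h7, h8⟩
        rcases List.mem_cons.1 h5 with rfl | h5
        · exact absurd ⟨h6, h7⟩ h1
        · exact h5

end Euler

/-! ### From a tour to a tour subgraph -/

section FromTours
variable {h v : ℕ}

/-- A walk along segments of the grid, with the list of the segments. -/
inductive EdgeWalk : List (Edge h v) → Vertex h v → Vertex h v → Prop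
  | nil (u : Vertex h v) : EdgeWalk [] u u
  | cons {e : Edge h v} {S : List (Edge h v)} {u w z : Vertex h v} :
    e.Adjacent → e.Joins u w → EdgeWalk S w z → EdgeWalk (e :: S) u z

namespace EdgeWalk
variable {S S' : List (Edge h v)} {u w z : Vertex h v}

theorem append (h1 : EdgeWalk S u w) (h2 : EdgeWalk S' w z) : EdgeWalk (S ++ S') u z := by
  induction h1 with
  | nil => exact h2
  | cons a b _ ih => exact .cons a b (ih h2)

theorem reverse (h1 : EdgeWalk S u w) : EdgeWalk S.reverse w u := by
  induction h1 with
  | nil => exact .nil _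
  | cons a b _ ih =>
    rw [List.reverse_cons]
    exact ih.append (.cons a b.symm (.nil _))

theorem adjacent (h1 : EdgeWalk S u w) : ∀ e ∈ S, e.Adjacent := by
  induction h1 with
  | nil => simp
  | cons a _ _ ih => simpa [a] using ih

/-- Each passage through a vertex uses two ends of segments, so only the two ends of the walk can be
odd. -/
theorem even (h1 : EdgeWalk S u w) (a : Vertex h v) :
    Even (degree S a + ((if u = a then 1 else 0) + if w = a then 1 else 0)) := by
  induction h1 with
  | nil u =>
    rw [degree_nil, zero_add, ← two_mul]
    exact even_two_mul _
  | @cons e S u w z _ hj _ ih =>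
    have hinc : incidence e a = (if u = a then 1 else 0) + if w = a then 1 else 0 := by
      rcases hj with ⟨rfl, rfl⟩ | ⟨rfl, rfl⟩
      · rfl
      · rw [incidence, add_comm]
    have : degree (e :: S) a + ((if u = a then 1 else 0) + (if z = a then 1 else 0)) =
        (degree S a + ((if w = a then 1 else 0) + (if z = a then 1 else 0))) +
        2 * (if u = a then 1 else 0) := by
      rw [degree_cons, hinc]
      ring
    rw [this]
    exact ih.add (even_two_mul _)

theorem conn (h1 : EdgeWalk S u w) (a : Vertex h v) (ha : degree S a ≠ 0) : Conn S u a := by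
  induction h1 with
  | nil => simp at ha
  | @cons e S u w z _ hj _ ih =>
    have huw : Conn (e :: S) u w := .of_joins (by simp) hj
    by_cases hS : degree S a = 0
    · rw [degree_cons, hS, add_zero, incidence] at ha
      have : e.src = a ∨ e.dst = a := by
        by_contra hcon
        push Not at hcon
        simp [hcon] at ha
      rcases hj with ⟨rfl, rfl⟩ | ⟨rfl, rfl⟩ <;> rcases this with rfl | rfl
      · exact .refl _
      · exact huw
      · exact huw
      · exact .refl _
    · exact huw.trans ((ih hS).mono (List.subset_cons_self _ _))

theorem conn_end (h1 : EdgeWalk S u w) : Conn S u w := by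
  induction h1 with
  | nil => exact .refl _
  | cons a hj _ ih =>
    exact (Conn.of_joins (by simp) hj).trans (ih.mono (List.subset_cons_self _ _))

end EdgeWalk

theorem exists_edgeWalk_vert (I : Grid ℝ h v) (j : Fin v) (n : ℕ) (i i' : Fin h)
    (hi : i'.val = i.val + n) :
    ∃ S, EdgeWalk S (i, j) (i', j) ∧ edgeLength I S = I.y i' - I.y i := by
  induction n generalizing i with
  | zero =>
    obtain rfl : i' = i := Fin.ext hi
    exact ⟨[], .nil _, by simp⟩
  | succ n ih =>
    have hlt : i.val + 1 < h := by omega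
    obtain ⟨S, h1, h2⟩ := ih ⟨i.val + 1, hlt⟩ (by simp; omega)
    refine ⟨.vert i ⟨i.val + 1, hlt⟩ j :: S, .cons rfl (Or.inl ⟨rfl, rfl⟩) h1, ?_⟩
    rw [edgeLength_cons, h2, Edge.length]
    ring

theorem exists_edgeWalk_horiz (I : Grid ℝ h v) (i : Fin h) (n : ℕ) (j j' : Fin v)
    (hj : j'.val = j.val + n) :
    ∃ S, EdgeWalk S (i, j) (i, j') ∧ edgeLength I S = I.x j' - I.x j := by
  induction n generalizing j with
  | zero =>
    obtain rfl : j' = j := Fin.ext hj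
    exact ⟨[], .nil _, by simp⟩
  | succ n ih =>
    have hlt : j.val + 1 < v := by omega
    obtain ⟨S, h1, h2⟩ := ih ⟨j.val + 1, hlt⟩ (by simp; omega)
    refine ⟨.horiz i j ⟨j.val + 1, hlt⟩ :: S, .cons rfl (Or.inl ⟨rfl, rfl⟩) h1, ?_⟩
    rw [edgeLength_cons, h2, Edge.length]
    ring

theorem edgeLength_reverse (I : Grid ℝ h v) (S : List (Edge h v)) :
    edgeLength I S.reverse = edgeLength I S := by
  rw [edgeLength, edgeLength, List.map_reverse, List.sum_reverse]

/-- An L-shaped path, vertical and then horizontal, realises the ℓ1 distance inside the grid. -/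
theorem exists_edgeWalk {I : Grid ℝ h v} (hx : Monotone I.x) (hy : Monotone I.y)
    (u w : Vertex h v) :
    ∃ S, EdgeWalk S u w ∧ edgeLength I S = dist1 (I.point u) (I.point w) := by
  obtain ⟨i, j⟩ := u
  obtain ⟨i', j'⟩ := w
  have h1 : ∃ S, EdgeWalk S (i, j) (i', j) ∧ edgeLength I S = |I.y i - I.y i'| := by
    rcases le_total i i' with hle | hle
    · obtain ⟨S, h2, h3⟩ := exists_edgeWalk_vert I j (i'.val - i.val) i i'
        (by rw [Fin.le_def] at hle; omega)
      exact ⟨S, h2, by rw [h3, abs_sub_comm, abs_of_nonneg (sub_nonneg.2 (hy hle))]⟩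
    · obtain ⟨S, h2, h3⟩ := exists_edgeWalk_vert I j (i.val - i'.val) i' i
        (by rw [Fin.le_def] at hle; omega)
      exact ⟨_, h2.reverse, by
        rw [edgeLength_reverse, h3, abs_of_nonneg (sub_nonneg.2 (hy hle))]⟩
  have h2 : ∃ S, EdgeWalk S (i', j) (i', j') ∧ edgeLength I S = |I.x j - I.x j'| := by
    rcases le_total j j' with hle | hle
    · obtain ⟨S, h2, h3⟩ := exists_edgeWalk_horiz I i' (j'.val - j.val) j j'
        (by rw [Fin.le_def] at hle; omega)
      exact ⟨S, h2, by rw [h3, abs_sub_comm, abs_of_nonneg (sub_nonneg.2 (hx hle))]⟩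
    · obtain ⟨S, h2, h3⟩ := exists_edgeWalk_horiz I i' (j.val - j'.val) j' j
        (by rw [Fin.le_def] at hle; omega)
      exact ⟨_, h2.reverse, by
        rw [edgeLength_reverse, h3, abs_of_nonneg (sub_nonneg.2 (hx hle))]⟩
  obtain ⟨S, h3, h4⟩ := h1
  obtain ⟨S', h5, h6⟩ := h2
  refine ⟨S ++ S', h3.append h5, ?_⟩
  rw [edgeLength_append, h4, h6, add_comm]
  rfl

theorem exists_edgeWalk_through {I : Grid ℝ h v} (hx : Monotone I.x) (hy : Monotone I.y)
    (us : List (Vertex h v)) (u w : Vertex h v) :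
    ∃ S, EdgeWalk S u w ∧
      edgeLength I S = walkLength (fun a b => dist1 (I.point a) (I.point b)) (u :: (us ++ [w])) ∧
      ∀ a ∈ us, Conn S u a := by
  induction us generalizing u with
  | nil =>
    obtain ⟨S, h1, h2⟩ := exists_edgeWalk hx hy u w
    exact ⟨S, h1, by simpa using h2, by simp⟩
  | cons t us ih =>
    obtain ⟨S, h1, h2⟩ := exists_edgeWalk hx hy u t
    obtain ⟨S', h3, h4, h5⟩ := ih t
    have h6 : Conn (S ++ S') u t := h1.conn_end.mono (List.subset_append_left _ _)
    refine ⟨S ++ S', h1.append h3, ?_, ?_⟩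
    · rw [edgeLength_append, h2, h4]
      rfl
    · intro a ha
      rcases List.mem_cons.1 ha with rfl | ha
      · exact h6
      · exact h6.trans ((h5 a ha).mono (List.subset_append_right _ _))

theorem nodup_edges : (edges h v).Nodup := by
  rw [edges, List.nodup_flatMap]
  refine ⟨fun j _ => ?_, ?_⟩
  · refine List.nodup_append.2 ⟨?_, ?_, ?_⟩
    · refine List.Nodup.filterMap ?_ (List.nodup_finRange h)
      intro a a' b hb hb'
      simp only [Option.mem_def] at hb hb'
      split_ifs at hb hb'
      rw [← Option.some.inj hb'] at hb
      exact (Edge.vert.inj (Option.some.inj hb)).1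
    · rw [horizEdges]
      split_ifs
      · exact (List.nodup_finRange h).map fun a a' haa => (Edge.horiz.inj haa).1
      · exact List.nodup_nil
    · intro a ha b hb hab
      obtain ⟨i, i', -, rfl⟩ := mem_vertEdges.1 ha
      obtain ⟨k, j', -, rfl⟩ := mem_horizEdges.1 hb
      cases hab
  · refine (List.nodup_finRange v).imp ?_
    intro j j' hjj
    refine List.disjoint_left.2 fun e he he' => hjj ?_
    rw [List.mem_append, mem_vertEdges, mem_horizEdges] at he he'
    rcases he with ⟨i, i', -, rfl⟩ | ⟨i, j0, -, rfl⟩ <;>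
      rcases he' with ⟨k, k', -, h1⟩ | ⟨k, j1, -, h1⟩
    · exact (Edge.vert.inj h1).2.2
    · cases h1
    · cases h1
    · exact (Edge.horiz.inj h1).2.1

theorem sum_map_build {R : Type} [AddCommMonoid R] (f : Edge h v → R) (m : Edge h v → Fin 3)
    (es T : List (Edge h v)) : ((build m es T).map f).sum =
      (es.map fun e => (m e).val • f e).sum + (T.map f).sum := by
  induction es generalizing T with
  | nil => simp [build]
  | cons e es ih =>
    rw [build_cons, ih]
    simp only [List.map_append, List.sum_append, List.map_replicate, List.sum_replicate,
      List.map_cons, List.sum_cons]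
    rw [← add_assoc, add_comm (List.sum _) ((m e).val • f e)]

theorem mem_build (m : Edge h v → Fin 3) (es T : List (Edge h v)) (e : Edge h v) :
    e ∈ build m es T ↔ (e ∈ es ∧ m e ≠ 0) ∨ e ∈ T := by
  induction es generalizing T with
  | nil => simp [build]
  | cons e' es ih =>
    rw [build_cons, ih, List.mem_append, List.mem_replicate, List.mem_cons]
    have : (m e').val ≠ 0 ↔ m e' ≠ 0 := by rw [ne_eq, ne_eq, Fin.ext_iff]; rfl
    rw [this]
    constructor
    · rintro (h1 | ⟨h1, rfl⟩ | h1)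
      · exact Or.inl ⟨Or.inr h1.1, h1.2⟩
      · exact Or.inl ⟨Or.inl rfl, h1⟩
      · exact Or.inr h1
    · rintro (⟨rfl | h1, h2⟩ | h1)
      · exact Or.inr (Or.inl ⟨h2, rfl⟩)
      · exact Or.inl ⟨h1, h2⟩
      · exact Or.inr (Or.inr h1)

/-- Pairs of copies of a segment can be removed until at most two copies are left. -/
theorem exists_reduced {I : Grid ℝ h v} (hx : Monotone I.x) (hy : Monotone I.y)
    {S : List (Edge h v)} (hadj : ∀ e ∈ S, e.Adjacent) (hS : IsTourGraph I S) :
    ∃ m : Edge h v → Fin 3, IsTourGraph I (build m (edges h v) []) ∧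
      edgeLength I (build m (edges h v) []) ≤ edgeLength I S := by
  classical
  -- An odd number of copies is reduced to one and a positive even number to two: parity and support
  -- are kept.
  have hred : ∀ c : ℕ, ∃ (k : Fin 3) (d : ℕ), c = k.val + 2 * d ∧ (k = 0 ↔ c = 0) := by
    intro c
    rcases Nat.eq_zero_or_pos c with rfl | hc
    · exact ⟨0, 0, rfl, by simp⟩
    · rcases Nat.even_or_odd' c with ⟨d, rfl | rfl⟩
      · exact ⟨2, d - 1, by simp; omega, by simp; omega⟩
      · exact ⟨1, d, by simp; omega, by simp⟩
  choose red half hred1 hred2 using hred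
  set m : Edge h v → Fin 3 := fun e => red (S.count e) with hm
  set T := build m (edges h v) [] with hT
  have hsub : ∀ e ∈ S, e ∈ edges h v := fun e he => mem_edges.2 (hadj e he)
  have hmem : ∀ e, e ∈ T ↔ e ∈ S := by
    intro e
    rw [hT, mem_build]
    simp only [List.not_mem_nil, or_false, hm, ne_eq, hred2, List.count_eq_zero, not_not]
    exact ⟨fun hh => hh.2, fun hh => ⟨hsub e hh, hh⟩⟩
  -- Every additive quantity drops by twice a sum. For degrees this preserves parity; for lengths,
  -- which are nonnegative, it gives the inequality.
  have hsum : ∀ {R : Type} [AddCommMonoid R] (f : Edge h v → R), (S.map f).sum = (T.map f).sum +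
      2 • ∑ e ∈ (edges h v).toFinset, half (S.count e) • f e := by
    intro R _ f
    have h1 : (S.map f).sum = ∑ e ∈ (edges h v).toFinset, S.count e • f e := by
      rw [Finset.sum_list_map_count]
      refine Finset.sum_subset ?_ ?_
      · intro e he
        exact List.mem_toFinset.2 (hsub e (List.mem_toFinset.1 he))
      · intro e _ he
        rw [List.mem_toFinset] at he
        rw [List.count_eq_zero.2 he, zero_smul]
    have h2 : (T.map f).sum = ∑ e ∈ (edges h v).toFinset, (m e).val • f e := by
      rw [hT, sum_map_build, List.sum_toFinset _ nodup_edges]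
      simp
    rw [h1, h2, Finset.smul_sum, ← Finset.sum_add_distrib]
    refine Finset.sum_congr rfl fun e _ => ?_
    rw [smul_smul, ← add_smul, ← hred1]
  have hdeg : ∀ u, degree T u ≠ 0 ↔ degree S u ≠ 0 := by
    intro u
    constructor
    · intro hu
      obtain ⟨e, he, w, hj⟩ := exists_joins_of_degree_ne_zero hu
      exact degree_ne_zero_of_joins ((hmem e).1 he) hj
    · intro hu
      obtain ⟨e, he, w, hj⟩ := exists_joins_of_degree_ne_zero hu
      exact degree_ne_zero_of_joins ((hmem e).2 he) hj
  refine ⟨m, ⟨?_, ?_, ?_⟩, ?_⟩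
  · intro u
    have := hS.even u
    rw [degree, hsum, Nat.even_add] at this
    refine this.2 ?_
    rw [smul_eq_mul]
    exact even_two_mul _
  · intro i j hij
    exact (hdeg _).2 (hS.covers i j hij)
  · intro u w hu hw
    exact (hS.conn u w ((hdeg u).1 hu) ((hdeg w).1 hw)).mono fun e he => (hmem e).2 he
  · rw [edgeLength, edgeLength, hsum]
    refine le_add_of_nonneg_right (nsmul_nonneg (Finset.sum_nonneg fun e he => ?_) 2)
    refine nsmul_nonneg ?_ _
    rw [Edge.length_eq_dist1 hx hy (mem_edges.1 (List.mem_toFinset.1 he))]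
    exact dist1_nonneg _ _

/-- The grid walks along a tour form one closed walk, hence an even connected multigraph. Two
different vertices are required because a tour of a single vertex has no segment and leaves it with
degree zero. -/
theorem exists_build_of_tour {I : Grid ℝ h v} (hx : Monotone I.x) (hy : Monotone I.y)
    (us : List (Vertex h v)) (hus : ∀ u, I.mand u.1 u.2 = true → u ∈ us)
    (htwo : ∃ u w, u ∈ us ∧ w ∈ us ∧ u ≠ w) :
    ∃ m : Edge h v → Fin 3, IsTourGraph I (build m (edges h v) []) ∧
      edgeLength I (build m (edges h v) []) ≤ tourLength (us.map I.point) := by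
  cases us with
  | nil => simp at htwo
  | cons u us =>
    obtain ⟨S, h1, h2, h3⟩ := exists_edgeWalk_through hx hy us u u
    have hlen : tourLength ((u :: us).map I.point) = edgeLength I S := by
      rw [List.map_cons, tourLength_cons, h2, ← walkLength_map dist1 I.point]
      simp
    rw [hlen]
    refine exists_reduced hx hy h1.adjacent ⟨?_, ?_, ?_⟩
    · intro a
      have := h1.even a
      rw [← two_mul, Nat.even_add] at this
      exact this.2 (even_two_mul _)
    · intro i j hij
      have hne : ∀ a ∈ us, a ≠ u → degree S a ≠ 0 ∧ degree S u ≠ 0 := by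
        intro a ha hau
        exact ⟨fun h0 => hau ((h3 a ha).symm.eq_of_degree_eq_zero h0),
          fun h0 => hau ((h3 a ha).eq_of_degree_eq_zero h0).symm⟩
      by_cases hiu : (i, j) = u
      · rw [hiu]
        obtain ⟨a, b, ha, hb, hab⟩ := htwo
        by_cases hau : a = u
        · subst hau
          have : b ∈ us := by simpa [Ne.symm hab] using hb
          exact (hne b this (Ne.symm hab)).2
        · have : a ∈ us := by simpa [hau] using ha
          exact (hne a this hau).2
      · have := hus (i, j) hij
        rw [List.mem_cons] at this
        exact (hne _ (this.resolve_left hiu) hiu).1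
    · intro a b ha hb
      exact (h1.conn a ha).symm.trans (h1.conn b hb)

theorem Path.adjacent {I : Grid ℝ h v} {es T : List (Edge h v)} {ω : State h} (hp : Path I es T ω)
    (hes : ∀ e ∈ es, e.Adjacent) : ∀ e ∈ T, e.Adjacent := by
  induction hp with
  | nil => simp
  | @snoc es T e m ω ω' h1 h2 ih =>
    intro e' he'
    rcases List.mem_append.1 he' with he' | he'
    · rw [List.eq_of_mem_replicate he']
      exact hes e (by simp)
    · exact ih (fun e he => hes e (by simp [he])) e' he'

theorem Path.length_le {I : Grid ℝ h v} {es T : List (Edge h v)} {ω : State h}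
    (hp : Path I es T ω) : T.length ≤ 2 * es.length := by
  induction hp with
  | nil => simp
  | @snoc es T e m ω ω' h1 h2 ih =>
    have := m.isLt
    simp only [List.length_append, List.length_replicate, List.length_singleton]
    omega

theorem length_edges_le (h v : ℕ) : (edges h v).length ≤ 2 * (h * v) := by
  rcases Nat.eq_zero_or_pos h with rfl | hh
  · have : edges 0 v = [] := by
      refine List.eq_nil_iff_forall_not_mem.2 fun e _ => ?_
      cases e with
      | vert i _ _ => exact i.elim0
      | horiz i _ _ => exact i.elim0
    simp [this]
  rcases Nat.eq_zero_or_pos v with rfl | hv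
  · simp [edges]
  have := length_edges hh hv
  rw [← mul_assoc]
  omega

/-- The tour computed for a grid each line of which contains a vertex to visit. -/
theorem solve_spec {I : Grid ℝ h v} (hx : StrictMono I.x) (hy : StrictMono I.y) (hh : 0 < h)
    (hv : 0 < v) (hrow : ∀ i, ∃ j, I.mand i j = true) (hcol : ∀ j, ∃ i, I.mand i j = true) :
    (solve I).val.Nodup ∧
    (∀ p, p ∈ (solve I).val ↔ ∃ u : Vertex h v, I.mand u.1 u.2 = true ∧ I.point u = p) ∧
    ∀ us : List (Vertex h v), (∀ u, I.mand u.1 u.2 = true → u ∈ us) →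
      tourLength (solve I).val ≤ tourLength (us.map I.point) := by
  classical
  have hinj : Function.Injective I.point := by
    rintro ⟨i, j⟩ ⟨i', j'⟩ huw
    obtain ⟨h1, h2⟩ := Prod.mk.inj huw
    exact Prod.ext (hy.injective h2) (hx.injective h1)
  rw [solve]
  simp only [Counted.val_bind]
  split_ifs with h1
  · obtain ⟨rfl, rfl⟩ := h1
    have hval : ((List.finRange 1).flatMap fun i => (List.finRange 1).map fun j =>
        (I.x j, I.y i)) = [I.point (0, 0)] := rfl
    simp only [Counted.val_bind, Counted.val_pure]
    rw [hval]
    refine ⟨by simp, ?_, ?_⟩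
    · intro p
      rw [List.mem_singleton]
      constructor
      · rintro rfl
        obtain ⟨j, hj⟩ := hrow 0
        rw [Subsingleton.elim j 0] at hj
        exact ⟨(0, 0), hj, rfl⟩
      · rintro ⟨u, -, rfl⟩
        rw [Subsingleton.elim u (0, 0)]
    · intro us _
      rw [tourLength_cons]
      simpa [dist1_self] using tourLength_nonneg _
  -- The grid has two lines of one direction, and each of them carries a vertex to visit.
  · have htwo : ∃ u w : Vertex h v, I.mand u.1 u.2 = true ∧ I.mand w.1 w.2 = true ∧ u ≠ w := by
      by_cases hh1 : h = 1
      · have hv2 : 1 < v := by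
          have : v ≠ 1 := fun hv1 => h1 ⟨hh1, hv1⟩
          omega
        obtain ⟨i, hi⟩ := hcol ⟨0, hv⟩
        obtain ⟨i', hi'⟩ := hcol ⟨1, hv2⟩
        exact ⟨(i, _), (i', _), hi, hi', fun hc => by simpa using congrArg Prod.snd hc⟩
      · have hh2 : 1 < h := by omega
        obtain ⟨j, hj⟩ := hrow ⟨0, hh⟩
        obtain ⟨j', hj'⟩ := hrow ⟨1, hh2⟩
        exact ⟨(_, j), (_, j'), hj, hj', fun hc => by simpa using congrArg Prod.fst hc⟩
    obtain ⟨u0, w0, hu0, hw0, huw0⟩ := htwo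
    have hlast : ∃ r j, j.val + 1 = v ∧ I.mand r j = true := by
      obtain ⟨i, hi⟩ := hcol ⟨v - 1, by omega⟩
      exact ⟨i, _, by simp; omega, hi⟩
    obtain ⟨hsound, hopt⟩ := tourSubgraph_spec hlast
    have hbound : ∀ us : List (Vertex h v), (∀ u, I.mand u.1 u.2 = true → u ∈ us) →
        ∃ r, (tourSubgraph I).val = some r ∧ r.1 ≤ tourLength (us.map I.point) := by
      intro us hus
      obtain ⟨m, h2, h3⟩ := exists_build_of_tour hx.monotone hy.monotone us hus
        ⟨u0, w0, hus _ hu0, hus _ hw0, huw0⟩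
      obtain ⟨r, h4, h5⟩ := hopt m h2
      exact ⟨r, h4, h5.trans h3⟩
    -- A tour of all grid vertices serves only to show that the dynamic program returns something.
    obtain ⟨r, hr, -⟩ := hbound Finset.univ.toList (by simp)
    obtain ⟨hlen, hT, ω, hp⟩ := hsound r hr
    obtain ⟨len, T⟩ := r
    cases T with
    | nil => exact absurd rfl (hT.covers _ _ hu0)
    | cons e T =>
      simp only [Counted.val_bind, hr]
      have hadj := hp.adjacent fun e he => mem_edges.1 he
      -- There are at most `2 * (h * v)` segments with at most two copies each, and every copy
      -- counts twice in the fuel.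
      have hfuel : 2 * (e :: T).length + 1 ≤ 8 * (h * v) + 1 := by
        have h2 : (e :: T).length ≤ 2 * (edges h v).length := hp.length_le
        have h3 := length_edges_le h v
        omega
      obtain ⟨h2, h3, h4, h5⟩ := euler_isTourGraph hx.monotone hy.monotone hadj hT hfuel
      obtain ⟨h6, h7, h8⟩ := shortcut_spec I hinj
        (euler (8 * (h * v) + 1) [e.src] (multi (e :: T)).val []).val fun _ => false
      refine ⟨h7, ?_, ?_⟩
      · intro p
        rw [h8]
        constructor
        · rintro ⟨u, -, hu, -, rfl⟩
          exact ⟨u, hu, rfl⟩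
        · rintro ⟨u, hu, rfl⟩
          exact ⟨u, h5 u (hT.covers _ _ hu), hu, rfl, rfl⟩
      · intro us hus
        obtain ⟨r, hr', h9⟩ := hbound us hus
        rw [hr, Option.some.injEq] at hr'
        subst hr'
        refine (tourLength_le_walkLength h6 (s := I.point e.src) ?_ ?_).trans ?_
        · rw [List.head?_map, h2]
          rfl
        · rw [List.getLast?_map, h3]
          rfl
        · rw [walkLength_map]
          exact h4.trans (hlen.symm.le.trans h9)

end FromTours

/-! ### The construction of the grid -/

section Construction

theorem insertRow_spec (a : ℝ) (l : List ℝ) (hl : l.Pairwise (· < ·)) :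
    (insertRow a l).val.Pairwise (· < ·) ∧ ∀ x, x ∈ (insertRow a l).val ↔ x = a ∨ x ∈ l := by
  induction l with
  | nil => simp [insertRow]
  | cons b l ih =>
    obtain ⟨h1, h2⟩ := List.pairwise_cons.1 hl
    obtain ⟨h3, h4⟩ := ih h2
    rw [insertRow]
    simp only [Counted.val_bind]
    split_ifs with hab hab'
    · refine ⟨List.pairwise_cons.2 ⟨?_, hl⟩, fun x => ?_⟩
      · intro x hx
        rcases List.mem_cons.1 hx with rfl | hx
        · exact hab
        · exact hab.trans (h1 x hx)
      · simp
    · subst hab'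
      exact ⟨hl, fun x => by simp⟩
    · simp only [Counted.val_bind, Counted.val_pure]
      refine ⟨List.pairwise_cons.2 ⟨?_, h3⟩, fun x => ?_⟩
      · intro x hx
        rcases (h4 x).1 hx with rfl | hx
        · exact lt_of_le_of_ne (not_lt.1 hab) (Ne.symm hab')
        · exact h1 x hx
      · rw [List.mem_cons, h4, List.mem_cons]
        tauto

theorem steps_insertRow_le (a : ℝ) (l : List ℝ) : (insertRow a l).steps ≤ l.length + 1 := by
  induction l with
  | nil => simp [insertRow]
  | cons b l ih =>
    rw [insertRow]
    simp only [Counted.steps_bind, steps_tick]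
    split_ifs
    · simp
    · simp
    · simp only [Counted.steps_bind, Counted.steps_pure, List.length_cons]
      omega

theorem rows_spec (pts : List (ℝ × ℝ)) :
    (rows pts).val.Pairwise (· < ·) ∧ ∀ x, x ∈ (rows pts).val ↔ ∃ p ∈ pts, p.2 = x := by
  have key : ∀ (pts : List (ℝ × ℝ)) (l : List ℝ), l.Pairwise (· < ·) →
      (pts.foldl (fun l p => (insertRow p.2 l).val) l).Pairwise (· < ·) ∧
      ∀ x, x ∈ pts.foldl (fun l p => (insertRow p.2 l).val) l ↔ x ∈ l ∨ ∃ p ∈ pts, p.2 = x := by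
    intro pts
    induction pts with
    | nil => simp
    | cons p pts ih =>
      intro l hl
      obtain ⟨h1, h2⟩ := insertRow_spec p.2 l hl
      obtain ⟨h3, h4⟩ := ih _ h1
      refine ⟨h3, fun x => ?_⟩
      rw [List.foldl_cons, h4, h2]
      simp only [List.mem_cons, exists_eq_or_imp, eq_comm (a := x)]
      tauto
  have hval : (rows pts).val = pts.foldl (fun l p => (insertRow p.2 l).val) [] := by
    rw [rows, Counted.val_foldlM]
    rfl
  rw [hval]
  simpa using key pts [] List.Pairwise.nil

/-- The accumulated list stays strictly increasing with entries in `S`, so its length, which bounds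
the cost of an insertion, never exceeds `S.card`. -/
theorem steps_rows_le (pts : List (ℝ × ℝ)) {S : Finset ℝ} (hS : ∀ p ∈ pts, p.2 ∈ S) :
    (rows pts).steps ≤ pts.length * (S.card + 2) := by
  classical
  refine (Counted.foldlM_induction (fun l : List ℝ => l.Pairwise (· < ·) ∧ ∀ x ∈ l, x ∈ S)
    (S.card + 2) pts ?_ [] ⟨List.Pairwise.nil, by simp⟩).2
  rintro l p hp ⟨h1, h2⟩
  obtain ⟨h3, h4⟩ := insertRow_spec p.2 l h1
  refine ⟨⟨h3, fun x hx => ?_⟩, ?_⟩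
  · rcases (h4 x).1 hx with rfl | hx
    · exact hS p hp
    · exact h2 x hx
  · have h5 : l.length ≤ S.card := by
      rw [← List.toFinset_card_of_nodup (h1.imp fun hab => ne_of_lt hab)]
      exact Finset.card_le_card fun x hx => h2 x (List.mem_toFinset.1 hx)
    have h6 := steps_insertRow_le p.2 l
    simp only [Counted.steps_bind, steps_tick]
    omega

theorem cols_cons_val (p : ℝ × ℝ) (l : List (ℝ × ℝ)) :
    (cols (p :: l)).val = match (cols l).val with
      | [] => [p.1]
      | a :: xs => if p.1 = a then a :: xs else p.1 :: a :: xs := by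
  rw [cols]
  simp only [Counted.val_bind]
  cases (cols l).val with
  | nil => rfl
  | cons a xs => rfl

theorem steps_cols (l : List (ℝ × ℝ)) : (cols l).steps = l.length + 1 := by
  induction l with
  | nil => rfl
  | cons p l ih =>
    rw [cols]
    simp only [Counted.steps_bind, steps_tick, ih, List.length_cons]
    cases (cols l).val <;> simp <;> omega

theorem mem_cols (l : List (ℝ × ℝ)) (x : ℝ) : x ∈ (cols l).val ↔ ∃ p ∈ l, p.1 = x := by
  induction l with
  | nil => simp [cols]
  | cons p l ih =>
    rw [cols_cons_val]
    simp only [List.mem_cons, exists_eq_or_imp, ← ih]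
    cases (cols l).val with
    | nil => simp [eq_comm]
    | cons a xs =>
      dsimp only
      split_ifs with h1
      · simp only [List.mem_cons, h1]
        tauto
      · simp only [List.mem_cons, eq_comm (a := x) (b := p.1)]

theorem exists_cols_cons (p : ℝ × ℝ) (l : List (ℝ × ℝ)) :
    ∃ xs, (cols (p :: l)).val = p.1 :: xs := by
  rw [cols_cons_val]
  cases (cols l).val with
  | nil => exact ⟨[], rfl⟩
  | cons a xs =>
    dsimp only
    split_ifs with h1
    · exact ⟨xs, by rw [h1]⟩
    · exact ⟨a :: xs, rfl⟩

theorem pairwise_cols (l : List (ℝ × ℝ)) (hl : l.Pairwise fun p q => p.1 ≤ q.1) :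
    (cols l).val.Pairwise (· < ·) := by
  induction l with
  | nil => simp [cols]
  | cons p l ih =>
    obtain ⟨h1, h2⟩ := List.pairwise_cons.1 hl
    have h3 := ih h2
    have h4 : ∀ x ∈ (cols l).val, p.1 ≤ x := by
      intro x hx
      obtain ⟨q, hq, rfl⟩ := (mem_cols l x).1 hx
      exact h1 q hq
    rw [cols_cons_val]
    revert h3 h4
    cases (cols l).val with
    | nil => simp
    | cons a xs =>
      intro h3 h4
      dsimp only
      split_ifs with h5
      · exact h3
      · refine List.pairwise_cons.2 ⟨fun x hx => ?_, h3⟩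
        have h6 : p.1 < a := lt_of_le_of_ne (h4 a (by simp)) h5
        rcases List.mem_cons.1 hx with rfl | hx
        · exact h6
        · exact h6.trans ((List.pairwise_cons.1 h3).1 x hx)

/-- The abscissae, starting with the abscissa of the current vertical line. -/
theorem cols_cons_cons (q p : ℝ × ℝ) (l : List (ℝ × ℝ)) :
    (cols (q :: p :: l)).val =
      if p.1 = q.1 then (cols (p :: l)).val else q.1 :: (cols (p :: l)).val := by
  rw [cols_cons_val q]
  obtain ⟨xs, hxs⟩ := exists_cols_cons p l
  rw [hxs]
  simp only [eq_comm (a := q.1)]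

variable {h : ℕ}

/-- Here `q` plays the previous point, on line number `j`. As `cols (q :: l)` starts with `q.1`, the
number of the line of a later point is `j` plus the position of its abscissa in that list. -/
theorem mark_spec (y : Fin h → ℝ) (l : List (ℝ × ℝ)) (q : ℝ × ℝ) (j : ℕ) (M : Fin h → ℕ → Bool)
    (hl : (q :: l).Pairwise fun p q => p.1 ≤ q.1) (i : Fin h) (k : ℕ) :
    (mark y q.1 j l M).val i k = true ↔ M i k = true ∨
      ∃ p ∈ l, y i = p.2 ∧ j ≤ k ∧ (cols (q :: l)).val[k - j]? = some p.1 := by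
  induction l generalizing q j M with
  | nil => simp [mark]
  | cons p l ih =>
    obtain ⟨h1, h2⟩ := List.pairwise_cons.1 hl
    have hpw := pairwise_cols (p :: l) h2
    obtain ⟨xs, hxs⟩ := exists_cols_cons p l
    -- The abscissae are distinct, so `p.1` occurs at position zero only.
    have hfirst : ∀ j', (j' ≤ k ∧ (cols (p :: l)).val[k - j']? = some p.1) ↔ k = j' := by
      intro j'
      constructor
      · rintro ⟨h3, h4⟩
        have h5 : (cols (p :: l)).val[0]? = some p.1 := by rw [hxs]; rfl
        have hnd : (cols (p :: l)).val.Nodup := hpw.imp fun hab => ne_of_lt hab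
        have := (List.getElem?_inj (i := k - j') (j := 0) (List.getElem?_eq_some_iff.1 h4).1
          hnd).1 (h4.trans h5.symm)
        omega
      · rintro rfl
        refine ⟨le_rfl, ?_⟩
        rw [Nat.sub_self, hxs]
        rfl
    rw [mark]
    simp only [Counted.val_bind]
    rw [ih p _ _ h2, cols_cons_cons]
    simp only [Bool.or_eq_true, decide_eq_true_eq, List.mem_cons, exists_eq_or_imp]
    by_cases hpq : p.1 = q.1
    · rw [if_pos hpq, if_pos hpq, hfirst]
      tauto
    · rw [if_neg hpq, if_neg hpq]
      -- Dropping the leading abscissa lowers positions by one, which compensates for the increase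
      -- of the line number.
      have hshift : ∀ p' : ℝ × ℝ, p'.1 ≠ q.1 →
          ((j + 1 ≤ k ∧ (cols (p :: l)).val[k - (j + 1)]? = some p'.1) ↔
          (j ≤ k ∧ (q.1 :: (cols (p :: l)).val)[k - j]? = some p'.1)) := by
        intro p' hp'
        rcases Nat.lt_or_ge j k with hjk | hjk
        · have : k - j = (k - (j + 1)) + 1 := by omega
          rw [this, List.getElem?_cons_succ]
          exact and_congr_left fun _ => ⟨fun _ => by omega, fun _ => by omega⟩
        · have : k - j = 0 := by omega
          rw [this, List.getElem?_cons_zero]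
          refine iff_of_false (fun hh => by omega) fun hh => hp' ?_
          exact (Option.some.inj hh.2).symm
      have hlt : q.1 < p.1 := lt_of_le_of_ne (h1 p (by simp)) (Ne.symm hpq)
      rw [← hshift p hpq, hfirst]
      have : (∃ a ∈ l, y i = a.2 ∧ j + 1 ≤ k ∧ (cols (p :: l)).val[k - (j + 1)]? = some a.1) ↔
          ∃ a ∈ l, y i = a.2 ∧ j ≤ k ∧ (q.1 :: (cols (p :: l)).val)[k - j]? = some a.1 := by
        refine exists_congr fun a => and_congr_right fun ha => and_congr_right fun _ => ?_
        refine hshift a (ne_of_gt (hlt.trans_le ?_))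
        exact (List.pairwise_cons.1 h2).1 a ha
      rw [this, or_assoc, and_comm (a := k = j + 1)]

theorem steps_mark (y : Fin h → ℝ) (a : ℝ) (j : ℕ) (l : List (ℝ × ℝ)) (M : Fin h → ℕ → Bool) :
    (mark y a j l M).steps = l.length * (h + 2) + 1 := by
  induction l generalizing a j M with
  | nil => simp [mark]
  | cons p l ih =>
    rw [mark]
    simp only [Counted.steps_bind, steps_tick, ih, List.length_cons]
    ring

theorem grid_sigma_ext {h v h' v' : ℕ} (hh : h = h') (hv : v = v') (G : Grid ℝ h v)
    (G' : Grid ℝ h' v') (hy : ∀ i, G.y i = G'.y (Fin.cast hh i))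
    (hx : ∀ j, G.x j = G'.x (Fin.cast hv j))
    (hm : ∀ i j, G.mand i j = G'.mand (Fin.cast hh i) (Fin.cast hv j)) :
    (⟨h, v, G⟩ : Σ h v : ℕ, Grid ℝ h v) = ⟨h', v', G'⟩ := by
  subst hh hv
  obtain ⟨y, x, m⟩ := G
  obtain ⟨y', x', m'⟩ := G'
  obtain rfl : y = y' := funext hy
  obtain rfl : x = x' := funext hx
  obtain rfl : m = m' := funext fun i => funext fun j => hm i j
  rfl

theorem length_eq_card_of_pairwise {l : List ℝ} (hl : l.Pairwise (· < ·)) {S : Finset ℝ}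
    (hS : ∀ x, x ∈ l ↔ x ∈ S) : l.length = S.card := by
  rw [← List.toFinset_card_of_nodup (hl.imp fun hab => ne_of_lt hab)]
  congr 1
  ext x
  rw [List.mem_toFinset, hS]

/-- A finite set of reals has only one increasing enumeration. -/
theorem get_eq_orderEmbOfFin {l : List ℝ} (hl : l.Pairwise (· < ·)) {S : Finset ℝ}
    (hS : ∀ x, x ∈ l ↔ x ∈ S) (i : Fin l.length) :
    l.get i = S.orderEmbOfFin rfl (Fin.cast (length_eq_card_of_pairwise hl hS) i) := by
  have hlen := length_eq_card_of_pairwise hl hS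
  have := Finset.orderEmbOfFin_unique (s := S) rfl (f := fun k => l.get (Fin.cast hlen.symm k))
    (fun k => (hS _).1 (List.get_mem _ _)) (fun a b hab => by
      rw [List.pairwise_iff_get] at hl
      exact hl _ _ hab)
  have h2 := congrFun this (Fin.cast hlen i)
  simpa using h2

theorem Enumerates.length_eq {pts : List (ℝ × ℝ)} {P : Finset (ℝ × ℝ)} (hp : Enumerates pts P) :
    pts.length = P.card := by
  classical
  rw [← List.toFinset_card_of_nodup hp.1]
  congr 1
  ext p
  rw [List.mem_toFinset, hp.2]

section
variable {P : Finset (ℝ × ℝ)} {pts : List (ℝ × ℝ)} (hpts : Enumerates pts P)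
  (hsort : pts.Pairwise fun p q => p.1 ≤ q.1)
include hpts

theorem mem_rows_iff (x : ℝ) :
    x ∈ (rows pts).val ↔ x ∈ @Finset.image _ _ (Classical.decEq _) Prod.snd P := by
  rw [(rows_spec pts).2, Finset.mem_image]
  simp only [hpts.2]

theorem length_rows : (rows pts).val.length = numRows P := by
  rw [length_eq_card_of_pairwise (rows_spec pts).1 (mem_rows_iff hpts), numRows]

theorem mem_cols_iff (x : ℝ) :
    x ∈ (cols pts).val ↔ x ∈ @Finset.image _ _ (Classical.decEq _) Prod.fst P := by
  rw [mem_cols, Finset.mem_image]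
  simp only [hpts.2]

include hsort

theorem length_cols : (cols pts).val.length = numCols P := by
  rw [length_eq_card_of_pairwise (pairwise_cols pts hsort) (mem_cols_iff hpts), numCols]

theorem buildGrid_val : (buildGrid pts).val = ⟨numRows P, numCols P, hanan P⟩ := by
  have hval : (buildGrid pts).val = ⟨(rows pts).val.length, (cols pts).val.length,
      ⟨(rows pts).val.get, (cols pts).val.get, fun i j =>
        (mark (rows pts).val.get ((pts.map Prod.fst).headD 0) 0 pts fun _ _ => false).val i
          j.val⟩⟩ := rfl
  rw [hval]
  have hy : ∀ i, (rows pts).val.get i = (hanan P).y (Fin.cast (length_rows hpts) i) := by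
    intro i
    rw [get_eq_orderEmbOfFin (rows_spec pts).1 (mem_rows_iff hpts)]
    simp only [hanan]
    congr!
  have hx : ∀ j, (cols pts).val.get j = (hanan P).x (Fin.cast (length_cols hpts hsort) j) := by
    intro j
    rw [get_eq_orderEmbOfFin (pairwise_cols pts hsort) (mem_cols_iff hpts)]
    simp only [hanan]
    congr!
  refine grid_sigma_ext (length_rows hpts) (length_cols hpts hsort) _ _ hy hx ?_
  intro i j
  rw [Bool.eq_iff_iff]
  have hm : (hanan P).mand (Fin.cast (length_rows hpts) i) (Fin.cast (length_cols hpts hsort) j) =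
      true ↔ ((cols pts).val.get j, (rows pts).val.get i) ∈ P := by
    rw [hx, hy]
    simp only [hanan, decide_eq_true_eq]
  rw [hm]
  cases pts with
  | nil => exact absurd j.isLt (by simp [cols])
  | cons p l =>
    -- The marking starts with the abscissa of the first point on line zero, so the first point acts
    -- as its own predecessor.
    have hpw : (p :: p :: l).Pairwise fun p q => p.1 ≤ q.1 := by
      refine List.pairwise_cons.2 ⟨fun q hq => ?_, hsort⟩
      rcases List.mem_cons.1 hq with rfl | hq
      · exact le_rfl
      · exact (List.pairwise_cons.1 hsort).1 q hq
    change (mark (rows (p :: l)).val.get p.1 0 (p :: l) fun _ _ => false).val i j.val = true ↔ _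
    rw [mark_spec _ _ p 0 _ hpw, cols_cons_cons, if_pos rfl]
    simp only [Bool.false_eq_true, false_or, Nat.zero_le, true_and, Nat.sub_zero]
    have hget : (cols (p :: l)).val[j.val]? = some ((cols (p :: l)).val.get j) := by
      simp
    rw [hget, ← hpts.2]
    constructor
    · rintro ⟨q, hq, h1, h2⟩
      rw [Option.some.inj h2, h1]
      exact hq
    · intro hq
      exact ⟨_, hq, rfl, rfl⟩

theorem steps_buildGrid_le : (buildGrid pts).steps ≤ P.card * (numRows P + 2) + (P.card + 1) +
    (numRows P + numCols P + numRows P * numCols P) + (P.card * (numRows P + 2) + 1) := by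
  have h1 : (rows pts).steps ≤ P.card * (numRows P + 2) := by
    have := steps_rows_le pts (S := @Finset.image _ _ (Classical.decEq _) Prod.snd P) fun p hp =>
      (mem_rows_iff hpts _).1 (((rows_spec pts).2 _).2 ⟨p, hp, rfl⟩)
    rw [← length_eq_card_of_pairwise (rows_spec pts).1 (mem_rows_iff hpts), length_rows hpts,
      hpts.length_eq] at this
    exact this
  have hval : (buildGrid pts).steps = (rows pts).steps + ((cols pts).steps +
      (((rows pts).val.length + (cols pts).val.length +
        (rows pts).val.length * (cols pts).val.length) +
      ((mark (rows pts).val.get ((pts.map Prod.fst).headD 0) 0 pts fun _ _ => false).steps +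
        0))) := rfl
  rw [hval, steps_mark, steps_cols, length_rows hpts, length_cols hpts hsort, hpts.length_eq]
  omega

end

variable {P : Finset (ℝ × ℝ)}

theorem numRows_pos (hP : P.Nonempty) : 0 < numRows P :=
  Finset.card_pos.2 (hP.image _)

theorem numCols_pos (hP : P.Nonempty) : 0 < numCols P :=
  Finset.card_pos.2 (hP.image _)

theorem numCols_le (P : Finset (ℝ × ℝ)) : numCols P ≤ P.card := Finset.card_image_le

theorem strictMono_hanan_x (P : Finset (ℝ × ℝ)) : StrictMono (hanan P).x :=
  OrderEmbedding.strictMono _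

theorem strictMono_hanan_y (P : Finset (ℝ × ℝ)) : StrictMono (hanan P).y :=
  OrderEmbedding.strictMono _

theorem hanan_mand_iff (i : Fin (numRows P)) (j : Fin (numCols P)) :
    (hanan P).mand i j = true ↔ (hanan P).point (i, j) ∈ P := by
  simp only [hanan, decide_eq_true_eq, Grid.point]

theorem exists_hanan_vertex {p : ℝ × ℝ} (hp : p ∈ P) :
    ∃ u : Vertex (numRows P) (numCols P), (hanan P).point u = p := by
  classical
  have h1 : p.2 ∈ Set.range ((P.image Prod.snd).orderEmbOfFin rfl) := by
    rw [Finset.range_orderEmbOfFin]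
    exact Finset.mem_coe.2 (Finset.mem_image_of_mem _ hp)
  have h2 : p.1 ∈ Set.range ((P.image Prod.fst).orderEmbOfFin rfl) := by
    rw [Finset.range_orderEmbOfFin]
    exact Finset.mem_coe.2 (Finset.mem_image_of_mem _ hp)
  obtain ⟨i, hi⟩ := h1
  obtain ⟨j, hj⟩ := h2
  exact ⟨(i, j), Prod.ext hj hi⟩

theorem exists_hanan_mand_row (i : Fin (numRows P)) : ∃ j, (hanan P).mand i j = true := by
  classical
  have h1 : (hanan P).y i ∈ P.image Prod.snd := by
    exact Finset.orderEmbOfFin_mem (P.image Prod.snd) rfl i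
  obtain ⟨p, hp, h2⟩ := Finset.mem_image.1 h1
  obtain ⟨u, hu⟩ := exists_hanan_vertex hp
  have h3 : u.1 = i := (strictMono_hanan_y P).injective ((congrArg Prod.snd hu).trans h2)
  refine ⟨u.2, (hanan_mand_iff _ _).2 ?_⟩
  rw [← h3, Prod.mk.eta, hu]
  exact hp

theorem exists_hanan_mand_col (j : Fin (numCols P)) : ∃ i, (hanan P).mand i j = true := by
  classical
  have h1 : (hanan P).x j ∈ P.image Prod.fst := by
    exact Finset.orderEmbOfFin_mem (P.image Prod.fst) rfl j
  obtain ⟨p, hp, h2⟩ := Finset.mem_image.1 h1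
  obtain ⟨u, hu⟩ := exists_hanan_vertex hp
  have h3 : u.2 = j := (strictMono_hanan_x P).injective ((congrArg Prod.fst hu).trans h2)
  refine ⟨u.1, (hanan_mand_iff _ _).2 ?_⟩
  rw [← h3, Prod.mk.eta, hu]
  exact hp

theorem solve_hanan_spec (hP : P.Nonempty) : Enumerates (solve (hanan P)).val P ∧
    ∀ σ, Enumerates σ P → tourLength (solve (hanan P)).val ≤ tourLength σ := by
  obtain ⟨h1, h2, h3⟩ := solve_spec (strictMono_hanan_x P) (strictMono_hanan_y P) (numRows_pos hP)
    (numCols_pos hP) exists_hanan_mand_row exists_hanan_mand_col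
  refine ⟨⟨h1, fun p => ?_⟩, fun σ hσ => ?_⟩
  · rw [h2]
    constructor
    · rintro ⟨u, hu, rfl⟩
      exact (hanan_mand_iff _ _).1 hu
    · intro hp
      obtain ⟨u, rfl⟩ := exists_hanan_vertex hp
      exact ⟨u, (hanan_mand_iff _ _).2 hp, rfl⟩
  · obtain ⟨us, rfl⟩ : ∃ us : List (Vertex (numRows P) (numCols P)),
        us.map (hanan P).point = σ := by
      have : ∀ p ∈ σ, ∃ u : Vertex (numRows P) (numCols P), (hanan P).point u = p :=
        fun p hp => exists_hanan_vertex ((hσ.2 p).1 hp)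
      have hr : σ ∈ Set.range (List.map (hanan P).point) := by
        rw [Set.range_list_map]
        exact this
      exact hr
    refine h3 us fun u hu => ?_
    have := (hσ.2 _).2 ((hanan_mand_iff _ _).1 hu)
    obtain ⟨w, hw, hwu⟩ := List.mem_map.1 this
    have h4 : w = u := by
      obtain ⟨h5, h6⟩ := Prod.mk.inj hwu
      exact Prod.ext ((strictMono_hanan_y P).injective h6) ((strictMono_hanan_x P).injective h5)
    rwa [← h4]

end Construction

/-! ### The number of states -/

section Counting

/-- The letters of the word that encodes a state: the lowest vertex of a component with several
vertices (with its parity), a vertex at which no component with several vertices begins or ends, and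
the highest vertex of a component with several vertices. -/
abbrev Letter := Bool ⊕ Fin 4 ⊕ Unit

/-- The words with `n` letters that lead from `k` open components to none. -/
def words : ℕ → ℕ → Finset (List Letter)
  | 0, 0 => {[]}
  | 0, _ + 1 => ∅
  | n + 1, 0 => (Finset.univ.biUnion fun b => (words n 1).image (List.cons (.inl b))) ∪
      Finset.univ.biUnion fun c => (words n 0).image (List.cons (.inr (.inl c)))
  | n + 1, k + 1 => (Finset.univ.biUnion fun b => (words n (k + 2)).image (List.cons (.inl b))) ∪
      (Finset.univ.biUnion fun c => (words n (k + 1)).image (List.cons (.inr (.inl c)))) ∪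
      (words n k).image (List.cons (.inr (.inr ())))

theorem cons_open_mem_words {n k : ℕ} {w : List Letter} (b : Bool) (hw : w ∈ words n (k + 1)) :
    .inl b :: w ∈ words (n + 1) k := by
  cases k <;> simp [words, hw]

theorem cons_level_mem_words {n k : ℕ} {w : List Letter} (c : Fin 4) (hw : w ∈ words n k) :
    .inr (.inl c) :: w ∈ words (n + 1) k := by
  cases k <;> simp [words, hw]

theorem cons_close_mem_words {n k : ℕ} {w : List Letter} (hw : w ∈ words n k) :
    .inr (.inr ()) :: w ∈ words (n + 1) (k + 1) := by
  simp [words, hw]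

/-- Weighted Motzkin numbers: paths from height `k` to height zero with `n` steps, of which the level
steps have weight four and the upward steps weight two. -/
def motzkin : ℕ → ℕ → ℕ
  | 0, 0 => 1
  | 0, _ + 1 => 0
  | n + 1, 0 => 4 * motzkin n 0 + 2 * motzkin n 1
  | n + 1, k + 1 => 4 * motzkin n (k + 1) + (2 * motzkin n (k + 2) + motzkin n k)

/-- Only an upper bound is needed, so the unions need not be shown to be disjoint. -/
theorem card_words_le (n k : ℕ) : (words n k).card ≤ motzkin n k := by
  have hbi : ∀ {α : Type} [Fintype α] (f : α → Letter) (S : Finset (List Letter)),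
      (Finset.univ.biUnion fun a => S.image (List.cons (f a))).card ≤ Fintype.card α * S.card := by
    intro α _ f S
    refine Finset.card_biUnion_le.trans ?_
    refine (Finset.sum_le_card_nsmul _ _ S.card fun a _ => Finset.card_image_le).trans ?_
    simp
  induction n generalizing k with
  | zero => cases k <;> simp [words, motzkin]
  | succ n ih =>
    cases k with
    | zero =>
      rw [words, motzkin]
      refine (Finset.card_union_le _ _).trans ?_
      have h1 := hbi (fun b : Bool => (.inl b : Letter)) (words n 1)
      have h2 := hbi (fun c : Fin 4 => (.inr (.inl c) : Letter)) (words n 0)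
      have h3 := ih 1
      have h4 := ih 0
      simp only [Fintype.card_bool, Fintype.card_fin] at h1 h2
      omega
    | succ k =>
      rw [words, motzkin]
      refine (Finset.card_union_le _ _).trans ?_
      have h0 := Finset.card_union_le
        (Finset.univ.biUnion fun b : Bool => (words n (k + 2)).image (List.cons (.inl b)))
        (Finset.univ.biUnion fun c : Fin 4 => (words n (k + 1)).image (List.cons (.inr (.inl c))))
      have h1 := hbi (fun b : Bool => (.inl b : Letter)) (words n (k + 2))
      have h2 := hbi (fun c : Fin 4 => (.inr (.inl c) : Letter)) (words n (k + 1))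
      have h3 := ih (k + 2)
      have h4 := ih (k + 1)
      have h5 := ih k
      have h6 := Finset.card_image_le (s := words n k)
        (f := List.cons (.inr (.inr ()) : Letter))
      simp only [Fintype.card_bool, Fintype.card_fin] at h1 h2
      omega

variable {h : ℕ}

/-! ### Encoding states as words. -/

/-- The `i`-th frontier vertex is the highest one of its component. -/
def IsHighest (ω : State h) (i : Fin h) : Prop := ∀ k, comp ω k = comp ω i → k ≤ i

open Classical in
/-- The letter that encodes the `i`-th frontier vertex. -/
noncomputable def letter (ω : State h) (i : Fin h) : Letter :=
  match ω i with
  | none => .inr (.inl 0)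
  | some (p, c) =>
    if c = i then
      if IsHighest ω i then .inr (.inl 1) else .inl p
    else if IsHighest ω i then .inr (.inr ()) else .inr (.inl (if p then 3 else 2))

/-- The components that have vertices below `i` and vertices that are not below `i`. -/
def openComponents (ω : State h) (i : ℕ) : Finset (Fin h) :=
  Finset.univ.filter fun c => comp ω c = some c ∧ c.val < i ∧ ∃ k : Fin h, i ≤ k.val ∧
    comp ω k = some c

theorem mem_openComponents {ω : State h} {i : ℕ} {c : Fin h} :
    c ∈ openComponents ω i ↔ comp ω c = some c ∧ c.val < i ∧ ∃ k : Fin h, i ≤ k.val ∧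
      comp ω k = some c := by
  simp [openComponents]

/-- Only the component of `i` itself can be opened or closed at `i`. -/
theorem mem_openComponents_succ_of_ne {ω : State h} {i c : Fin h} (hc : comp ω i ≠ some c) :
    c ∈ openComponents ω (i.val + 1) ↔ c ∈ openComponents ω i.val := by
  rw [mem_openComponents, mem_openComponents]
  refine and_congr_right fun h1 => ?_
  have h2 : c ≠ i := by
    rintro rfl
    exact hc h1
  rw [ne_eq, Fin.ext_iff] at h2
  refine and_congr (by omega) (exists_congr fun k => and_congr_left fun h3 => ?_)
  have h4 : k ≠ i := by
    rintro rfl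
    exact hc h3
  rw [ne_eq, Fin.ext_iff] at h4
  omega

theorem mem_openComponents_comp {ω : State h} (hω : IsPartition (comp ω)) {i c : Fin h}
    (hc : comp ω i = some c) : c ∈ openComponents ω i.val ↔ c ≠ i := by
  rw [mem_openComponents]
  have h1 := hω.le i c hc
  rw [Fin.le_def] at h1
  rw [ne_eq, Fin.ext_iff]
  constructor
  · rintro ⟨-, h2, -⟩
    omega
  · exact fun h2 => ⟨hω.name i c hc, by omega, i, le_rfl, hc⟩

theorem mem_openComponents_succ_comp {ω : State h} (hω : IsPartition (comp ω)) {i c : Fin h}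
    (hc : comp ω i = some c) : c ∈ openComponents ω (i.val + 1) ↔ ¬ IsHighest ω i := by
  rw [mem_openComponents, IsHighest]
  have h1 := hω.le i c hc
  rw [Fin.le_def] at h1
  push Not
  constructor
  · rintro ⟨-, -, k, h2, h3⟩
    exact ⟨k, h3.trans hc.symm, by rw [Fin.lt_def]; omega⟩
  · rintro ⟨k, h2, h3⟩
    rw [Fin.lt_def] at h3
    exact ⟨hω.name i c hc, by omega, k, by omega, h2.trans hc⟩

/-- The height of the path is the number of open components. It rises at the lowest and falls at the
highest vertex of a component with several vertices, and stays level elsewhere, in particular at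
singletons. -/
theorem drop_letters_mem_words {ω : State h} (hω : IsPartition (comp ω)) (n i : ℕ)
    (hi : i + n = h) :
    (List.ofFn (letter ω)).drop i ∈ words n (openComponents ω i).card := by
  induction n generalizing i with
  | zero =>
    have h1 : openComponents ω i = ∅ := by
      refine Finset.eq_empty_of_forall_notMem fun c hc => ?_
      obtain ⟨-, -, k, h2, -⟩ := mem_openComponents.1 hc
      have := k.isLt
      omega
    rw [h1, List.drop_eq_nil_of_le (by simp; omega)]
    simp [words]
  | succ n ih =>
    have hlt : i < h := by omega
    have hrec := ih (i + 1) (by omega)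
    rw [List.drop_eq_getElem_cons (by simpa using hlt), List.getElem_ofFn]
    set j : Fin h := ⟨i, hlt⟩ with hj
    cases hωj : ω j with
    | none =>
      have h1 : openComponents ω (i + 1) = openComponents ω i := by
        ext c
        exact mem_openComponents_succ_of_ne (i := j) (by simp [comp, hωj])
      have h2 : letter ω j = .inr (.inl 0) := by simp [letter, hωj]
      rw [h2, ← h1]
      exact cons_level_mem_words _ hrec
    | some pc =>
      obtain ⟨p, c⟩ := pc
      have hc : comp ω j = some c := by simp [comp, hωj]
      have h1 := mem_openComponents_comp hω hc
      have h2 := mem_openComponents_succ_comp hω hc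
      have h3 : ∀ d, d ≠ c → (d ∈ openComponents ω (i + 1) ↔ d ∈ openComponents ω i) := by
        intro d hd
        refine mem_openComponents_succ_of_ne (i := j) ?_
        rw [hc]
        exact fun hh => hd (Option.some.inj hh).symm
      change c ∈ openComponents ω i ↔ _ at h1
      change c ∈ openComponents ω (i + 1) ↔ _ at h2
      by_cases hlow : c = j <;> by_cases hhigh : IsHighest ω j
      · have h4 : openComponents ω (i + 1) = openComponents ω i := by
          ext d
          by_cases hd : d = c
          · rw [hd, h1, h2]
            simp [hlow, hhigh]
          · exact h3 d hd
        have h5 : letter ω j = .inr (.inl 1) := by simp [letter, hωj, hlow, hhigh]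
        rw [h5, ← h4]
        exact cons_level_mem_words _ hrec
      · have h4 : openComponents ω (i + 1) = insert c (openComponents ω i) := by
          ext d
          by_cases hd : d = c
          · rw [hd, h2]
            simp [hhigh]
          · rw [h3 d hd]
            simp [hd]
        have h5 : letter ω j = .inl p := by simp [letter, hωj, hlow, hhigh]
        rw [h4, Finset.card_insert_of_notMem (fun hc' => h1.1 hc' hlow)] at hrec
        rw [h5]
        exact cons_open_mem_words _ hrec
      · have h4 : openComponents ω i = insert c (openComponents ω (i + 1)) := by
          ext d
          by_cases hd : d = c
          · rw [hd, h1]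
            simp [hlow]
          · rw [← h3 d hd]
            simp [hd]
        have h5 : letter ω j = .inr (.inr ()) := by simp [letter, hωj, hlow, hhigh]
        rw [h4, Finset.card_insert_of_notMem (by simp [h2, hhigh]), h5]
        exact cons_close_mem_words hrec
      · have h4 : openComponents ω (i + 1) = openComponents ω i := by
          ext d
          by_cases hd : d = c
          · rw [hd, h1, h2]
            simp [hlow, hhigh]
          · exact h3 d hd
        have h5 : letter ω j = .inr (.inl (if p then 3 else 2)) := by
          simp [letter, hωj, hlow, hhigh]
        rw [h5, ← h4]
        exact cons_level_mem_words _ hrec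

theorem letters_mem_words {ω : State h} (hω : IsState ω) : List.ofFn (letter ω) ∈ words h 0 := by
  have h1 := drop_letters_mem_words (isState_iff.1 hω).1 h 0 (by omega)
  have h2 : openComponents ω 0 = ∅ := by
    refine Finset.eq_empty_of_forall_notMem fun c hc => ?_
    have := (mem_openComponents.1 hc).2.1
    omega
  simpa [h2] using h1

/-- Everything a letter reveals on its own: the names of components are missing, and so is the
parity of a highest vertex. -/
theorem letter_eq_imp {ω ω' : State h} {i : Fin h} (hl : letter ω i = letter ω' i) :
    (ω i = none ↔ ω' i = none) ∧ (comp ω i = some i ↔ comp ω' i = some i) ∧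
    (ω i ≠ none → (IsHighest ω i ↔ IsHighest ω' i)) ∧
    (¬ IsHighest ω i → ω i ≠ none → (ω i).map Prod.fst = (ω' i).map Prod.fst) := by
  rw [letter.eq_def, letter.eq_def] at hl
  rcases h1 : ω i with _ | ⟨p, c⟩ <;> rcases h2 : ω' i with _ | ⟨p', c'⟩ <;> rw [h1, h2] at hl <;>
    simp only [comp, h1, h2] at hl ⊢
  · simp
  · split_ifs at hl <;> simp at hl
  · split_ifs at hl <;> simp at hl
  · split_ifs at hl <;> simp_all

theorem exists_isHighest {ω : State h} {c : Fin h} (hc : comp ω c = some c) :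
    ∃ d, comp ω d = some c ∧ IsHighest ω d := by
  obtain ⟨d, hd, hmax⟩ := (Finset.univ.filter fun k => comp ω k = some c).exists_max_image id
    ⟨c, by simpa using hc⟩
  have hd' : comp ω d = some c := by simpa using hd
  exact ⟨d, hd', fun k hk => hmax k (by simp [hk, hd'])⟩

/-- A vertex that continues a component must continue the most recently opened one. The component
`c'` starts below `i` in both states; let `d` be its highest vertex in `ω`. If `d < i`, then `d`
would be highest in `ω'` as well, although `i` lies above it in `c'`; if `d = i`, the names agree;
if `d > i`, then `c < c' < i < d` is a crossing in `ω`. -/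
theorem not_lt_of_letter_eq {ω ω' : State h} (hω : IsPartition (comp ω))
    (hω' : IsPartition (comp ω')) (hl : ∀ i, letter ω i = letter ω' i) {i c c' : Fin h}
    (hbelow : ∀ k < i, comp ω k = comp ω' k) (hc : comp ω i = some c) (hc' : comp ω' i = some c') :
    ¬ c < c' := by
  intro hlt
  have h1 : c' ≠ i := by
    rintro rfl
    rw [← (letter_eq_imp (hl c')).2.1] at hc'
    rw [hc] at hc'
    exact hlt.ne (Option.some.inj hc')
  have h2 : c' < i := lt_of_le_of_ne (hω'.le i c' hc') h1
  have h3 : comp ω c' = some c' := by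
    rw [hbelow c' h2]
    exact hω'.name i c' hc'
  obtain ⟨d, hd, hhigh⟩ := exists_isHighest h3
  have hdn : ω d ≠ none := by
    intro hh
    simp [comp, hh] at hd
  have hhigh' := ((letter_eq_imp (hl d)).2.2.1 hdn).1 hhigh
  rcases lt_trichotomy d i with h4 | h4 | h4
  · have := hhigh' i (by rw [hc', ← hbelow d h4, hd])
    exact not_lt.2 this h4
  · rw [h4, hc] at hd
    exact hlt.ne (Option.some.inj hd)
  · have h5 := hω.name i c hc
    have := hω.noncrossing c c' i d hlt h2 h4 (by simp [h5]) (by simp [h3]) (h5.trans hc.symm)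
      (h3.trans hd.symm)
    rw [h5, h3] at this
    exact hlt.ne (Option.some.inj this)

/-- The names are recovered from bottom to top. Then all parities except those of the highest
vertices are read off, and these follow because every component has an even number of odd vertices.
-/
theorem letter_injOn {ω ω' : State h} (hω : IsState ω) (hω' : IsState ω')
    (hl : ∀ i, letter ω i = letter ω' i) : ω = ω' := by
  obtain ⟨hp, ho⟩ := isState_iff.1 hω
  obtain ⟨hp', ho'⟩ := isState_iff.1 hω'
  have hcomp : ∀ i, comp ω i = comp ω' i := by
    intro i
    induction i using WellFoundedLT.induction with
    | ind i ih =>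
      have h1 := (letter_eq_imp (hl i)).1
      cases hc : comp ω i with
      | none =>
        have : ω i = none := by simpa [comp] using hc
        simp [comp, h1.1 this]
      | some c =>
        cases hc' : comp ω' i with
        | none =>
          have : ω' i = none := by simpa [comp] using hc'
          simp [comp, h1.2 this] at hc
        | some c' =>
          have h2 := not_lt_of_letter_eq hp hp' hl ih hc hc'
          have h3 := not_lt_of_letter_eq hp' hp (fun i => (hl i).symm)
            (fun k hk => (ih k hk).symm) hc' hc
          rw [le_antisymm (not_lt.1 h3) (not_lt.1 h2)]
  have hpar : ∀ k, ω k ≠ none → ¬ IsHighest ω k → ω k = ω' k := by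
    intro k hk hh
    have h1 := (letter_eq_imp (hl k)).2.2.2 hh hk
    have h2 := hcomp k
    simp only [comp] at h2
    rcases h3 : ω k with _ | ⟨p, c⟩ <;> rcases h4 : ω' k with _ | ⟨p', c'⟩ <;>
      rw [h3, h4] at h1 h2 <;> simp_all
  funext i
  by_cases hn : ω i = none
  · rw [hn, ((letter_eq_imp (hl i)).1.1 hn)]
  by_cases hh : IsHighest ω i
  · obtain ⟨⟨p, c⟩, h1⟩ := Option.ne_none_iff_exists'.1 hn
    have hc : comp ω i = some c := by simp [comp, h1]
    have hc' : comp ω' i = some c := by rw [← hcomp, hc]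
    obtain ⟨⟨p', c'⟩, h2, h3⟩ := Option.map_eq_some_iff.1 hc'
    dsimp only at h3
    subst h3
    -- The other vertices of the component are not highest, hence equal in both states, and cancel.
    have hdiff : oddCount ω c' - oddCount ω' c' =
        (if ω i = some (true, c') then 1 else 0) - if ω' i = some (true, c') then 1 else 0 := by
      rw [oddCount, oddCount, ← Finset.sum_sub_distrib]
      refine Finset.sum_eq_single i (fun k _ hk => ?_) (by simp)
      by_cases hkc : comp ω k = some c'
      · have hkn : ω k ≠ none := by
          intro h0
          simp [comp, h0] at hkc
        have hki : ¬ IsHighest ω k := by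
          intro h4
          have h5 := h4 i (hc.trans hkc.symm)
          have h6 := hh k (hkc.trans hc.symm)
          exact hk (le_antisymm h6 h5)
        rw [hpar k hkn hki, sub_self]
      · rw [if_neg, if_neg, sub_self]
        · intro h4
          exact hkc (by rw [hcomp]; simp [comp, h4])
        · intro h4
          exact hkc (by simp [comp, h4])
    rw [ho, ho', h1, h2] at hdiff
    rw [h1, h2]
    cases p <;> cases p' <;> simp at hdiff ⊢
  · exact hpar i hn hh

theorem card_Omega_le_motzkin (h : ℕ) : (Omega h).card ≤ motzkin h 0 := by
  refine le_trans ?_ (card_words_le h 0)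
  refine Finset.card_le_card_of_injOn (fun ω => List.ofFn (letter ω)) ?_ ?_
  · intro ω hω
    exact letters_mem_words (Finset.mem_filter.1 hω).2
  · intro ω hω ω' hω' hl
    exact letter_injOn (Finset.mem_filter.1 hω).2 (Finset.mem_filter.1 hω').2
      (congrFun (List.ofFn_injective hl))

/-! ### Ballot numbers and the bound on the number of states. -/

/-- Weighted ballot numbers: paths from height `k` to height zero with `m` steps, none of which is
level and of which the upward steps have weight two. -/
def ballot : ℕ → ℕ → ℕ
  | 0, 0 => 1
  | 0, _ + 1 => 0
  | m + 1, 0 => 2 * ballot m 1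
  | m + 1, k + 1 => 2 * ballot m (k + 2) + ballot m k

/-- Level steps do not change the height: choose the positions of the `m` other steps, give each
level step one of four kinds, and the rest is a ballot path. The proof checks that both sides obey
the same recurrence, by Pascal's rule. -/
theorem motzkin_eq_sum (n k : ℕ) :
    motzkin n k = ∑ m ∈ Finset.range (n + 1), n.choose m * (4 ^ (n - m) * ballot m k) := by
  have hstep : ∀ n k, ∑ m ∈ Finset.range (n + 2),
      (n + 1).choose m * (4 ^ (n + 1 - m) * ballot m k) =
      4 * (∑ m ∈ Finset.range (n + 1), n.choose m * (4 ^ (n - m) * ballot m k)) +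
      ∑ m ∈ Finset.range (n + 1), n.choose m * (4 ^ (n - m) * ballot (m + 1) k) := by
    intro n k
    have := Finset.sum_choose_succ_mul (R := ℕ) (fun i j => 4 ^ j * ballot i k) n
    simp only [Nat.cast_id] at this
    rw [this, Finset.mul_sum]
    congr 1
    refine Finset.sum_congr rfl fun m hm => ?_
    have : n + 1 - m = (n - m) + 1 := by
      have := Finset.mem_range.1 hm
      omega
    rw [this, pow_succ]
    ring
  induction n generalizing k with
  | zero => cases k <;> simp [motzkin, ballot]
  | succ n ih =>
    rw [hstep, ← ih]
    cases k with
    | zero =>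
      rw [motzkin, ih 1, Finset.mul_sum]
      congr 1
      refine Finset.sum_congr rfl fun m _ => ?_
      rw [ballot]
      ring
    | succ k =>
      rw [motzkin, ih (k + 2), ih k, Finset.mul_sum, ← Finset.sum_add_distrib]
      congr 1
      refine Finset.sum_congr rfl fun m _ => ?_
      rw [ballot]
      ring

theorem ballot_eq_zero_of_lt {m k : ℕ} (hk : m < k) : ballot m k = 0 := by
  induction m generalizing k with
  | zero =>
    obtain ⟨k, rfl⟩ := Nat.exists_eq_succ_of_ne_zero hk.ne'
    rfl
  | succ m ih =>
    obtain ⟨k, rfl⟩ := Nat.exists_eq_succ_of_ne_zero (Nat.ne_zero_of_lt hk)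
    rw [ballot, ih (by omega), ih (by omega)]

theorem ballot_eq_zero_of_odd {m k : ℕ} (hk : Odd (m + k)) : ballot m k = 0 := by
  induction m generalizing k with
  | zero =>
    cases k with
    | zero => simp at hk
    | succ k => rfl
  | succ m ih =>
    cases k with
    | zero => rw [ballot, ih (by rwa [add_zero] at hk)]
    | succ k =>
      rw [ballot, ih (k := k + 2), ih (k := k)]
      · have h1 : m + 1 + (k + 1) = m + k + 2 := by ring
        rw [h1, Nat.odd_add] at hk
        simpa using hk
      · have h1 : m + 1 + (k + 1) = m + (k + 2) := by ring
        rwa [h1] at hk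

/-- The binomial coefficient to the left of `n.choose d`. -/
def choosePred (n : ℕ) : ℕ → ℕ
  | 0 => 0
  | d + 1 => n.choose d

theorem choosePred_succ (n d : ℕ) :
    choosePred (n + 1) (d + 1) = choosePred n d + n.choose d := by
  cases d with
  | zero => simp [choosePred]
  | succ d => exact Nat.choose_succ_succ n d

/-- Reflection principle: a path has `d` upward steps, hence weight `2 ^ d`, and the paths that dip
below zero correspond to the neighbouring binomial coefficient. The additive form avoids
subtraction. -/
theorem ballot_reflection (m k d : ℕ) (hm : m = k + 2 * d) :
    ballot m k + 2 ^ d * choosePred m d = 2 ^ d * m.choose d := by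
  induction m generalizing k d with
  | zero =>
    obtain ⟨rfl, rfl⟩ : k = 0 ∧ d = 0 := by omega
    simp [ballot, choosePred]
  | succ m ih =>
    cases k with
    | zero =>
      obtain ⟨d, rfl⟩ : ∃ e, d = e + 1 := ⟨d - 1, by omega⟩
      have h1 := ih 1 d (by omega)
      -- Here `m = 2 * d + 1`, so these are the two middle coefficients.
      have h2 : m.choose (d + 1) = m.choose d := Nat.choose_symm_of_eq_add (by omega)
      rw [ballot, choosePred_succ, Nat.choose_succ_succ, h2, pow_succ]
      linarith
    | succ k =>
      cases d with
      | zero =>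
        have h1 := ih k 0 (by omega)
        rw [ballot, ballot_eq_zero_of_lt (k := k + 2) (by omega)]
        simpa [choosePred] using h1
      | succ d =>
        have h1 := ih (k + 2) d (by omega)
        have h2 := ih k (d + 1) (by omega)
        rw [ballot, choosePred_succ, Nat.choose_succ_succ]
        have h3 : choosePred m (d + 1) = m.choose d := rfl
        rw [h3] at h2
        rw [pow_succ] at h2 ⊢
        linarith

theorem succ_mul_ballot (d : ℕ) : (d + 1) * ballot (2 * d) 0 = 2 ^ d * d.centralBinom := by
  have h1 := ballot_reflection (2 * d) 0 d (by omega)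
  have h2 : (d + 1) * choosePred (2 * d) d = d * (2 * d).choose d := by
    cases d with
    | zero => simp [choosePred]
    | succ e =>
      have := Nat.choose_succ_right_eq (2 * (e + 1)) e
      have h3 : 2 * (e + 1) - e = e + 2 := by omega
      rw [h3] at this
      rw [choosePred]
      linarith
  rw [Nat.centralBinom]
  have h3 : (d + 1) * ballot (2 * d) 0 + 2 ^ d * ((d + 1) * choosePred (2 * d) d) =
      (d + 1) * (2 ^ d * (2 * d).choose d) := by
    rw [← h1]
    ring
  rw [h2] at h3
  have h4 : (d + 1) * (2 ^ d * (2 * d).choose d) =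
      2 ^ d * (2 * d).choose d + 2 ^ d * (d * (2 * d).choose d) := by ring
  omega

/-- The square of the bound `4 ^ d / √(2 * d + 1)`. The induction step amounts to `(2 * d + 1) * (2
* d + 3) ≤ (2 * d + 2) ^ 2`. -/
theorem centralBinom_sq_mul_le (d : ℕ) : d.centralBinom ^ 2 * (2 * d + 1) ≤ 16 ^ d := by
  induction d with
  | zero => simp
  | succ d ih =>
    have h1 := Nat.succ_mul_centralBinom_succ d
    have h2 : (d + 1) ^ 2 * ((d + 1).centralBinom ^ 2 * (2 * (d + 1) + 1)) ≤
        (d + 1) ^ 2 * 16 ^ (d + 1) := by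
      calc (d + 1) ^ 2 * ((d + 1).centralBinom ^ 2 * (2 * (d + 1) + 1))
          = ((d + 1) * (d + 1).centralBinom) ^ 2 * (2 * d + 3) := by ring
        _ = (d.centralBinom ^ 2 * (2 * d + 1)) * (4 * ((2 * d + 1) * (2 * d + 3))) := by
            rw [h1]
            ring
        _ ≤ 16 ^ d * (4 * ((2 * d + 1) * (2 * d + 3))) := Nat.mul_le_mul_right _ ih
        _ ≤ 16 ^ d * (16 * (d + 1) ^ 2) := by
            refine Nat.mul_le_mul_left _ ?_
            nlinarith
        _ = (d + 1) ^ 2 * 16 ^ (d + 1) := by ring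
    exact Nat.le_of_mul_le_mul_left h2 (by positivity)

/-- For `m = 2 * d` the ballot number is at most `8 ^ d / ((d + 1) * √(2 * d + 1))`. It is rewritten
with `√(m + 1)` in the numerator, which is then enlarged to `√(n + 1)` so that it can leave the sum
over `m`. -/
theorem ballot_le {n m : ℕ} (hm : m ≤ n) : (ballot m 0 : ℝ) ≤
    √8 ^ m * (2 * √(n + 1) / ((m + 1) * (m + 2))) := by
  rcases Nat.even_or_odd m with hm2 | hm2
  · obtain ⟨d, rfl⟩ : ∃ d, m = 2 * d := hm2.two_dvd
    have h8 : √8 ^ (2 * d) = (8 : ℝ) ^ d := by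
      rw [pow_mul, Real.sq_sqrt (by norm_num)]
    have h1 : ((d : ℝ) + 1) * ballot (2 * d) 0 = 2 ^ d * d.centralBinom := by
      exact_mod_cast succ_mul_ballot d
    have h2 : (d.centralBinom : ℝ) * √(2 * d + 1) ≤ 4 ^ d := by
      have h3 : (d.centralBinom : ℝ) ^ 2 * (2 * d + 1) ≤ 16 ^ d := by
        exact_mod_cast centralBinom_sq_mul_le d
      refine abs_le_of_sq_le_sq' ?_ (by positivity) |>.2
      rw [mul_pow, Real.sq_sqrt (by positivity), ← pow_mul, mul_comm d, pow_mul]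
      norm_num
      exact h3
    have hs : √(2 * (d : ℝ) + 1) ≤ √((n : ℝ) + 1) := by
      refine Real.sqrt_le_sqrt ?_
      have : ((2 * d : ℕ) : ℝ) ≤ n := Nat.cast_le.2 hm
      push_cast at this
      linarith
    have hs2 : √(2 * (d : ℝ) + 1) * √(2 * (d : ℝ) + 1) = 2 * d + 1 :=
      Real.mul_self_sqrt (by positivity)
    rw [h8, mul_div_assoc', le_div_iff₀ (by positivity)]
    push_cast
    calc (ballot (2 * d) 0 : ℝ) * ((2 * d + 1) * (2 * d + 2))
        = 2 * (((d : ℝ) + 1) * ballot (2 * d) 0) * (2 * d + 1) := by ring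
      _ = 2 * (2 ^ d * d.centralBinom) * (√(2 * (d : ℝ) + 1) * √(2 * (d : ℝ) + 1)) := by
          rw [h1, hs2]
      _ = 2 * 2 ^ d * (d.centralBinom * √(2 * (d : ℝ) + 1)) * √(2 * (d : ℝ) + 1) := by ring
      _ ≤ 2 * 2 ^ d * 4 ^ d * √((n : ℝ) + 1) := by gcongr
      _ = 8 ^ d * (2 * √((n : ℝ) + 1)) := by
          have : (8 : ℝ) ^ d = 2 ^ d * 4 ^ d := by rw [← mul_pow]; norm_num
          rw [this]
          ring
  · rw [ballot_eq_zero_of_odd (by simpa using hm2)]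
    simp only [Nat.cast_zero]
    positivity

/-- The denominator `(m + 1) * (m + 2)` turns `n.choose m` into `(n + 2).choose (m + 2)` up to the
factor `(n + 1) * (n + 2)`. The sum is then part of the binomial expansion of `(4 + √8) ^ (n + 2)`,
and one of these factors is bounded by `8`. -/
theorem motzkin_le (n : ℕ) :
    (motzkin n 0 : ℝ) ≤ 2 * ((4 + √8) ^ (n + 1) / √(((n : ℝ) + 1) ^ 3)) := by
  have hN : (0 : ℝ) < n + 1 := by positivity
  have hs8 : √8 ≤ (4 : ℝ) := by
    rw [Real.sqrt_le_left (by norm_num)]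
    norm_num
  have hs8' : √8 ^ 2 = (8 : ℝ) := Real.sq_sqrt (by norm_num)
  -- The `8` in the denominator is `√8 ^ 2`, needed to raise the exponent of `√8` to `m + 2`.
  have hterm : ∀ m ∈ Finset.range (n + 1),
      ((n.choose m * (4 ^ (n - m) * ballot m 0) : ℕ) : ℝ) ≤
      2 * √(n + 1) / ((n + 1) * (n + 2) * 8) *
        (√8 ^ (m + 2) * 4 ^ (n - m) * (n + 2).choose (m + 2)) := by
    intro m hm
    have hmn : m ≤ n := by
      have := Finset.mem_range.1 hm
      omega
    have h1 := ballot_le hmn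
    have h2 : ((n : ℝ) + 1) * (n + 2) * n.choose m =
        (n + 2).choose (m + 2) * ((m + 1) * (m + 2)) := by
      have h3 := Nat.add_one_mul_choose_eq n m
      have h4 := Nat.add_one_mul_choose_eq (n + 1) (m + 1)
      have h5 : (n + 1) * (n + 2) * n.choose m = (n + 2).choose (m + 2) * ((m + 1) * (m + 2)) := by
        calc (n + 1) * (n + 2) * n.choose m = (n + 2) * ((n + 1) * n.choose m) := by ring
          _ = ((n + 1 + 1) * (n + 1).choose (m + 1)) * (m + 1) := by rw [h3]; ring
          _ = _ := by rw [h4]; ring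
      exact_mod_cast h5
    have h6 : ((n + 2).choose (m + 2) : ℝ) / ((n + 1) * (n + 2)) =
        n.choose m / ((m + 1) * (m + 2)) := by
      rw [div_eq_div_iff (by positivity) (by positivity), ← h2]
      ring
    push_cast
    calc (n.choose m : ℝ) * (4 ^ (n - m) * ballot m 0)
        ≤ n.choose m * (4 ^ (n - m) * (√8 ^ m * (2 * √(n + 1) / ((m + 1) * (m + 2))))) := by
          gcongr
      _ = (n.choose m / ((m + 1) * (m + 2))) * (2 * √(n + 1) * √8 ^ m * 4 ^ (n - m)) := by ring
      _ = _ := by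
          rw [← h6, pow_add, hs8']
          field_simp
  have hsum : ∑ m ∈ Finset.range (n + 1),
      √8 ^ (m + 2) * 4 ^ (n - m) * ((n + 2).choose (m + 2) : ℝ) ≤ (4 + √8) ^ (n + 2) := by
    have h0 := add_pow (√8 : ℝ) 4 (n + 2)
    rw [Finset.sum_range_succ', Finset.sum_range_succ'] at h0
    have : ∀ m, n + 2 - (m + 1 + 1) = n - m := fun m => by omega
    simp only [this] at h0
    rw [add_comm (4 : ℝ), h0]
    -- The first two terms of the expansion are absent from the sum and are dropped as nonnegative.
    have h1 : 0 ≤ √8 ^ (0 + 1) * (4 : ℝ) ^ (n + 2 - (0 + 1)) * ((n + 2).choose (0 + 1) : ℝ) := by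
      positivity
    have h2 : 0 ≤ √8 ^ 0 * (4 : ℝ) ^ (n + 2 - 0) * ((n + 2).choose 0 : ℝ) := by positivity
    linarith
  rw [motzkin_eq_sum, Nat.cast_sum]
  refine (Finset.sum_le_sum hterm).trans ?_
  rw [← Finset.mul_sum]
  have hsq : √(((n : ℝ) + 1) ^ 3) = (n + 1) * √(n + 1) := by
    have : ((n : ℝ) + 1) ^ 3 = (n + 1) ^ 2 * (n + 1) := by ring
    rw [this, Real.sqrt_mul (by positivity), Real.sqrt_sq hN.le]
  have hself : √((n : ℝ) + 1) * √((n : ℝ) + 1) = n + 1 := Real.mul_self_sqrt hN.le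
  have hspos : 0 < √((n : ℝ) + 1) := Real.sqrt_pos.2 hN
  calc 2 * √((n : ℝ) + 1) / ((n + 1) * (n + 2) * 8) * ∑ m ∈ Finset.range (n + 1),
        √8 ^ (m + 2) * 4 ^ (n - m) * ((n + 2).choose (m + 2) : ℝ)
      ≤ 2 * √((n : ℝ) + 1) / ((n + 1) * (n + 1) * 8) * (4 + √8) ^ (n + 2) := by
        gcongr
        linarith
    _ ≤ 2 * √((n : ℝ) + 1) / ((n + 1) * (n + 1) * 8) * ((4 + √8) ^ (n + 1) * 8) := by
        rw [pow_succ _ (n + 1)]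
        gcongr
        linarith
    _ = 2 * ((4 + √8) ^ (n + 1) / √(((n : ℝ) + 1) ^ 3)) := by
        rw [hsq]
        have h1 : 2 * √((n : ℝ) + 1) / ((n + 1) * (n + 1) * 8) =
            2 * (√((n : ℝ) + 1) / (n + 1)) / ((n + 1) * 8) := by
          field_simp
        have h2 : √((n : ℝ) + 1) / (n + 1) = 1 / √((n : ℝ) + 1) := by
          rw [div_eq_div_iff hN.ne' hspos.ne', hself, one_mul]
        rw [h1, h2]
        field_simp

theorem card_Omega_le (h : ℕ) :
    ((Omega h).card : ℝ) ≤ 2 * ((4 + √8) ^ (h + 1) / √(((h : ℝ) + 1) ^ 3)) :=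
  (Nat.cast_le.2 (card_Omega_le_motzkin h)).trans (motzkin_le h)

theorem isBigO_card_Omega : (fun h : ℕ => ((Omega h).card : ℝ)) =O[atTop]
    fun h : ℕ => (4 + √8) ^ (h + 1) / √(((h : ℝ) + 1) ^ 3) := by
  refine IsBigO.of_bound 2 (Eventually.of_forall fun h => ?_)
  rw [Real.norm_of_nonneg (Nat.cast_nonneg _), Real.norm_of_nonneg (by positivity)]
  exact card_Omega_le h

/-- Since `4 + √8 < 7`, the ratio of the exponentials tends to zero even after multiplication by a
square; this pays for the quadratic cost of handling one state. -/
theorem exists_mul_card_Omega_le : ∃ C : ℕ, ∀ h : ℕ, (h + 1) ^ 2 * (Omega h).card ≤ C * 7 ^ h := by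
  have hs8 : √8 ≤ (2.9 : ℝ) := by
    rw [Real.sqrt_le_left (by norm_num)]
    norm_num
  have hlt : (4 + √8) / 7 < (1 : ℝ) := by
    rw [div_lt_one (by norm_num)]
    linarith
  have hlim := tendsto_pow_const_mul_const_pow_of_abs_lt_one 2
    (r := (4 + √8) / 7) (by rw [abs_of_nonneg (by positivity)]; exact hlt)
  obtain ⟨B, hB⟩ := hlim.bddAbove_range
  obtain ⟨C, hC⟩ := exists_nat_ge (2 * 7 * B)
  refine ⟨C, fun h => ?_⟩
  have h1 : ((h + 1 : ℕ) : ℝ) ^ 2 * ((4 + √8) / 7) ^ (h + 1) ≤ B := hB ⟨h + 1, rfl⟩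
  have h2 : ((Omega h).card : ℝ) ≤ 2 * (4 + √8) ^ (h + 1) := by
    refine (card_Omega_le h).trans ?_
    gcongr
    refine div_le_self (by positivity) ?_
    rw [Real.one_le_sqrt]
    exact one_le_pow₀ (by linarith [Nat.cast_nonneg (α := ℝ) h])
  have h3 : (((h + 1) ^ 2 * (Omega h).card : ℕ) : ℝ) ≤ ((C * 7 ^ h : ℕ) : ℝ) := by
    push_cast
    push_cast at h1
    calc ((h : ℝ) + 1) ^ 2 * (Omega h).card ≤ (h + 1) ^ 2 * (2 * (4 + √8) ^ (h + 1)) := by gcongr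
      _ = (((h : ℝ) + 1) ^ 2 * ((4 + √8) / 7) ^ (h + 1)) * (2 * 7) * 7 ^ h := by
          rw [div_pow, pow_succ (7 : ℝ) h]
          field_simp
      _ ≤ B * (2 * 7) * 7 ^ h := by gcongr
      _ ≤ C * 7 ^ h := by
          gcongr
          linarith
  exact_mod_cast h3

end Counting

/-! ### The number of steps -/

section Steps
variable {h v : ℕ}

/-- The insertion dominates: up to `h + 1` new nodes with `2 * h + 1` children each. -/
theorem steps_record_le (ω : State h) (len : ℝ) (T : List (Edge h v)) (L : Layer ℝ h v) :
    (record ω len T L).steps ≤ 5 * (h + 1) ^ 2 := by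
  have h1 := L.table.steps_find_le (List.ofFn ω)
  have h2 := L.table.steps_insert_le (len, T) (List.ofFn ω)
  have h3 : Fintype.card (Cell h) = 2 * h + 1 := by simp [Cell]
  rw [List.length_ofFn] at h1 h2
  rw [h3] at h2
  have h4 : (record ω len T L).steps ≤ (h + 1) + (L.table.find (List.ofFn ω)).steps +
      (1 + (L.table.insert (len, T) (List.ofFn ω)).steps) := by
    simp only [record, Counted.steps_bind, steps_tick]
    simp only [add_assoc]
    refine Nat.add_le_add_left (Nat.add_le_add_left (Nat.add_le_add_left ?_ _) _) _
    cases (L.table.find (List.ofFn ω)).val with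
    | none => simp
    | some old =>
      simp only [Counted.steps_bind, steps_tick]
      split_ifs <;> simp
  nlinarith

theorem steps_addVert_le (i i' : Fin h) (m : Fin 3) (ω : State h) :
    (addVert i i' m ω).steps ≤ 3 * (h + 1) := by
  rw [addVert]
  simp only [Counted.steps_bind, steps_tick]
  split_ifs
  · simp
    omega
  · simp
    omega

theorem steps_removeVertex_le (i c : Fin h) (ω : State h) :
    (removeVertex i c ω).steps ≤ 3 * h + 1 := by
  rw [removeVertex]
  simp only [Counted.steps_bind, steps_tick]
  split_ifs
  · simp only [Counted.steps_bind, steps_tick]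
    cases (List.finRange h).find? fun k => comp (Function.update ω i none) k = some i <;>
      simp <;> omega
  · simp
    omega

theorem steps_addHoriz_le (mand : Bool) (i : Fin h) (m : Fin 3) (ω : State h) :
    (addHoriz mand i m ω).steps ≤ 3 * (h + 1) := by
  rw [addHoriz.eq_def]
  simp only [Counted.steps_bind, steps_tick]
  rcases hω : ω i with _ | ⟨_ | _, c⟩ <;> fin_cases m <;> dsimp only
  · split_ifs <;> simp <;> omega
  · simp
    omega
  · simp
    omega
  · have := steps_removeVertex_le i c ω
    omega
  · simp
    omega
  · simp
    omega
  · simp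
    omega
  · simp
    omega
  · simp
    omega

theorem steps_transition_le (I : Grid ℝ h v) (e : Edge h v) (m : Fin 3) (ω : State h) :
    (transition I e m ω).steps ≤ 3 * (h + 1) := by
  cases e with
  | vert i i' j => exact steps_addVert_le i i' m ω
  | horiz i j j' => exact steps_addHoriz_le _ i m ω

theorem steps_tryChoice_le (I : Grid ℝ h v) (e : Edge h v) (ω : State h) (len : ℝ)
    (T : List (Edge h v)) (L : Layer ℝ h v) (m : Fin 3) :
    (tryChoice I e ω len T L m).steps ≤ 13 * (h + 1) ^ 2 := by
  have h1 := steps_transition_le I e m ω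
  have h2 : (tryChoice I e ω len T L m).steps ≤
      1 + ((transition I e m ω).steps + (4 + 5 * (h + 1) ^ 2)) := by
    simp only [tryChoice, Counted.steps_bind, steps_tick]
    refine Nat.add_le_add_left (Nat.add_le_add_left ?_ _) _
    cases (transition I e m ω).val with
    | none => simp
    | some ω' =>
      simp only [Counted.steps_bind, steps_tick]
      exact Nat.add_le_add_left (steps_record_le _ _ _ _) _
  nlinarith

theorem steps_expand_le (I : Grid ℝ h v) (L : Layer ℝ h v) (e : Edge h v) (L' : Layer ℝ h v)
    (ω : State h) : (expand I L e L' ω).steps ≤ 41 * (h + 1) ^ 2 := by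
  have h1 := L.table.steps_find_le (List.ofFn ω)
  rw [List.length_ofFn] at h1
  have h2 : (expand I L e L' ω).steps ≤
      (h + 1) + ((L.table.find (List.ofFn ω)).steps + 3 * (13 * (h + 1) ^ 2)) := by
    simp only [expand, Counted.steps_bind, steps_tick]
    refine Nat.add_le_add_left (Nat.add_le_add_left ?_ _) _
    cases (L.table.find (List.ofFn ω)).val with
    | none => simp
    | some r =>
      exact (Counted.foldlM_induction (fun _ => True) (13 * (h + 1) ^ 2) [0, 1, 2]
        (fun L' m _ _ => ⟨trivial, steps_tryChoice_le I e ω r.1 r.2 L' m⟩) L' trivial).2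
  nlinarith

theorem card_Omega_pos (h : ℕ) : 0 < (Omega h).card :=
  Finset.card_pos.2 ⟨_, Finset.mem_filter.2 ⟨Finset.mem_univ _, isState_none⟩⟩

/-- The initial step is absorbed in the constant because `Omega h` is not empty. -/
theorem steps_nextLayer_le (I : Grid ℝ h v) (L : Layer ℝ h v) (e : Edge h v)
    (hL : L.states.length ≤ (Omega h).card) :
    (nextLayer I L e).steps ≤ 42 * ((h + 1) ^ 2 * (Omega h).card) := by
  have h1 := (Counted.foldlM_induction (fun _ : Layer ℝ h v => True) (41 * (h + 1) ^ 2) L.states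
    (fun L' ω _ _ => ⟨trivial, steps_expand_le I L e L' ω⟩) ⟨[], .empty⟩ trivial).2
  have h2 := Nat.mul_le_mul_right (41 * (h + 1) ^ 2) hL
  have h3 : 0 < (h + 1) ^ 2 * (Omega h).card := Nat.mul_pos (by positivity) (card_Omega_pos h)
  rw [nextLayer_eq, Counted.steps_bind, steps_tick]
  have h4 : (Omega h).card * (41 * (h + 1) ^ 2) = 41 * ((h + 1) ^ 2 * (Omega h).card) := by ring
  omega

theorem layer_properties (I : Grid ℝ h v) : ∀ l, (layer I l).val.states.length ≤ (Omega h).card ∧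
    (layer I l).steps ≤ 6 * (h + 1) ^ 2 +
      (edges h v).length * (42 * ((h + 1) ^ 2 * (Omega h).card)) := by
  intro l
  have hadj : ∀ e ∈ (edges h v).take l, e.Adjacent := fun e he =>
    mem_edges.1 (List.mem_of_mem_take he)
  refine ⟨length_states_le (represents_layer I l) hadj, ?_⟩
  have h1 : (firstLayer (K := ℝ) (h := h) (v := v)).steps ≤ 6 * (h + 1) ^ 2 := by
    have := steps_record_le (fun _ : Fin h => none) 0 [] (⟨[], .empty⟩ : Layer ℝ h v)
    simp only [firstLayer, Counted.steps_bind, steps_tick]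
    nlinarith
  -- The invariant only asks that the layer represent the paths along some list of adjacent
  -- segments; this bounds the number of states.
  have h2 := (Counted.foldlM_induction (f := nextLayer I)
    (fun L : Layer ℝ h v => ∃ es, (∀ e ∈ es, e.Adjacent) ∧ Represents I L (Path I es))
    (42 * ((h + 1) ^ 2 * (Omega h).card)) ((edges h v).take l) (fun L e he hL => by
      obtain ⟨es, h3, h4⟩ := hL
      refine ⟨⟨es ++ [e], ?_, h4.nextLayer e⟩, steps_nextLayer_le I L e (length_states_le h4 h3)⟩
      intro e' he'
      rcases List.mem_append.1 he' with he' | he'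
      · exact h3 e' he'
      · rw [List.mem_singleton.1 he']
        exact hadj e he) firstLayer.val ⟨[], by simp, represents_firstLayer I⟩).2
  have h3 : ((edges h v).take l).length ≤ (edges h v).length := by
    rw [List.length_take]
    exact min_le_right _ _
  have h4 := Nat.mul_le_mul_right (42 * ((h + 1) ^ 2 * (Omega h).card)) h3
  rw [layer, Counted.steps_bind]
  omega

theorem steps_best_le (I : Grid ℝ h v) (L : Layer ℝ h v)
    (hL : L.states.length ≤ (Omega h).card) :
    (best I L).steps ≤ 3 * ((h + 1) ^ 2 * (Omega h).card) := by
  have h1 : (best I L).steps ≤ L.states.length * (3 * (h + 1) ^ 2) := by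
    refine (Counted.foldlM_induction (fun _ => True) _ L.states (fun b ω _ _ => ⟨trivial, ?_⟩)
      none trivial).2
    have h2 := L.table.steps_find_le (List.ofFn ω)
    rw [List.length_ofFn] at h2
    simp only [Counted.steps_bind, steps_tick]
    split_ifs
    · simp only [Counted.steps_bind, steps_tick]
      cases b <;> cases (L.table.find (List.ofFn ω)).val <;> simp <;> nlinarith
    · simp
      nlinarith
  refine h1.trans ((Nat.mul_le_mul_right _ hL).trans (le_of_eq ?_))
  ring

theorem steps_multi (T : List (Edge h v)) : (multi T).steps ≤ 4 * (h * v) + 2 * T.length := by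
  rw [multi, Counted.steps_bind, steps_tick]
  refine Nat.add_le_add_left ?_ _
  rw [mul_comm]
  exact (Counted.foldlM_induction (fun _ => True) 2 T (fun M e _ _ => ⟨trivial, by simp⟩) _
    trivial).2

theorem euler_bounds (k : ℕ) (st : List (Vertex h v)) (M : Multi h v)
    (circuit : List (Vertex h v)) : (euler k st M circuit).steps ≤ 8 * k ∧
      (euler k st M circuit).val.length ≤ k + circuit.length := by
  induction k generalizing st M circuit with
  | zero => simp [euler]
  | succ k ih =>
    cases st with
    | nil =>
      simp [euler]
      omega
    | cons u st =>
      rw [euler]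
      simp only [Counted.steps_bind, Counted.val_bind, steps_tick]
      cases (neighbours u).find? fun w => 0 < M u w with
      | some w =>
        have := ih (w :: u :: st) (M.modify (· - 1) u w) circuit
        simp only [Counted.steps_bind, Counted.val_bind, steps_tick]
        omega
      | none =>
        have := ih st M (u :: circuit)
        simp only [Counted.steps_bind, Counted.val_bind, steps_tick]
        rw [List.length_cons] at this
        omega

theorem steps_shortcut_le (I : Grid ℝ h v) (seen : Vertex h v → Bool) (l : List (Vertex h v)) :
    (shortcut I seen l).steps ≤ 5 * l.length + 1 := by
  induction l generalizing seen with
  | nil => simp [shortcut]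
  | cons u l ih =>
    rw [shortcut]
    simp only [Counted.steps_bind, steps_tick, List.length_cons]
    split_ifs
    · have := ih (Function.update seen u true)
      simp only [Counted.steps_bind, steps_tick, Counted.steps_pure]
      omega
    · have := ih seen
      omega

theorem steps_solve_le (I : Grid ℝ h v) (hh : 0 < h) (hv : 0 < v) :
    (solve I).steps ≤ 250 * ((h + 1) ^ 2 * (Omega h).card * (h * v)) := by
  set X := (h + 1) ^ 2 * (Omega h).card with hX
  have hX0 : 0 < X := Nat.mul_pos (by positivity) (card_Omega_pos h)
  have hhv : 0 < h * v := Nat.mul_pos hh hv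
  have hedges := length_edges_le h v
  have h1 : h * v ≤ X * (h * v) := Nat.le_mul_of_pos_left _ hX0
  have h2 : X ≤ X * (h * v) := Nat.le_mul_of_pos_right _ hhv
  -- The constant is `6` for the first layer, `2 * 42` for the at most `2 * (h * v)` segments, and
  -- `3` for the choice of the best entry.
  have hsub : (tourSubgraph I).steps ≤ 93 * (X * (h * v)) := by
    obtain ⟨h3, h4⟩ := layer_properties I (edges h v).length
    have h5 := steps_best_le I _ h3
    rw [← hX] at h4 h5
    have h6 : (edges h v).length * (42 * X) ≤ 84 * (X * (h * v)) := by
      refine (Nat.mul_le_mul_right _ hedges).trans (le_of_eq ?_)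
      ring
    have h7 : (h + 1) ^ 2 ≤ X := Nat.le_mul_of_pos_right _ (card_Omega_pos h)
    rw [tourSubgraph, Counted.steps_bind]
    omega
  have hlen : ∀ r, (tourSubgraph I).val = some r → r.2.length ≤ 4 * (h * v) := by
    intro r hr
    have h3 := represents_layer I (edges h v).length
    rw [List.take_length] at h3
    obtain ⟨-, ω, -, hp⟩ := (best_spec h3).1 r hr
    have := hp.length_le
    omega
  rw [solve]
  simp only [Counted.steps_bind, steps_tick]
  split_ifs
  · simp only [Counted.steps_bind, steps_tick, Counted.steps_pure]
    omega
  · simp only [Counted.steps_bind]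
    rcases hr : (tourSubgraph I).val with _ | ⟨len, _ | ⟨e, T⟩⟩
    · simp only [Counted.steps_pure]
      omega
    · simp only [Counted.steps_pure]
      omega
    · have h3 : (e :: T).length ≤ 4 * (h * v) := hlen _ hr
      have h4 := steps_multi (e :: T)
      obtain ⟨h5, h6⟩ := euler_bounds (8 * (h * v) + 1) [e.src] (multi (e :: T)).val []
      have h7 := steps_shortcut_le I (fun _ => false)
        (euler (8 * (h * v) + 1) [e.src] (multi (e :: T)).val []).val
      simp only [Counted.steps_bind, steps_tick]
      rw [List.length_nil, add_zero] at h6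
      omega

theorem exists_steps_tsp_le : ∃ C : ℕ, ∀ (P : Finset (ℝ × ℝ)) (pts : List (ℝ × ℝ)), P.Nonempty →
    Enumerates pts P → pts.Pairwise (fun p q => p.1 ≤ q.1) →
    (tsp pts).steps ≤ C * (P.card * numRows P * 7 ^ numRows P) := by
  obtain ⟨C, hC⟩ := exists_mul_card_Omega_le
  refine ⟨250 * C + 12, fun P pts hP hpts hsort => ?_⟩
  have h1 := steps_buildGrid_le hpts hsort
  have h2 := steps_solve_le (hanan P) (numRows_pos hP) (numCols_pos hP)
  have h3 : (tsp pts).steps = (buildGrid pts).steps + (solve (hanan P)).steps := by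
    rw [tsp, Counted.steps_bind, buildGrid_val hpts hsort]
  have hv := numCols_le P
  have hh0 := numRows_pos hP
  have hn0 : 0 < P.card := Finset.card_pos.2 hP
  rw [h3]
  generalize (buildGrid pts).steps = a at h1 ⊢
  generalize (solve (hanan P)).steps = b at h2 ⊢
  have hC' := hC (numRows P)
  generalize (Omega (numRows P)).card = w at hC' h2
  generalize numRows P = h at h1 h2 hC' hh0 ⊢
  generalize numCols P = v at h1 h2 hv
  generalize P.card = n at h1 hv hn0 ⊢
  have h4 : b ≤ 250 * C * (n * h * 7 ^ h) := by
    calc b ≤ 250 * ((h + 1) ^ 2 * w * (h * v)) := h2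
      _ ≤ 250 * (C * 7 ^ h * (h * n)) := by gcongr
      _ = 250 * C * (n * h * 7 ^ h) := by ring
  -- Each of the two terms `n * (h + 2)` is at most three times `n * h`; the remaining terms account
  -- for six more.
  have h5 : a ≤ 12 * (n * h) := by
    have h6 : h * v ≤ n * h := by
      rw [mul_comm n]
      exact Nat.mul_le_mul_left _ hv
    have h7 : h ≤ n * h := Nat.le_mul_of_pos_left _ hn0
    have h8 : n ≤ n * h := Nat.le_mul_of_pos_right _ hh0
    have h9 : n * (h + 2) = n * h + 2 * n := by ring
    omega
  have h6 : n * h ≤ n * h * 7 ^ h := Nat.le_mul_of_pos_right _ (by positivity)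
  rw [add_mul]
  omega

end Steps

end RTSP

theorem mainTheorem1 :
    ((fun h : ℕ => ((RTSP.Omega h).card : ℝ)) =O[atTop]
      fun h : ℕ => (4 + √8) ^ (h + 1) / √(((h : ℝ) + 1) ^ 3)) ∧
    (∀ P : Finset (ℝ × ℝ), P.Nonempty →
      (RTSP.edges (RTSP.numRows P) (RTSP.numCols P)).length
          + RTSP.numRows P + RTSP.numCols P = 2 * RTSP.numRows P * RTSP.numCols P ∧
      ∀ l ≤ (RTSP.edges (RTSP.numRows P) (RTSP.numCols P)).length,
        (∀ ω ∈ (RTSP.layer (RTSP.hanan P) l).val.states, ω ∈ RTSP.Omega (RTSP.numRows P)) ∧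
        (RTSP.layer (RTSP.hanan P) l).val.states.length ≤ (RTSP.Omega (RTSP.numRows P)).card) ∧
    ∃ C : ℕ, ∀ (P : Finset (ℝ × ℝ)) (pts : List (ℝ × ℝ)), P.Nonempty →
      RTSP.Enumerates pts P → pts.Pairwise (fun p q => p.1 ≤ q.1) →
      (RTSP.buildGrid pts).val = ⟨RTSP.numRows P, RTSP.numCols P, RTSP.hanan P⟩ ∧
      RTSP.Enumerates (RTSP.tsp pts).val P ∧
      (∀ σ, RTSP.Enumerates σ P →
        RTSP.tourLength (RTSP.tsp pts).val ≤ RTSP.tourLength σ) ∧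
      (RTSP.tsp pts).steps ≤ C * (P.card * RTSP.numRows P * 7 ^ RTSP.numRows P) := by
  refine ⟨RTSP.isBigO_card_Omega, fun P hP => ⟨RTSP.length_edges (RTSP.numRows_pos hP)
    (RTSP.numCols_pos hP), fun l _ => ?_⟩, ?_⟩
  · have hadj : ∀ e ∈ (RTSP.edges (RTSP.numRows P) (RTSP.numCols P)).take l, e.Adjacent :=
      fun e he => RTSP.mem_edges.1 (List.mem_of_mem_take he)
    have hL := RTSP.represents_layer (RTSP.hanan P) l
    exact ⟨fun ω hω => RTSP.mem_Omega_of_mem_states hL hadj hω, RTSP.length_states_le hL hadj⟩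
  · obtain ⟨C, hC⟩ := RTSP.exists_steps_tsp_le
    refine ⟨C, fun P pts hP hpts hsort => ?_⟩
    have hgrid := RTSP.buildGrid_val hpts hsort
    have htsp : (RTSP.tsp pts).val = (RTSP.solve (RTSP.hanan P)).val := by
      rw [RTSP.tsp, RTSP.Counted.val_bind, hgrid]
    have hsolve := RTSP.solve_hanan_spec hP
    rw [← htsp] at hsolve
    exact ⟨hgrid, hsolve.1, hsolve.2, hC P pts hP hpts hsort⟩
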